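/- A crossed module $(H,G,\mu)$ is a group homomorphism $\mu\colon H\to G$ with an action of $G$ on $H$ such that $\mu({}^gh)=g\mu(h)g^{-1}$ and ${}^{\mu(h)}h'=hh'h^{-1}$. It is abelian if $G$ and $H$ are abelian and $G$ acts trivially on $H$. Morphisms are commutative squares of group homomorphisms compatible with the actions; short exact sequences are those that are short exact sequences of groups in both components. The free crossed module on a set $S$ is the inclusion crossed module of $\ker\big((0\ 1)\colon F_S*F_S\to F_S\big)$ in $F_S*F_S$, where $F_S$ is the free group on $S$ and $(0\ 1)$ is trivial on the first factor and the identity on the second; this is the value at $S$ of the left adjoint of the functor $(H,G,\mu)\mapsto H\times G$ to sets. A crossed module is free if it is isomorphic to one of these. The nerve $N_*(H,G,\mu)$ is the simplicial group obtained as the nerve of the internal category in groups with group of objects $G$, group of arrows $H\rtimes G$, source $(h,g)\mapsto g$ and target $(h,g)\mapsto\mu(h)g$; so $N_n=H\rtimes(\cdots(H\rtimes G)\cdots)$ with $n$ factors $H$, and the faces are $d_0(h_1,\dots,h_n,g)=(h_2,\dots,h_n,g)$, $d_i(h_1,\dots,h_n,g)=(h_1,\dots,h_ih_{i+1},\dots,h_n,g)$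 for $0<i<n$, and $d_n(h_1,\dots,h_n,g)=(h_1,\dots,h_{n-1},\mu(h_n)g)$. An action of $(H,G,\mu)$ on an abelian crossed module $(C,A,\nu)$ (written additively) consists of actions of $G$ on $C$ and $A$ by group automorphisms and a map $\xi\colon H\times A\to C$ such that $\nu({}^gc)={}^g\nu(c)$, $\nu\xi(h,a)={}^{\mu(h)}a-a$, $\xi(h,\nu(c))={}^{\mu(h)}c-c$, ${}^g\xi(h,a)=\xi({}^gh,{}^ga)$, $\xi(hh',a)={}^{\mu(h)}\xi(h',a)+\xi(h,a)$ and $\xi(h,a+a')=\xi(h,a)+\xi(h,a')$. It induces an action of the simplicial group $G_*=N_*(H,G,\mu)$ on the abelian simplicial group $A_*=N_*(C,A,\nu)$, given by conjugation in the nerve of the corresponding semidirect product crossed module. Let $B_*(G_n)$ be the standard (bar) resolution. The complexes $B_*(G_n)\otimes_{G_n}A_n$, $n\ge 0$, together with the alternating sums of face maps in the direction of $n$, form a bicomplex, and $H_n((H,G,\mu),(C,A,\nu))$ is the $n$th homology group of its total complex. For the trivial action on $(0,\mathbb Z,0)$ one writes $H_n(H,G,\mu)$; this is the Baues–Ellis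 homology of $(H,G,\mu)$. Let $$0\to(R',F',\eta')\xrightarrow{\ i\ }(R,F,\eta)\xrightarrow{\ p\ }(H,G,\mu)\to 0$$ be any free presentation of a crossed module $(H,G,\mu)$, that is, a short exact sequence of crossed modules with $(R,F,\eta)$ free. Let $(R',F',\eta')_{ab}=(R'/[F',R'],\,F'/[F',F'],\,\eta')$, where $[F',R']$ is the normal subgroup of $R'$ generated by all ${}^xy\,y^{-1}$ with $x\in F'$, $y\in R'$. Let $(H,G,\mu)$ act on it by the action induced by conjugation in $(R,F,\eta)$: regarding $R'$ and $F'$ as subgroups of $R$ and $F$ via $i$, for $f\in F$, $r\in R$, $x\in F'$, $y\in R'$, $${}^{p(f)}[x]=[fxf^{-1}],\qquad {}^{p(f)}[y]=[{}^fy],\qquad \xi(p(r),[x])=[\,r\cdot{}^x(r^{-1})\,].$$ Then there is an isomorphism of abelian groups $$H_3(H,G,\mu)\cong H_1\big((H,G,\mu),(R',F',\eta')_{ab}\big).$$ -/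

import Mathlib

open CategoryTheory

universe u

/-! ### Crossed modules -/

/-- A crossed module `(H, G, μ)`: a homomorphism `μ : H → G` and an action of `G` on `H` by group
automorphisms, satisfying the precrossed module identity and the Peiffer identity. -/
structure CrossedModule (H G : Type u) [Group H] [Group G] where
  /-- the structure homomorphism -/
  μ : H →* G
  /-- the action of `G` on `H` -/
  act : G →* MulAut H
  μ_act : ∀ g h, μ (act g h) = g * μ h * g⁻¹
  peiffer : ∀ h h', act (μ h) h' = h * h' * h⁻¹

namespace CrossedModule

/-- A morphism `(top, bot)` of crossed modules. -/
structure Hom {H G H' G' : Type u} [Group H] [Group G] [Group H'] [Group G']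
    (X : CrossedModule H G) (X' : CrossedModule H' G') where
  /-- the component `H → H'` -/
  top : H →* H'
  /-- the component `G → G'` -/
  bot : G →* G'
  comm : ∀ h, bot (X.μ h) = X'.μ (top h)
  equivariant : ∀ g h, top (X.act g h) = X'.act (bot g) (top h)

/-- The inclusion crossed module of a normal subgroup, with the conjugation action. -/
def inclusion {G : Type u} [Group G] (N : Subgroup G) [N.Normal] : CrossedModule N G where
  μ := N.subtype
  act := MulAut.conjNormal
  μ_act g h := by simp
  peiffer h h' := by ext; simp

/-- The kernel of the retraction `(0 1) : F_S + F_S → F_S` of the second coproduct injection into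
the free product of two copies of the free group on `S` (equivalently, the normal closure of the
image of the first injection). -/
def freeTop (S : Type u) : Subgroup (Monoid.Coprod (FreeGroup S) (FreeGroup S)) :=
  (Monoid.Coprod.lift (1 : FreeGroup S →* FreeGroup S) (MonoidHom.id (FreeGroup S))).ker

instance (S : Type u) : (freeTop S).Normal :=
  inferInstanceAs (MonoidHom.ker _).Normal

/-- The free crossed module on the set `S`: the value at `S` of the left adjoint to the functor
sending `(H, G, μ)` to the set `H × G`. -/
def free (S : Type u) :
    CrossedModule (freeTop S) (Monoid.Coprod (FreeGroup S) (FreeGroup S)) :=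
  inclusion (freeTop S)

/-- A crossed module is free (with respect to sets) if it is isomorphic to the free crossed
module on some set. -/
def IsFree {R F : Type u} [Group R] [Group F] (X : CrossedModule R F) : Prop :=
  ∃ (S : Type u) (e : Hom (free S) X), Function.Bijective e.top ∧ Function.Bijective e.bot

/-- A short exact sequence `0 → X' → X → X'' → 0` of crossed modules. -/
structure IsShortExact {H' G' H G H'' G'' : Type u} [Group H'] [Group G'] [Group H] [Group G]
    [Group H''] [Group G''] {X' : CrossedModule H' G'} {X : CrossedModule H G}
    {X'' : CrossedModule H'' G''} (i : Hom X' X) (p : Hom X X'') : Prop where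
  top_injective : Function.Injective i.top
  bot_injective : Function.Injective i.bot
  top_exact : i.top.range = p.top.ker
  bot_exact : i.bot.range = p.bot.ker
  top_surjective : Function.Surjective p.top
  bot_surjective : Function.Surjective p.bot

/-! ### Abelian crossed modules, actions and abelianisation

An abelian crossed module `(C, A, ν)` (both groups abelian, `A` acting trivially on `C`) is the
same thing as a homomorphism `ν : C →+ A` of (additive) abelian groups. -/

/-- An action of a crossed module `(H, G, μ)` on an abelian crossed module `(C, A, ν)`: actions of
`G` on `C` and `A` and a map `ξ : H × A → C` satisfying the usual identities, written additively.
(The identity relating the actions of `G` to the action of `A` on `C` is void, the latter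
being trivial.) -/
structure Action {H G C A : Type u} [Group H] [Group G] [AddCommGroup C] [AddCommGroup A]
    (X : CrossedModule H G) (ν : C →+ A) where
  /-- the action of `G` on `C` -/
  actC : G →* AddMonoid.End C
  /-- the action of `G` on `A` -/
  actA : G →* AddMonoid.End A
  /-- the map `H × A → C` -/
  ξ : H → A → C
  ν_act : ∀ g c, ν (actC g c) = actA g (ν c)
  ν_ξ : ∀ h a, ν (ξ h a) = actA (X.μ h) a - a
  ξ_ν : ∀ h c, ξ h (ν c) = actC (X.μ h) c - c
  act_ξ : ∀ g h a, actC g (ξ h a) = ξ (X.act g h) (actA g a)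
  ξ_mul : ∀ h h' a, ξ (h * h') a = actC (X.μ h) (ξ h' a) + ξ h a
  ξ_add : ∀ h a a', ξ h (a + a') = ξ h a + ξ h a'

/-- The trivial action. It exists for the crossed module `(0, A, 0)`. -/
def trivialAction {H G : Type u} [Group H] [Group G] (X : CrossedModule H G)
    (A : Type u) [AddCommGroup A] : Action X (0 : PUnit.{u + 1} →+ A) where
  actC := 1
  actA := 1
  ξ _ _ := 0
  ν_act _ _ := by simp
  ν_ξ _ _ := by simp
  ξ_ν _ _ := by simp
  act_ξ _ _ _ := by simp
  ξ_mul _ _ _ := by simp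
  ξ_add _ _ _ := by simp

section Abelianisation

variable {H G : Type u} [Group H] [Group G]

/-- `[G, H]`: the normal subgroup of `H` generated by the elements `ᵍh h⁻¹`. -/
def commTop (X : CrossedModule H G) : Subgroup H :=
  Subgroup.normalClosure {x | ∃ g h, x = X.act g h * h⁻¹}

instance (X : CrossedModule H G) : X.commTop.Normal := Subgroup.normalClosure_normal

theorem act_mul_inv_mem (X : CrossedModule H G) (g : G) (h : H) :
    X.act g h * h⁻¹ ∈ X.commTop :=
  Subgroup.subset_normalClosure ⟨g, h, rfl⟩

theorem mk_act (X : CrossedModule H G) (g : G) (h : H) :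
    (QuotientGroup.mk (X.act g h) : H ⧸ X.commTop) = QuotientGroup.mk h := by
  have h1 : (QuotientGroup.mk (X.act g h * h⁻¹) : H ⧸ X.commTop) = 1 :=
    (QuotientGroup.eq_one_iff _).2 (X.act_mul_inv_mem g h)
  rw [QuotientGroup.mk_mul, QuotientGroup.mk_inv] at h1
  exact mul_inv_eq_one.1 h1

/-- The top group `H / [G, H]` of the abelianisation of `(H, G, μ)`. -/
abbrev AbTop (X : CrossedModule H G) : Type u := H ⧸ X.commTop

instance (X : CrossedModule H G) : CommGroup X.AbTop :=
  { (inferInstance : Group (H ⧸ X.commTop)) with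
    mul_comm := by
      rintro ⟨a⟩ ⟨b⟩
      have h := X.mk_act (X.μ a) b
      rw [X.peiffer, QuotientGroup.mk_mul, QuotientGroup.mk_mul, QuotientGroup.mk_inv] at h
      exact mul_inv_eq_iff_eq_mul.1 h }

/-- The homomorphism `H / [G, H] → G / [G, G]` induced by `μ`, in multiplicative notation. -/
def abMap (X : CrossedModule H G) : X.AbTop →* Abelianization G :=
  QuotientGroup.lift X.commTop (Abelianization.of.comp X.μ) (by
    have h : X.commTop ≤ (Abelianization.of.comp X.μ).ker := by
      refine Subgroup.normalClosure_le_normal ?_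
      rintro _ ⟨g, h, rfl⟩
      simp [MonoidHom.mem_ker, X.μ_act]
    exact fun x hx => h hx)

/-- The abelianisation `(H, G, μ)_ab = (H / [G, H], G / [G, G], μ)`, an abelian crossed module. -/
def ab (X : CrossedModule H G) : Additive X.AbTop →+ Additive (Abelianization G) :=
  MonoidHom.toAdditive X.abMap

end Abelianisation

/-! ### The action on the abelianised kernel of a short exact sequence

For a short exact sequence `0 → (R', F', η') → (R, F, η) → (H, G, μ) → 0`, the crossed module
`(R, F, η)` acts on its normal subobject `(R', F', η')` by conjugation, via `x ↦ f x f⁻¹` on `F'`,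
`y ↦ ᶠy` on `R'` and `(r, x) ↦ r ˣ(r⁻¹) ∈ R'`. On `(R', F', η')_ab` this induces an action of
`(H, G, μ)`. -/

namespace IsShortExact

variable {R' F' R F H G : Type u} [Group R'] [Group F'] [Group R] [Group F] [Group H] [Group G]
  {X' : CrossedModule R' F'} {X : CrossedModule R F} {Y : CrossedModule H G}
  {i : Hom X' X} {p : Hom X Y}

theorem exists_top (e : IsShortExact i p) {r : R} (h : p.top r = 1) : ∃ y, i.top y = r := by
  have : r ∈ i.top.range := by rw [e.top_exact]; exact h
  exact this

theorem exists_bot (e : IsShortExact i p) {f : F} (h : p.bot f = 1) : ∃ x, i.bot x = f := by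
  have : f ∈ i.bot.range := by rw [e.bot_exact]; exact h
  exact this

theorem p_i_top (e : IsShortExact i p) (y : R') : p.top (i.top y) = 1 := by
  have : i.top y ∈ p.top.ker := by rw [← e.top_exact]; exact ⟨y, rfl⟩
  exact this

theorem p_i_bot (e : IsShortExact i p) (x : F') : p.bot (i.bot x) = 1 := by
  have : i.bot x ∈ p.bot.ker := by rw [← e.bot_exact]; exact ⟨x, rfl⟩
  exact this

theorem exists_conjBot (e : IsShortExact i p) (f : F) (x : F') :
    ∃ x', i.bot x' = f * i.bot x * f⁻¹ :=
  e.exists_bot (by simp [e.p_i_bot])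

theorem exists_conjTop (e : IsShortExact i p) (f : F) (y : R') :
    ∃ y', i.top y' = X.act f (i.top y) :=
  e.exists_top (by simp [p.equivariant, e.p_i_top])

theorem exists_bracket (e : IsShortExact i p) (r : R) (x : F') :
    ∃ y, i.top y = r * X.act (i.bot x) r⁻¹ :=
  e.exists_top (by simp [p.equivariant, e.p_i_bot])

/-- The action of `f ∈ F` on `F'` by conjugation in `F`. -/
noncomputable def conjBot (e : IsShortExact i p) (f : F) : F' →* F' where
  toFun x := (e.exists_conjBot f x).choose
  map_one' := e.bot_injective (by rw [(e.exists_conjBot f 1).choose_spec]; simp)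
  map_mul' x x' := e.bot_injective (by
    refine (e.exists_conjBot f (x * x')).choose_spec.trans ?_
    rw [map_mul, map_mul, (e.exists_conjBot f x).choose_spec, (e.exists_conjBot f x').choose_spec]
    group)

theorem i_conjBot (e : IsShortExact i p) (f : F) (x : F') :
    i.bot (e.conjBot f x) = f * i.bot x * f⁻¹ :=
  (e.exists_conjBot f x).choose_spec

/-- The action of `f ∈ F` on `R'`, restricted from `R`. -/
noncomputable def conjTop (e : IsShortExact i p) (f : F) : R' →* R' where
  toFun y := (e.exists_conjTop f y).choose
  map_one' := e.top_injective (by rw [(e.exists_conjTop f 1).choose_spec]; simp)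
  map_mul' y y' := e.top_injective (by
    refine (e.exists_conjTop f (y * y')).choose_spec.trans ?_
    rw [map_mul, map_mul, map_mul, (e.exists_conjTop f y).choose_spec,
      (e.exists_conjTop f y').choose_spec])

theorem i_conjTop (e : IsShortExact i p) (f : F) (y : R') :
    i.top (e.conjTop f y) = X.act f (i.top y) :=
  (e.exists_conjTop f y).choose_spec

/-- The element `r ˣ(r⁻¹)` of `R'`, for `r ∈ R` and `x ∈ F'`. -/
noncomputable def bracket (e : IsShortExact i p) (r : R) (x : F') : R' :=
  (e.exists_bracket r x).choose

theorem i_bracket (e : IsShortExact i p) (r : R) (x : F') :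
    i.top (e.bracket r x) = r * X.act (i.bot x) r⁻¹ :=
  (e.exists_bracket r x).choose_spec

theorem conjTop_act (e : IsShortExact i p) (f : F) (x : F') (y : R') :
    e.conjTop f (X'.act x y) = X'.act (e.conjBot f x) (e.conjTop f y) :=
  e.top_injective (by
    simp only [i_conjTop, i.equivariant, i_conjBot, map_mul, MulAut.mul_apply, map_inv]
    simp)

theorem commTop_le (e : IsShortExact i p) (f : F) :
    X'.commTop ≤ X'.commTop.comap (e.conjTop f) := by
  refine Subgroup.normalClosure_le_normal ?_
  rintro _ ⟨x, y, rfl⟩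
  simp only [SetLike.mem_coe, Subgroup.mem_comap, map_mul, map_inv, conjTop_act]
  exact X'.act_mul_inv_mem _ _

/-- The endomorphism of `F'/[F', F']` induced by `conjBot`. -/
noncomputable def abBot (e : IsShortExact i p) (f : F) :
    AddMonoid.End (Additive (Abelianization F')) :=
  MonoidHom.toAdditive (Abelianization.map (e.conjBot f))

/-- The endomorphism of `R'/[F', R']` induced by `conjTop`. -/
noncomputable def abTop (e : IsShortExact i p) (f : F) :
    AddMonoid.End (Additive X'.AbTop) :=
  MonoidHom.toAdditive (QuotientGroup.map _ _ (e.conjTop f) (e.commTop_le f))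

/-- The homomorphism `F'/[F', F'] → R'/[F', R']` induced by `bracket r`. -/
noncomputable def abBracket (e : IsShortExact i p) (r : R) :
    Additive (Abelianization F') →+ Additive X'.AbTop :=
  MonoidHom.toAdditive (Abelianization.lift (A := X'.AbTop)
    { toFun := fun x => QuotientGroup.mk (e.bracket r x)
      map_one' := by
        have : e.bracket r 1 = 1 := e.top_injective (by simp [i_bracket])
        rw [this]; rfl
      map_mul' := fun x x' => by
        have : e.bracket r (x * x') = e.bracket r x * X'.act x (e.bracket r x') :=
          e.top_injective (by
            simp [i_bracket, i.equivariant, MulAut.mul_apply])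
        rw [this, QuotientGroup.mk_mul, mk_act] })

/-- The class in `F'/[F', F']`. -/
abbrev clsBot (_ : IsShortExact i p) (x : F') : Additive (Abelianization F') :=
  Additive.ofMul (Abelianization.of x)

/-- The class in `R'/[F', R']`. -/
abbrev clsTop (_ : IsShortExact i p) (y : R') : Additive X'.AbTop :=
  Additive.ofMul (QuotientGroup.mk y : X'.AbTop)

theorem clsBot_surjective (e : IsShortExact i p) : Function.Surjective e.clsBot := by
  rintro ⟨x⟩; exact ⟨x, rfl⟩

theorem clsTop_surjective (e : IsShortExact i p) : Function.Surjective e.clsTop := by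
  rintro ⟨y⟩; exact ⟨y, rfl⟩

theorem clsTop_mul (e : IsShortExact i p) (y y' : R') :
    e.clsTop (y * y') = e.clsTop y + e.clsTop y' := rfl

theorem clsTop_act (e : IsShortExact i p) (x : F') (y : R') :
    e.clsTop (X'.act x y) = e.clsTop y := congrArg Additive.ofMul (X'.mk_act x y)

theorem abBot_cls (e : IsShortExact i p) (f : F) (x : F') :
    e.abBot f (e.clsBot x) = e.clsBot (e.conjBot f x) := rfl

theorem abTop_cls (e : IsShortExact i p) (f : F) (y : R') :
    e.abTop f (e.clsTop y) = e.clsTop (e.conjTop f y) := rfl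

theorem abBracket_cls (e : IsShortExact i p) (r : R) (x : F') :
    e.abBracket r (e.clsBot x) = e.clsTop (e.bracket r x) := rfl

theorem ab_cls (e : IsShortExact i p) (y : R') : X'.ab (e.clsTop y) = e.clsBot (X'.μ y) := rfl

theorem abBot_mul (e : IsShortExact i p) (f f' : F) :
    e.abBot (f * f') = e.abBot f * e.abBot f' := by
  refine AddMonoidHom.ext fun a => ?_
  obtain ⟨x, rfl⟩ := e.clsBot_surjective a
  change e.abBot (f * f') _ = e.abBot f (e.abBot f' _)
  rw [abBot_cls, abBot_cls, abBot_cls]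
  congr 1
  exact e.bot_injective (by simp [i_conjBot, mul_assoc])

theorem abTop_mul (e : IsShortExact i p) (f f' : F) :
    e.abTop (f * f') = e.abTop f * e.abTop f' := by
  refine AddMonoidHom.ext fun a => ?_
  obtain ⟨x, rfl⟩ := e.clsTop_surjective a
  change e.abTop (f * f') _ = e.abTop f (e.abTop f' _)
  rw [abTop_cls, abTop_cls, abTop_cls]
  congr 1
  exact e.top_injective (by simp [i_conjTop, MulAut.mul_apply])

theorem abBot_i (e : IsShortExact i p) (x : F') : e.abBot (i.bot x) = 1 := by
  refine AddMonoidHom.ext fun a => ?_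
  obtain ⟨x', rfl⟩ := e.clsBot_surjective a
  have : e.conjBot (i.bot x) x' = x * x' * x⁻¹ := e.bot_injective (by simp [i_conjBot])
  change e.abBot _ _ = e.clsBot x'
  rw [abBot_cls, this]
  exact congrArg Additive.ofMul (by simp)

theorem abTop_i (e : IsShortExact i p) (x : F') : e.abTop (i.bot x) = 1 := by
  refine AddMonoidHom.ext fun a => ?_
  obtain ⟨y, rfl⟩ := e.clsTop_surjective a
  have : e.conjTop (i.bot x) y = X'.act x y :=
    e.top_injective (by simp [i_conjTop, i.equivariant])
  change e.abTop _ _ = e.clsTop y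
  rw [abTop_cls, this, clsTop_act]

theorem abBot_one (e : IsShortExact i p) : e.abBot 1 = 1 := by
  simpa using e.abBot_i 1

theorem abTop_one (e : IsShortExact i p) : e.abTop 1 = 1 := by
  simpa using e.abTop_i 1

theorem abBot_congr (e : IsShortExact i p) {f f' : F} (h : p.bot f = p.bot f') :
    e.abBot f = e.abBot f' := by
  obtain ⟨x, hx⟩ := e.exists_bot (f := f'⁻¹ * f) (by simp [h])
  have : f = f' * i.bot x := by rw [hx]; group
  rw [this, abBot_mul, abBot_i, mul_one]

theorem abTop_congr (e : IsShortExact i p) {f f' : F} (h : p.bot f = p.bot f') :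
    e.abTop f = e.abTop f' := by
  obtain ⟨x, hx⟩ := e.exists_bot (f := f'⁻¹ * f) (by simp [h])
  have : f = f' * i.bot x := by rw [hx]; group
  rw [this, abTop_mul, abTop_i, mul_one]

theorem abBracket_mul (e : IsShortExact i p) (r r' : R) (a : Additive (Abelianization F')) :
    e.abBracket (r * r') a = e.abTop (X.μ r) (e.abBracket r' a) + e.abBracket r a := by
  obtain ⟨x, rfl⟩ := e.clsBot_surjective a
  rw [abBracket_cls, abBracket_cls, abBracket_cls, abTop_cls, ← clsTop_mul]
  congr 1
  exact e.top_injective (by simp [i_bracket, i_conjTop, X.peiffer, mul_assoc])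

theorem abBracket_i (e : IsShortExact i p) (y : R') (a : Additive (Abelianization F')) :
    e.abBracket (i.top y) a = 0 := by
  obtain ⟨x, rfl⟩ := e.clsBot_surjective a
  have : e.bracket (i.top y) x = y * X'.act x y⁻¹ :=
    e.top_injective (by simp [i_bracket, i.equivariant])
  rw [abBracket_cls, this, clsTop_mul, clsTop_act, ← clsTop_mul, mul_inv_cancel]
  rfl

theorem abBracket_congr (e : IsShortExact i p) {r r' : R} (h : p.top r = p.top r')
    (a : Additive (Abelianization F')) : e.abBracket r a = e.abBracket r' a := by
  obtain ⟨y, hy⟩ := e.exists_top (r := r'⁻¹ * r) (by simp [h])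
  have : r = r' * i.top y := by rw [hy]; group
  rw [this, abBracket_mul, abBracket_i, map_zero, zero_add]

/-- The induced action of `(H, G, μ)` on `(R', F', η')_ab`: elements of `H` and `G` act through
arbitrary lifts to `R` and `F`. -/
noncomputable def abAction (e : IsShortExact i p) : Action Y X'.ab where
  actC :=
    { toFun := fun g => e.abTop (Function.surjInv e.bot_surjective g)
      map_one' := by
        rw [← e.abTop_one]
        exact e.abTop_congr (by simp [Function.surjInv_eq])
      map_mul' := fun g g' => by
        rw [← e.abTop_mul]
        exact e.abTop_congr (by simp [Function.surjInv_eq]) }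
  actA :=
    { toFun := fun g => e.abBot (Function.surjInv e.bot_surjective g)
      map_one' := by
        rw [← e.abBot_one]
        exact e.abBot_congr (by simp [Function.surjInv_eq])
      map_mul' := fun g g' => by
        rw [← e.abBot_mul]
        exact e.abBot_congr (by simp [Function.surjInv_eq]) }
  ξ h a := e.abBracket (Function.surjInv e.top_surjective h) a
  ν_act g c := by
    obtain ⟨y, rfl⟩ := e.clsTop_surjective c
    change X'.ab (e.abTop _ _) = e.abBot _ _
    rw [abTop_cls, ab_cls, ab_cls, abBot_cls]
    congr 1
    exact e.bot_injective (by simp [i_conjBot, i.comm, i_conjTop, X.μ_act])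
  ν_ξ h a := by
    obtain ⟨x, rfl⟩ := e.clsBot_surjective a
    change X'.ab (e.abBracket _ _) = e.abBot _ _ - _
    rw [e.abBot_congr (f' := X.μ (Function.surjInv e.top_surjective h))
      (by simp [Function.surjInv_eq, p.comm]), abBracket_cls, ab_cls, abBot_cls, eq_sub_iff_add_eq]
    refine congrArg e.clsBot (a₁ := _ * _) (e.bot_injective ?_)
    simp [i_conjBot, i.comm, i_bracket, X.μ_act, mul_assoc]
  ξ_ν h c := by
    obtain ⟨y, rfl⟩ := e.clsTop_surjective c
    change e.abBracket _ _ = e.abTop _ _ - _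
    rw [e.abTop_congr (f' := X.μ (Function.surjInv e.top_surjective h))
      (by simp [Function.surjInv_eq, p.comm]), ab_cls, abBracket_cls, abTop_cls, eq_sub_iff_add_eq,
      ← clsTop_mul]
    congr 1
    exact e.top_injective (by simp [i_conjTop, i.comm, i_bracket, X.peiffer, mul_assoc])
  act_ξ g h a := by
    obtain ⟨x, rfl⟩ := e.clsBot_surjective a
    change e.abTop _ (e.abBracket _ _) = e.abBracket _ (e.abBot _ _)
    rw [e.abBracket_congr (r := Function.surjInv e.top_surjective (Y.act g h))
      (r' := X.act (Function.surjInv e.bot_surjective g) (Function.surjInv e.top_surjective h))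
      (by simp [Function.surjInv_eq, p.equivariant]), abBracket_cls, abTop_cls, abBot_cls,
      abBracket_cls]
    congr 1
    exact e.top_injective (by simp [i_conjTop, i_conjBot, i_bracket, MulAut.mul_apply])
  ξ_mul h h' a := by
    change e.abBracket _ _ = e.abTop _ (e.abBracket _ _) + e.abBracket _ _
    rw [e.abTop_congr (f' := X.μ (Function.surjInv e.top_surjective h))
      (by simp [Function.surjInv_eq, p.comm]), ← abBracket_mul]
    exact e.abBracket_congr (by simp [Function.surjInv_eq]) _
  ξ_add h a a' := map_add _ _ _

theorem abAction_actC (e : IsShortExact i p) (f : F) (y : R') :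
    e.abAction.actC (p.bot f) (e.clsTop y) = e.clsTop (e.conjTop f y) :=
  congrArg (fun t : AddMonoid.End _ => t (e.clsTop y))
    (e.abTop_congr (Function.surjInv_eq e.bot_surjective (p.bot f)))

theorem abAction_actA (e : IsShortExact i p) (f : F) (x : F') :
    e.abAction.actA (p.bot f) (e.clsBot x) = e.clsBot (e.conjBot f x) :=
  congrArg (fun t : AddMonoid.End _ => t (e.clsBot x))
    (e.abBot_congr (Function.surjInv_eq e.bot_surjective (p.bot f)))

theorem abAction_ξ (e : IsShortExact i p) (r : R) (x : F') :
    e.abAction.ξ (p.top r) (e.clsBot x) = e.clsTop (e.bracket r x) :=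
  e.abBracket_congr (Function.surjInv_eq e.top_surjective (p.top r)) _

end IsShortExact

/-! ### Nerves

A crossed module `(H, G, μ)` determines a category internal to groups, with group of objects `G`
and group of arrows `H ⋊ G`, where `(h, g)` is an arrow from `g` to `μ(h) g`. An `n`-simplex
`(h₁, …, hₙ, g)` of its nerve is the chain of composable arrows
`g → μ(hₙ) g → ⋯ → μ(h₁ ⋯ hₙ) g`, whose vertices are numbered `n, n - 1, …, 0` in this order, so
that the `i`-th face omits the `i`-th vertex. -/

section Nerve

variable {H G : Type u} [Group H] [Group G]

/-- A diagram, contravariantly indexed by the preorder `ι`, in the internal category of a crossed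
module: objects `obj j` and, for `j ≤ k`, an arrow `(arr j k, obj k)` from `obj k` to `obj j`,
compatible with composition. For `ι = {0 < ⋯ < n}` this amounts to `(h₁, …, hₙ, g)`, where
`g = obj n` and `hⱼ = arr (j - 1) j`. -/
@[ext]
structure Diagram (X : CrossedModule H G) (ι : Type) [Preorder ι] where
  /-- the objects -/
  obj : ι → G
  /-- the `H`-components of the arrows -/
  arr : ∀ j k : ι, j ≤ k → H
  target : ∀ j k (h : j ≤ k), X.μ (arr j k h) * obj k = obj j
  comp : ∀ j k l (h : j ≤ k) (h' : k ≤ l), arr j k h * arr k l h' = arr j l (h.trans h')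

namespace Diagram

variable {X : CrossedModule H G} {ι κ : Type} [Preorder ι] [Preorder κ]

theorem act_obj (x : X.Diagram ι) (j k : ι) (h : j ≤ k) (y : H) :
    X.act (x.obj j) y = x.arr j k h * X.act (x.obj k) y * (x.arr j k h)⁻¹ := by
  rw [← x.target j k h, map_mul, MulAut.mul_apply, X.peiffer]

/-- Pointwise multiplication in `G` and in the semidirect product `H ⋊ G`. -/
instance : Mul (X.Diagram ι) where
  mul x y :=
    { obj := fun j => x.obj j * y.obj j
      arr := fun j k h => x.arr j k h * X.act (x.obj k) (y.arr j k h)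
      target := fun j k h => by
        rw [← x.target j k h, ← y.target j k h, map_mul, X.μ_act]
        group
      comp := fun j k l h h' => by
        rw [x.act_obj k l h', ← x.comp j k l h h', ← y.comp j k l h h', map_mul]
        group }

instance : One (X.Diagram ι) where
  one :=
    { obj := fun _ => 1
      arr := fun _ _ _ => 1
      target := fun _ _ _ => by simp
      comp := fun _ _ _ _ _ => by simp }

instance : Inv (X.Diagram ι) where
  inv x :=
    { obj := fun j => (x.obj j)⁻¹
      arr := fun j k h => X.act (x.obj k)⁻¹ (x.arr j k h)⁻¹
      target := fun j k h => by
        rw [← x.target j k h, X.μ_act, map_inv]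
        group
      comp := fun j k l h h' => by
        have h2 (g : G) (y : H) : X.act g (X.act g⁻¹ y) = y := by
          rw [← MulAut.mul_apply, ← map_mul, mul_inv_cancel, map_one, MulAut.one_apply]
        have h1 := x.act_obj k l h' (X.act (x.obj k)⁻¹ (x.arr j k h)⁻¹)
        rw [h2] at h1
        have h3 : X.act (x.obj l) (X.act (x.obj k)⁻¹ (x.arr j k h)⁻¹) =
            (x.arr k l h')⁻¹ * (x.arr j k h)⁻¹ * x.arr k l h' := by
          have h4 := congrArg (fun t => (x.arr k l h')⁻¹ * t * x.arr k l h') h1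
          simpa only [mul_assoc, inv_mul_cancel, mul_one, inv_mul_cancel_left] using h4.symm
        apply (X.act (x.obj l)).injective
        rw [map_mul, h2, h2, ← x.comp j k l h h', mul_inv_rev, h3, mul_assoc, mul_inv_cancel,
          mul_one] }

@[simp] theorem mul_obj (x y : X.Diagram ι) (j : ι) : (x * y).obj j = x.obj j * y.obj j := rfl

@[simp] theorem mul_arr (x y : X.Diagram ι) (j k : ι) (h : j ≤ k) :
    (x * y).arr j k h = x.arr j k h * X.act (x.obj k) (y.arr j k h) := rfl

@[simp] theorem one_obj (j : ι) : (1 : X.Diagram ι).obj j = 1 := rfl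

@[simp] theorem one_arr (j k : ι) (h : j ≤ k) : (1 : X.Diagram ι).arr j k h = 1 := rfl

@[simp] theorem inv_obj (x : X.Diagram ι) (j : ι) : x⁻¹.obj j = (x.obj j)⁻¹ := rfl

@[simp] theorem inv_arr (x : X.Diagram ι) (j k : ι) (h : j ≤ k) :
    x⁻¹.arr j k h = X.act (x.obj k)⁻¹ (x.arr j k h)⁻¹ := rfl

instance : Group (X.Diagram ι) :=
  Group.ofLeftAxioms
    (fun x y z => by ext <;> simp [mul_assoc, MulAut.mul_apply])
    (fun x => by ext <;> simp)
    (fun x => by ext <;> simp)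

/-- Restriction of a diagram along a monotone map. -/
def restrict (f : ι →o κ) : X.Diagram κ →* X.Diagram ι where
  toFun x :=
    { obj := fun j => x.obj (f j)
      arr := fun j k h => x.arr (f j) (f k) (f.monotone h)
      target := fun _ _ _ => x.target _ _ _
      comp := fun _ _ _ _ _ => x.comp _ _ _ _ _ }
  map_one' := rfl
  map_mul' _ _ := rfl

end Diagram

/-- The nerve of a crossed module, a simplicial group. -/
def nerve (X : CrossedModule H G) : SimplicialObject GrpCat.{u} where
  obj n := GrpCat.of (X.Diagram (Fin (n.unop.len + 1)))
  map f := GrpCat.ofHom (Diagram.restrict f.unop.toOrderHom)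
  map_id _ := rfl
  map_comp _ _ := rfl

end Nerve

section AbNerve

variable {C A : Type u} [AddCommGroup C] [AddCommGroup A]

/-- A diagram, contravariantly indexed by the preorder `ι`, in the internal category of an abelian
crossed module `(C, A, ν)`, as in `Diagram` but written additively. -/
@[ext]
structure AbDiagram (ν : C →+ A) (ι : Type) [Preorder ι] where
  /-- the objects -/
  obj : ι → A
  /-- the `C`-components of the arrows -/
  arr : ∀ j k : ι, j ≤ k → C
  target : ∀ j k (h : j ≤ k), ν (arr j k h) + obj k = obj j
  comp : ∀ j k l (h : j ≤ k) (h' : k ≤ l), arr j k h + arr k l h' = arr j l (h.trans h')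

namespace AbDiagram

variable {ν : C →+ A} {ι κ : Type} [Preorder ι] [Preorder κ]

/-- Pointwise addition (the semidirect product of `C` and `A` being their product). -/
instance : Add (AbDiagram ν ι) where
  add x y :=
    { obj := fun j => x.obj j + y.obj j
      arr := fun j k h => x.arr j k h + y.arr j k h
      target := fun j k h => by
        rw [← x.target j k h, ← y.target j k h, map_add]
        abel
      comp := fun j k l h h' => by
        rw [← x.comp j k l h h', ← y.comp j k l h h']
        abel }

instance : Zero (AbDiagram ν ι) where
  zero :=
    { obj := fun _ => 0
      arr := fun _ _ _ => 0
      target := fun _ _ _ => by simp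
      comp := fun _ _ _ _ _ => by simp }

instance : Neg (AbDiagram ν ι) where
  neg x :=
    { obj := fun j => -x.obj j
      arr := fun j k h => -x.arr j k h
      target := fun j k h => by
        rw [← x.target j k h, map_neg]
        abel
      comp := fun j k l h h' => by
        rw [← x.comp j k l h h']
        abel }

@[simp] theorem add_obj (x y : AbDiagram ν ι) (j : ι) : (x + y).obj j = x.obj j + y.obj j := rfl

@[simp] theorem add_arr (x y : AbDiagram ν ι) (j k : ι) (h : j ≤ k) :
    (x + y).arr j k h = x.arr j k h + y.arr j k h := rfl

@[simp] theorem zero_obj (j : ι) : (0 : AbDiagram ν ι).obj j = 0 := rfl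

@[simp] theorem zero_arr (j k : ι) (h : j ≤ k) : (0 : AbDiagram ν ι).arr j k h = 0 := rfl

@[simp] theorem neg_obj (x : AbDiagram ν ι) (j : ι) : (-x).obj j = -x.obj j := rfl

@[simp] theorem neg_arr (x : AbDiagram ν ι) (j k : ι) (h : j ≤ k) :
    (-x).arr j k h = -x.arr j k h := rfl

instance : AddCommGroup (AbDiagram ν ι) :=
  { AddGroup.ofLeftAxioms (G := AbDiagram ν ι)
      (fun x y z => by ext <;> simp [add_assoc])
      (fun x => by ext <;> simp)
      (fun x => by ext <;> simp) with
    add_comm := fun x y => by ext <;> simp [add_comm] }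

/-- Restriction of a diagram along a monotone map. -/
def restrict (f : ι →o κ) : AbDiagram ν κ →+ AbDiagram ν ι where
  toFun x :=
    { obj := fun j => x.obj (f j)
      arr := fun j k h => x.arr (f j) (f k) (f.monotone h)
      target := fun _ _ _ => x.target _ _ _
      comp := fun _ _ _ _ _ => x.comp _ _ _ _ _ }
  map_zero' := rfl
  map_add' _ _ := rfl

end AbDiagram

/-- The nerve of an abelian crossed module, an abelian simplicial group. -/
def abNerve (ν : C →+ A) : SimplicialObject AddCommGrpCat.{u} where
  obj n := AddCommGrpCat.of (AbDiagram ν (Fin (n.unop.len + 1)))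
  map f := AddCommGrpCat.ofHom (AbDiagram.restrict f.unop.toOrderHom)
  map_id _ := rfl
  map_comp _ _ := rfl

end AbNerve

end CrossedModule

/-! ### Homology of simplicial groups -/

/-- An action of a simplicial group on an abelian simplicial group. -/
structure SimplicialAction (G : SimplicialObject GrpCat.{u}) (A : SimplicialObject AddCommGrpCat.{u})
    where
  /-- the action in each dimension -/
  act : ∀ n, G.obj n →* AddMonoid.End (A.obj n)
  map_act : ∀ {m n} (f : m ⟶ n) (g : G.obj m) (a : A.obj m),
    A.map f (act m g a) = act n (G.map f g) (A.map f a)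

namespace SimplicialAction

variable {G : SimplicialObject GrpCat.{u}} {A : SimplicialObject AddCommGrpCat.{u}}

/-- The `G_n`-module `A_n` (over a copy of the integers in the universe at hand). -/
def rep (α : SimplicialAction G A) (n : SimplexCategoryᵒᵖ) : Rep.{u} (ULift.{u} ℤ) (G.obj n) :=
  Rep.of (X := A.obj n) (k := ULift.{u} ℤ)
    { toFun := fun g =>
        { toFun := fun a => α.act n g a
          map_add' := fun a b => map_add (α.act n g) a b
          map_smul' := fun c a => map_zsmul (α.act n g) c.down a }
      map_one' := by ext a; simp
      map_mul' := fun g h => by ext a; simp }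

/-- The map of modules induced by a simplicial operator. -/
def repMap (α : SimplicialAction G A) {m n : SimplexCategoryᵒᵖ} (f : m ⟶ n) :
    α.rep m ⟶ Rep.res (G.map f).hom (α.rep n) :=
  Rep.ofHom (k := ULift.{u} ℤ)
    { toFun := fun a => A.map f a
      map_add' := fun a b => map_add (A.map f).hom a b
      map_smul' := fun c a => map_zsmul (A.map f).hom c.down a
      isIntertwining' := fun g => by ext a; exact α.map_act f g a }

/-- The simplicial chain complex which in simplicial degree `n` is the complex
`B_*(G_n) ⊗_{G_n} A_n`, where `B_*` is the standard (bar) resolution: it is given in degree `m` by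
`ℤ[G_n^m] ⊗ A_n`. -/
noncomputable def chains (α : SimplicialAction G A) :
    SimplicialObject (ChainComplex (ModuleCat.{u} (ULift.{u} ℤ)) ℕ) where
  obj n := groupHomology.inhomogeneousChains (α.rep n)
  map f := groupHomology.chainsMap (G.map f).hom (α.repMap f)
  map_id n := by
    rw [← groupHomology.chainsMap_id]
    refine groupHomology.chainsMap_congr ?_ ?_
    · rw [G.map_id]; rfl
    · ext a
      change A.map (𝟙 n) a = a
      rw [A.map_id]; rfl
  map_comp f g := by
    rw [← groupHomology.chainsMap_comp]
    refine groupHomology.chainsMap_congr ?_ ?_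
    · rw [G.map_comp]; rfl
    · ext a
      change A.map (f ≫ g) a = A.map g (A.map f a)
      rw [A.map_comp]; rfl

/-- The bicomplex `B(G_*, A_*)`: its columns are the complexes `B_*(G_n) ⊗_{G_n} A_n`, its
horizontal differentials the alternating sums of the face maps. -/
noncomputable def bicomplex (α : SimplicialAction G A) :
    HomologicalComplex₂ (ModuleCat.{u} (ULift.{u} ℤ)) (ComplexShape.down ℕ)
      (ComplexShape.down ℕ) :=
  (AlgebraicTopology.alternatingFaceMapComplex _).obj α.chains

/-- The homology `H_n(G_*, A_*)` of a simplicial group with coefficients in an abelian simplicial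
group: the homology of the total complex of `B(G_*, A_*)`. -/
noncomputable def homology (α : SimplicialAction G A) (n : ℕ) : ModuleCat.{u} (ULift.{u} ℤ) :=
  (α.bicomplex.total (ComplexShape.down ℕ)).homology n

end SimplicialAction

/-! ### Homology of crossed modules -/

namespace CrossedModule

variable {H G C A : Type u} [Group H] [Group G] [AddCommGroup C] [AddCommGroup A]
  {X : CrossedModule H G} {ν : C →+ A}

namespace Action

theorem ξ_sub (α : Action X ν) (h : H) (a b : A) : α.ξ h (a - b) = α.ξ h a - α.ξ h b := by
  rw [eq_sub_iff_add_eq, ← α.ξ_add, sub_add_cancel]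

theorem actA_mul (α : Action X ν) (g g' : G) (a : A) :
    α.actA (g * g') a = α.actA g (α.actA g' a) := by rw [map_mul]; rfl

theorem actC_mul (α : Action X ν) (g g' : G) (c : C) :
    α.actC (g * g') c = α.actC g (α.actC g' c) := by rw [map_mul]; rfl

theorem ξ_one (α : Action X ν) (a : A) : α.ξ 1 a = 0 := by
  have h := α.ξ_mul 1 1 a
  have h1 (c : C) : α.actC 1 c = c := by rw [map_one]; rfl
  rw [map_one, mul_one, h1] at h
  exact left_eq_add.1 h

theorem ξ_zero (α : Action X ν) (h : H) : α.ξ h 0 = 0 := by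
  have := α.ξ_add h 0 0
  rw [add_zero] at this
  exact left_eq_add.1 this

/-- The pointwise action of diagrams in the internal category of `(H, G, μ)` on diagrams in that of
`(C, A, ν)`: the arrow `(h, g) : g → μ(h) g` sends the object `a` to `ᵍa` and the arrow `(c, a)` to
the arrow with source `ᵍa` and `C`-component `ᵏc + ξ(h, ᵍa)`, where `k = μ(h) g`. This is the
conjugation action in the internal category of the semidirect product crossed module
`(C ⋊ H, A ⋊ G)`, in which `ξ(h, a) = h ᵃ(h⁻¹)`. -/
def diagramAct (α : Action X ν) {ι : Type} [Preorder ι] :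
    X.Diagram ι →* AddMonoid.End (AbDiagram ν ι) where
  toFun x :=
    { toFun := fun y =>
        { obj := fun j => α.actA (x.obj j) (y.obj j)
          arr := fun j k h => α.actC (x.obj j) (y.arr j k h) +
            α.ξ (x.arr j k h) (α.actA (x.obj k) (y.obj k))
          target := fun j k h => by
            rw [map_add, α.ν_act, α.ν_ξ, ← α.actA_mul, x.target, ← y.target j k h, map_add]
            abel
          comp := fun j k l h h' => by
            rw [← x.comp j k l h h', ← y.comp j k l h h', α.ξ_mul, map_add, ← y.target k l h',
              map_add, α.ξ_add]
            have h1 := α.ξ_ν (x.arr j k h) (α.actC (x.obj k) (y.arr k l h'))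
            have h2 := α.ξ_ν (x.arr j k h) (α.ξ (x.arr k l h') (α.actA (x.obj l) (y.obj l)))
            rw [α.ν_act, ← α.actC_mul, x.target] at h1
            rw [α.ν_ξ, α.ξ_sub, ← α.actA_mul, x.target] at h2
            rw [h1, eq_add_of_sub_eq h2.symm]
            abel }
      map_zero' := by ext <;> simp [α.ξ_zero]
      map_add' := fun y z => by
        ext j
        · simp
        · simp only [AbDiagram.add_obj, AbDiagram.add_arr, map_add, α.ξ_add]
          abel }
  map_one' := by
    refine AddMonoidHom.ext fun y => AbDiagram.ext ?_ ?_
    · funext j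
      change α.actA 1 _ = _
      rw [map_one]; rfl
    · funext j k h
      change α.actC 1 _ + α.ξ 1 _ = _
      rw [map_one, α.ξ_one, add_zero]; rfl
  map_mul' x x' := by
    refine AddMonoidHom.ext fun y => AbDiagram.ext ?_ ?_
    · funext j
      exact α.actA_mul _ _ _
    · funext j k h
      change α.actC (x.obj j * x'.obj j) (y.arr j k h) +
          α.ξ (x.arr j k h * X.act (x.obj k) (x'.arr j k h))
            (α.actA (x.obj k * x'.obj k) (y.obj k)) =
        α.actC (x.obj j) (α.actC (x'.obj j) (y.arr j k h) +
            α.ξ (x'.arr j k h) (α.actA (x'.obj k) (y.obj k))) +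
          α.ξ (x.arr j k h) (α.actA (x.obj k) (α.actA (x'.obj k) (y.obj k)))
      rw [α.ξ_mul, α.actA_mul, ← α.act_ξ, ← α.actC_mul (X.μ _), x.target, α.actC_mul, map_add]
      abel

end Action

/-- The action of the nerve of `(H, G, μ)` on the nerve of `(C, A, ν)`. -/
def Action.nerveAction (α : Action X ν) : SimplicialAction X.nerve (abNerve ν) where
  act _ := α.diagramAct
  map_act _ _ _ := rfl

/-- The homology `H_n((H, G, μ), (C, A, ν))` of a crossed module with coefficients in an abelian
crossed module on which it acts. -/
noncomputable def homology (α : Action X ν) (n : ℕ) : ModuleCat.{u} (ULift.{u} ℤ) :=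
  α.nerveAction.homology n

/-- The (Baues–Ellis) homology `H_n(H, G, μ)` with integral coefficients, i.e. with coefficients in
the abelian crossed module `(0, ℤ, 0)` with trivial action. -/
noncomputable def integralHomology (X : CrossedModule H G) (n : ℕ) :
    ModuleCat.{u} (ULift.{u} ℤ) :=
  homology (X.trivialAction (ULift.{u} ℤ)) n

end CrossedModule

/-! Write `G`, `E`, `K` for the nerves of `Y`, `X`, `X'`. In each dimension `E → G` is a surjection
of groups with kernel `K`, so there is the classical relation sequence of `G`-modules `0 → K_ab →
ℤ[G] ⊗_E I(E) → ℤ[G] → ℤ → 0`, where `I(E)` is the augmentation ideal. It is compatible with the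
simplicial operators, and `K_ab` is the nerve of `(R', F', η')_ab` with its induced action
(`relation_injective`, `relation_exact`, `augmentation_exact`). Cutting the sequence at `I(G)` gives
two connecting homomorphisms, which lower the degree from 3 to 1. They are isomorphisms once `ℤ[G]`
has no homology in degrees 2 and 3 and the relation module `ℤ[G] ⊗_E I(E)` has none in degrees 1 and
2 (`nonempty_homology_iso_of_relation`).

For the acyclicity, consider coefficients `ℤ[G × T]` with `G` acting on the first factor. The
columns of the bicomplex are contractible onto `ℤ[T]`, so the homology is that of the simplicial set
`T` (`isZero_homology_free`). For a free crossed module `η` is injective with free cokernel `Q`,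
hence `E` is homotopy equivalent, as a simplicial set, to the discrete set `Q`, and each `E^k` to
`Q^k`. Thus `ℤ[G × E^k]` has homology `ℤ[Q^k]`, concentrated in degree 0.

The relation module is the cokernel of `ℤ[G × E²] → ℤ[G × E]` in the complex `ℤ[G] ⊗_E B(E)`. On
zeroth homology this complex becomes the integral bar complex of `Q`, which is exact in degrees 2
and 3 because `Q` is free (`exact_two`, `exact_three`). This yields the injectivity statements on
zeroth homology (`mem_zeroBoundary_of_exact`) that make the first and second homology of the
relation module vanish. The second vanishing also uses that `ℤ[G₀ × E₀³]` maps onto the kernel of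
the next differential, which holds since `E₀ ≅ F` is free; dimension 0 is enough because zeroth
homology is a quotient of the module in dimension 0. -/

open scoped Simplicial

/-! ### Total complexes of first quadrant bicomplexes, computed on components. -/

namespace HomologicalComplex₂

variable {R : Type u} [Ring R]
  (K : HomologicalComplex₂ (ModuleCat.{u} R) (ComplexShape.down ℕ) (ComplexShape.down ℕ))

/-- The total complex of a first quadrant bicomplex of modules. -/
noncomputable abbrev tot : ChainComplex (ModuleCat.{u} R) ℕ := K.total (ComplexShape.down ℕ)

/-- The inclusion of a summand of the total complex. -/
noncomputable def totι (p q n : ℕ) (h : p + q = n) : (K.X p).X q ⟶ K.tot.X n :=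
  K.ιTotal (ComplexShape.down ℕ) p q n h

/-- The projection of the total complex to a summand. -/
noncomputable def totπ (p q n : ℕ) (h : p + q = n) : K.tot.X n ⟶ (K.X p).X q :=
  K.totalDesc fun p' q' h' =>
    if hp : p' = p then
      (K.XXIsoOfEq _ _ _ hp (by change p' + q' = n at h'; omega)).hom
    else 0

variable {K} in
theorem tot_hom_ext {A : ModuleCat.{u} R} {n : ℕ} {f g : K.tot.X n ⟶ A}
    (h : ∀ p q (hn : p + q = n), K.totι p q n hn ≫ f = K.totι p q n hn ≫ g) : f = g :=
  total.hom_ext _ h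

theorem totι_totπ (p q n : ℕ) (h : p + q = n) : K.totι p q n h ≫ K.totπ p q n h = 𝟙 _ := by
  rw [totι, totπ, ι_totalDesc]
  simp

theorem totι_totπ_ne (p q p' q' n : ℕ) (h : p + q = n) (h' : p' + q' = n) (hp : p ≠ p') :
    K.totι p q n h ≫ K.totπ p' q' n h' = 0 := by
  rw [totι, totπ, ι_totalDesc, dif_neg hp]

theorem totι_d (p q n : ℕ) (h : p + q = n + 1) :
    K.totι p q (n + 1) h ≫ K.tot.d (n + 1) n =
      K.d₁ (ComplexShape.down ℕ) p q n + K.d₂ (ComplexShape.down ℕ) p q n := by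
  rw [totι, total_d, Preadditive.comp_add, ι_D₁, ι_D₂]

theorem d₁_succ (p q n : ℕ) (h : p + q = n) : K.d₁ (ComplexShape.down ℕ) (p + 1) q n =
    (K.d (p + 1) p).f q ≫ K.totι p q n h := by
  rw [K.d₁_eq (ComplexShape.down ℕ) (i₁' := p) rfl q n h]
  exact one_smul _ _

theorem d₁_zero (q n : ℕ) : K.d₁ (ComplexShape.down ℕ) 0 q n = 0 :=
  K.d₁_eq_zero _ _ _ _ (by simp)

theorem d₂_succ (p q n : ℕ) (h : p + q = n) : K.d₂ (ComplexShape.down ℕ) p (q + 1) n =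
    (-1 : ℤˣ) ^ p • ((K.X p).d (q + 1) q ≫ K.totι p q n h) :=
  K.d₂_eq (ComplexShape.down ℕ) (i₂' := q) p rfl n h

theorem d₂_zero (p n : ℕ) : K.d₂ (ComplexShape.down ℕ) p 0 n = 0 :=
  K.d₂_eq_zero _ _ _ _ (by simp)

/-- The counterpart of `totι_d` for projections: the elementwise arguments need to read off a single
component of a boundary. Both sides are compared on each summand. -/
theorem tot_d_totπ (p q n : ℕ) (h : p + q = n) :
    K.tot.d (n + 1) n ≫ K.totπ p q n h =
      K.totπ (p + 1) q (n + 1) (by omega) ≫ (K.d (p + 1) p).f q +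
      (-1 : ℤˣ) ^ p • (K.totπ p (q + 1) (n + 1) (by omega) ≫ (K.X p).d (q + 1) q) := by
  refine tot_hom_ext fun p' q' h' => ?_
  rw [← Category.assoc, totι_d, Preadditive.add_comp, Preadditive.comp_add,
    ← Category.assoc, Linear.comp_units_smul, ← Category.assoc]
  congr 1
  · rcases p' with _ | p'
    · rw [d₁_zero, totι_totπ_ne _ _ _ _ _ _ _ _ (by omega)]; simp
    · rw [d₁_succ _ _ _ _ (by omega), Category.assoc]
      by_cases hp : p' = p
      · subst hp
        obtain rfl : q' = q := by omega
        rw [totι_totπ, totι_totπ]; simp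
      · rw [totι_totπ_ne _ _ _ _ _ _ _ _ hp, totι_totπ_ne _ _ _ _ _ _ _ _ (by omega)]; simp
  · rcases q' with _ | q'
    · rw [d₂_zero, totι_totπ_ne _ _ _ _ _ _ _ _ (by omega)]; simp
    · rw [d₂_succ _ _ _ _ (by omega), Linear.units_smul_comp, Category.assoc]
      by_cases hp : p' = p
      · subst hp
        obtain rfl : q' = q := by omega
        rw [totι_totπ, totι_totπ]; simp
      · rw [totι_totπ_ne _ _ _ _ _ _ _ _ hp, totι_totπ_ne _ _ _ _ _ _ _ _ hp]; simp

theorem sum_totπ_totι (n : ℕ) :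
    ∑ p : Fin (n + 1), K.totπ p (n - p) n (by omega) ≫ K.totι p (n - p) n (by omega) = 𝟙 _ := by
  refine tot_hom_ext fun p q h => ?_
  rw [Preadditive.comp_sum, Finset.sum_eq_single ⟨p, by omega⟩]
  · obtain rfl : q = n - p := by omega
    rw [← Category.assoc, totι_totπ]; simp
  · intro b _ hb
    rw [← Category.assoc, totι_totπ_ne _ _ _ _ _ _ _ _ (fun h => hb (Fin.ext h.symm)),
      Limits.zero_comp]
  · simp

variable {K}

theorem tot_ext {n : ℕ} {x y : K.tot.X n}
    (h : ∀ p q (hn : p + q = n), K.totπ p q n hn x = K.totπ p q n hn y) : x = y := by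
  have key (z : K.tot.X n) : ∑ p : Fin (n + 1),
      K.totι p (n - p) n (by omega) (K.totπ p (n - p) n (by omega) z) = z := by
    have := congrArg (fun f => f.hom z) (K.sum_totπ_totι n)
    simpa using this
  rw [← key x, ← key y]
  exact Finset.sum_congr rfl fun p _ => by rw [h]

theorem totπ_totι_apply (p q n : ℕ) (h : p + q = n) (x : (K.X p).X q) :
    K.totπ p q n h (K.totι p q n h x) = x :=
  congrArg (fun f => f.hom x) (K.totι_totπ p q n h)

theorem totπ_totι_apply_ne (p q p' q' n : ℕ) (h : p + q = n) (h' : p' + q' = n) (hp : p ≠ p')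
    (x : (K.X p).X q) : K.totπ p' q' n h' (K.totι p q n h x) = 0 :=
  congrArg (fun f => f.hom x) (K.totι_totπ_ne p q p' q' n h h' hp)

theorem tot_exists (n : ℕ) (f : ∀ p q, p + q = n → (K.X p).X q) :
    ∃ x : K.tot.X n, ∀ p q h, K.totπ p q n h x = f p q h := by
  refine ⟨∑ p : Fin (n + 1), K.totι p (n - p) n (by omega) (f p (n - p) (by omega)), ?_⟩
  intro p q h
  obtain rfl : q = n - p := by omega
  rw [map_sum, Finset.sum_eq_single ⟨p, by omega⟩]
  · rw [totπ_totι_apply]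
  · intro b _ hb
    rw [totπ_totι_apply_ne _ _ _ _ _ _ _ fun h => hb (Fin.ext h)]
  · simp

theorem totπ_d_apply (p q n : ℕ) (h : p + q = n) (x : K.tot.X (n + 1)) :
    K.totπ p q n h (K.tot.d (n + 1) n x) =
      (K.d (p + 1) p).f q (K.totπ (p + 1) q (n + 1) (by omega) x) +
      (-1 : ℤˣ) ^ p • (K.X p).d (q + 1) q (K.totπ p (q + 1) (n + 1) (by omega) x) :=
  congrArg (fun f => f.hom x) (K.tot_d_totπ p q n h)

variable {L M : HomologicalComplex₂ (ModuleCat.{u} R) (ComplexShape.down ℕ) (ComplexShape.down ℕ)}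

theorem totι_map (φ : K ⟶ L) (p q n : ℕ) (h : p + q = n) :
    K.totι p q n h ≫ (total.map φ (ComplexShape.down ℕ)).f n =
      (φ.f p).f q ≫ L.totι p q n h :=
  ιTotal_map K L φ _ p q n h

theorem map_totπ (φ : K ⟶ L) (p q n : ℕ) (h : p + q = n) :
    (total.map φ (ComplexShape.down ℕ)).f n ≫ L.totπ p q n h =
      K.totπ p q n h ≫ (φ.f p).f q := by
  refine tot_hom_ext fun p' q' h' => ?_
  rw [← Category.assoc, totι_map, Category.assoc, ← Category.assoc (K.totι _ _ _ _)]
  by_cases hp : p' = p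
  · subst hp
    obtain rfl : q' = q := by omega
    rw [totι_totπ, totι_totπ]; simp
  · rw [totι_totπ_ne _ _ _ _ _ _ _ _ hp, totι_totπ_ne _ _ _ _ _ _ _ _ hp]; simp

theorem totπ_map_apply (φ : K ⟶ L) (p q n : ℕ) (h : p + q = n) (x : K.tot.X n) :
    L.totπ p q n h ((total.map φ (ComplexShape.down ℕ)).f n x) =
      (φ.f p).f q (K.totπ p q n h x) :=
  congrArg (fun f => f.hom x) (map_totπ φ p q n h)

theorem tot_map_injective (φ : K ⟶ L) (hinj : ∀ p q, Function.Injective ((φ.f p).f q)) (n : ℕ) :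
    Function.Injective ((total.map φ (ComplexShape.down ℕ)).f n) := by
  intro x y hxy
  refine tot_ext fun p q h => hinj p q ?_
  rw [← totπ_map_apply, ← totπ_map_apply, hxy]

theorem tot_map_surjective (φ : K ⟶ L) (hsurj : ∀ p q, Function.Surjective ((φ.f p).f q))
    (n : ℕ) : Function.Surjective ((total.map φ (ComplexShape.down ℕ)).f n) := by
  intro y
  choose f hf using fun p q (h : p + q = n) => hsurj p q (L.totπ p q n h y)
  obtain ⟨x, hx⟩ := tot_exists n f
  exact ⟨x, tot_ext fun p q h => by rw [totπ_map_apply, hx, hf]⟩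

theorem tot_map_exact (φ : K ⟶ L) (ψ : L ⟶ M)
    (hex : ∀ p q, Function.Exact ((φ.f p).f q) ((ψ.f p).f q)) (n : ℕ) :
    Function.Exact ((total.map φ (ComplexShape.down ℕ)).f n)
      ((total.map ψ (ComplexShape.down ℕ)).f n) := by
  intro y
  constructor
  · intro hy
    have h1 (p q) (h : p + q = n) : ∃ x, (φ.f p).f q x = L.totπ p q n h y := by
      refine (hex p q _).1 ?_
      rw [← totπ_map_apply, hy, map_zero]
    choose f hf using h1
    obtain ⟨x, hx⟩ := K.tot_exists n f
    exact ⟨x, tot_ext fun p q h => by rw [totπ_map_apply, hx, hf]⟩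
  · rintro ⟨x, rfl⟩
    refine tot_ext fun p q h => ?_
    rw [totπ_map_apply, totπ_map_apply, map_zero]
    exact (hex p q _).2 ⟨_, rfl⟩

theorem tot_map_comp_eq_zero (φ : K ⟶ L) (ψ : L ⟶ M)
    (hex : ∀ p q, Function.Exact ((φ.f p).f q) ((ψ.f p).f q)) :
    total.map φ (ComplexShape.down ℕ) ≫ total.map ψ (ComplexShape.down ℕ) = 0 := by
  ext n x
  exact (tot_map_exact φ ψ hex n _).2 ⟨x, rfl⟩

/-- A degreewise short exact sequence of bicomplexes induces a short exact sequence of total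
complexes. -/
theorem tot_shortExact (φ : K ⟶ L) (ψ : L ⟶ M)
    (hinj : ∀ p q, Function.Injective ((φ.f p).f q))
    (hex : ∀ p q, Function.Exact ((φ.f p).f q) ((ψ.f p).f q))
    (hsurj : ∀ p q, Function.Surjective ((ψ.f p).f q)) :
    (ShortComplex.mk (total.map φ (ComplexShape.down ℕ))
      (total.map ψ (ComplexShape.down ℕ)) (tot_map_comp_eq_zero φ ψ hex)).ShortExact :=
  HomologicalComplex.shortExact_of_degreewise_shortExact _ fun n =>
    { exact := (ShortComplex.ShortExact.moduleCat_exact_iff_function_exact _).2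
        (tot_map_exact φ ψ hex n)
      mono_f := (ModuleCat.mono_iff_injective _).2 (tot_map_injective φ hinj n)
      epi_g := (ModuleCat.epi_iff_surjective _).2 (tot_map_surjective ψ hsurj n) }

/-- If every cycle of positive degree `n + 1` is a boundary, then the homology vanishes. -/
theorem isZero_homology_succ_of_exists (C : ChainComplex (ModuleCat.{u} R) ℕ) (n : ℕ)
    (h : ∀ x : C.X (n + 1), C.d (n + 1) n x = 0 → ∃ y : C.X (n + 2), C.d (n + 2) (n + 1) y = x) :
    Limits.IsZero (C.homology (n + 1)) := by
  rw [← HomologicalComplex.exactAt_iff_isZero_homology,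
    HomologicalComplex.exactAt_iff' _ (n + 2) (n + 1) n (by simp) (by simp),
    ShortComplex.moduleCat_exact_iff]
  exact h

theorem d_d_apply (C : ChainComplex (ModuleCat.{u} R) ℕ) (i j k : ℕ) (x : C.X i) :
    C.d j k (C.d i j x) = 0 :=
  congrArg (fun f => f.hom x) (C.d_comp_d i j k)

/-- If the columns are exact in positive degrees and the complex of their zeroth homology modules
is exact in positive degrees, then the total complex is exact in positive degrees. -/
theorem isZero_homology_tot_succ (K : HomologicalComplex₂ (ModuleCat.{u} R) (ComplexShape.down ℕ)
      (ComplexShape.down ℕ))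
    (hcol : ∀ p q (x : (K.X p).X (q + 1)), (K.X p).d (q + 1) q x = 0 →
      ∃ y, (K.X p).d (q + 2) (q + 1) y = x)
    (hrow : ∀ p (x : (K.X (p + 1)).X 0) (z : (K.X p).X 1),
      (K.d (p + 1) p).f 0 x = (K.X p).d 1 0 z →
      ∃ (y : (K.X (p + 2)).X 0) (w : (K.X (p + 1)).X 1),
        x = (K.d (p + 2) (p + 1)).f 0 y + (K.X (p + 1)).d 1 0 w)
    (n : ℕ) : Limits.IsZero (K.tot.homology (n + 1)) := by
  have unit_smul {A : Type u} [AddCommGroup A] (p : ℕ) (a : A) :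
      (-1 : ℤˣ) ^ p • ((-1 : ℤˣ) ^ p • a) = a := by
    rw [smul_smul, ← pow_add, ← two_mul, pow_mul]; simp
  -- A cycle with no component in columns `p ≥ k` is pushed towards column 0 by subtracting
  -- boundaries, one column at a time. The corner component `(n + 1, 0)` is excluded here, as
  -- vertical exactness says nothing about it.
  have step1 : ∀ k, k ≤ n + 1 → ∀ x : K.tot.X (n + 1), K.tot.d (n + 1) n x = 0 →
      (∀ p q h, k ≤ p → K.totπ p q (n + 1) h x = 0) → ∃ y, K.tot.d (n + 2) (n + 1) y = x := by
    intro k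
    induction k with
    | zero =>
      intro _ x _ hx
      refine ⟨0, ?_⟩
      rw [map_zero]
      exact (tot_ext fun p q h => by rw [hx p q h (Nat.zero_le _), map_zero]).symm
    | succ k ih =>
      intro hk x hdx hx
      obtain ⟨q, hq⟩ : ∃ q, k + q = n := ⟨n - k, by omega⟩
      -- Column `k + 1` contributes nothing at `(k, q)`, so the component of `x` in column `k` is a
      -- vertical cycle.
      have h1 := totπ_d_apply k q n hq x
      rw [hdx, map_zero, hx (k + 1) q _ le_rfl, map_zero, zero_add] at h1
      have h2 := congrArg ((-1 : ℤˣ) ^ k • ·) h1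
      simp only [smul_zero, unit_smul] at h2
      obtain ⟨y, hy⟩ := hcol k q _ h2.symm
      -- The sign cancels the one carried by the vertical part of the total differential in column
      -- `k`. Besides column `k`, the boundary of `Y` meets only column `k - 1`.
      let Y := K.totι k (q + 2) (n + 2) (by omega) ((-1 : ℤˣ) ^ k • y)
      obtain ⟨Z, hZ⟩ := ih (by omega) (x - K.tot.d (n + 2) (n + 1) Y)
        (by
          rw [map_sub, hdx, d_d_apply, sub_zero])
        (by
          intro p q' h hp
          rw [map_sub, totπ_d_apply p q' (n + 1) h Y,
            totπ_totι_apply_ne _ _ _ _ _ _ _ (by omega), map_zero, zero_add]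
          by_cases hpk : k = p
          · subst hpk
            obtain rfl : q' = q + 1 := by omega
            rw [totπ_totι_apply, ← hy, Units.smul_def, Units.smul_def, map_zsmul,
              ← Units.smul_def, ← Units.smul_def, unit_smul, sub_self]
          · rw [totπ_totι_apply_ne _ _ _ _ _ _ _ hpk, map_zero, smul_zero, sub_zero]
            exact hx p q' h (by omega))
      exact ⟨Z + Y, by rw [map_add, hZ, sub_add_cancel]⟩
  refine isZero_homology_succ_of_exists _ _ fun x hdx => ?_
  have h1 := totπ_d_apply n 0 n rfl x
  rw [hdx, map_zero] at h1
  -- The corner component is a horizontal cycle only modulo vertical boundaries, which is the form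
  -- of cycle that `hrow` accepts. Subtracting the boundary of `Y` clears the corner and leaves the
  -- situation of `step1`.
  obtain ⟨y, w, hyw⟩ := hrow n (K.totπ (n + 1) 0 (n + 1) rfl x)
    (-((-1 : ℤˣ) ^ n • K.totπ n 1 (n + 1) rfl x)) (by
      rw [map_neg, Units.smul_def, map_zsmul, ← Units.smul_def]
      exact eq_neg_of_add_eq_zero_left h1.symm)
  let Y := K.totι (n + 2) 0 (n + 2) rfl y +
    K.totι (n + 1) 1 (n + 2) rfl ((-1 : ℤˣ) ^ (n + 1) • w)
  have hY : K.totπ (n + 1) 0 (n + 1) rfl (K.tot.d (n + 2) (n + 1) Y) =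
      K.totπ (n + 1) 0 (n + 1) rfl x := by
    have e1 : K.totπ (n + 2) 0 (n + 2) rfl Y = y := by
      rw [map_add, totπ_totι_apply, totπ_totι_apply_ne _ _ _ _ _ _ _ (by omega), add_zero]
    have e2 : K.totπ (n + 1) 1 (n + 2) rfl Y = (-1 : ℤˣ) ^ (n + 1) • w := by
      rw [map_add, totπ_totι_apply, totπ_totι_apply_ne _ _ _ _ _ _ _ (by omega), zero_add]
    refine (totπ_d_apply (n + 1) 0 (n + 1) rfl Y).trans ?_
    rw [e1, e2, Units.smul_def, Units.smul_def, map_zsmul, ← Units.smul_def,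
      ← Units.smul_def, unit_smul, hyw]
  obtain ⟨Z, hZ⟩ := step1 (n + 1) le_rfl (x - K.tot.d (n + 2) (n + 1) Y)
    (by
      rw [map_sub, hdx, d_d_apply, sub_zero])
    (by
      intro p q h hp
      obtain rfl : p = n + 1 := by omega
      obtain rfl : q = 0 := by omega
      rw [map_sub, hY, sub_self])
  exact ⟨Z + Y, by rw [map_add, hZ, sub_add_cancel]⟩

/-- The connecting homomorphism argument in degree one, for a short exact sequence of complexes
whose middle term has no first homology. -/
theorem isZero_homology_one_of_shortExact {A B C : ChainComplex (ModuleCat.{u} R) ℕ}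
    (f : A ⟶ B) (g : B ⟶ C) (hex : ∀ n, Function.Exact (f.f n) (g.f n))
    (hsurj : ∀ n, Function.Surjective (g.f n)) (hB : Limits.IsZero (B.homology 1))
    (h0 : ∀ (a : A.X 0) (b : B.X 1), B.d 1 0 b = f.f 0 a → ∃ a' : A.X 1, A.d 1 0 a' = a) :
    Limits.IsZero (C.homology 1) := by
  refine isZero_homology_succ_of_exists C 0 fun x hx => ?_
  have hB' : ∀ b : B.X 1, B.d 1 0 b = 0 → ∃ y : B.X 2, B.d 2 1 y = b := by
    rw [← HomologicalComplex.exactAt_iff_isZero_homology,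
      HomologicalComplex.exactAt_iff' _ 2 1 0 (by simp) (by simp),
      ShortComplex.moduleCat_exact_iff] at hB
    exact hB
  have comm {P Q : ChainComplex (ModuleCat.{u} R) ℕ} (φ : P ⟶ Q) (i j : ℕ) (z : P.X i) :
      Q.d i j (φ.f i z) = φ.f j (P.d i j z) :=
    congrArg (fun t => t.hom z) (φ.comm i j)
  obtain ⟨b, rfl⟩ := hsurj 1 x
  obtain ⟨a, ha⟩ := (hex 0 (B.d 1 0 b)).1 (by rw [← comm, hx])
  -- The class of `a` is the image of the given cycle under the connecting homomorphism; it dies in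
  -- the homology of `B`, hence already in that of `A`. Correcting `b` by `a'` gives a cycle of `B`.
  obtain ⟨a', rfl⟩ := h0 a b ha.symm
  obtain ⟨y, hy⟩ := hB' (b - f.f 1 a') (by rw [map_sub, comm, ha, sub_self])
  exact ⟨g.f 2 y, by rw [comm, hy, map_sub, (hex 1 _).2 ⟨a', rfl⟩, sub_zero]⟩

theorem tot_d_one_apply (y : K.tot.X 1) : K.tot.d 1 0 y = K.totι 0 0 0 rfl
    ((K.d 1 0).f 0 (K.totπ 1 0 1 rfl y) + (K.X 0).d 1 0 (K.totπ 0 1 1 rfl y)) := by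
  refine tot_ext fun p q h => ?_
  obtain rfl : p = 0 := by omega
  obtain rfl : q = 0 := by omega
  rw [totπ_totι_apply, totπ_d_apply, pow_zero, one_smul]

end HomologicalComplex₂

/-! ### Maps of coefficient systems and the resulting long exact sequences. -/

namespace SimplicialAction

variable {G : SimplicialObject GrpCat.{u}} {A B C : SimplicialObject AddCommGrpCat.{u}}

/-- An equivariant map of abelian simplicial groups with an action of a simplicial group. -/
structure Hom (α : SimplicialAction G A) (β : SimplicialAction G B) where
  /-- the components -/
  app : ∀ n, A.obj n →+ B.obj n
  map_app : ∀ {m n} (f : m ⟶ n) (a : A.obj m), app n (A.map f a) = B.map f (app m a)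
  act_app : ∀ n (g : G.obj n) (a : A.obj n), app n (α.act n g a) = β.act n g (app n a)

variable {α : SimplicialAction G A} {β : SimplicialAction G B} {γ : SimplicialAction G C}

namespace Hom

/-- The induced map of modules in a given dimension. -/
def repHom (φ : Hom α β) (n : SimplexCategoryᵒᵖ) : α.rep n ⟶ β.rep n :=
  Rep.ofHom (k := ULift.{u} ℤ)
    { toFun := fun a => φ.app n a
      map_add' := fun a b => map_add (φ.app n) a b
      map_smul' := fun c a => map_zsmul (φ.app n) c.down a
      isIntertwining' := fun g => by ext a; exact φ.act_app n g a }

/-- The induced map of simplicial chain complexes. -/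
noncomputable def chains (φ : Hom α β) : α.chains ⟶ β.chains where
  app n := groupHomology.chainsMap (MonoidHom.id _) (φ.repHom n)
  naturality m n f := by
    change groupHomology.chainsMap _ _ ≫ groupHomology.chainsMap _ _ =
      groupHomology.chainsMap _ _ ≫ groupHomology.chainsMap _ _
    rw [← groupHomology.chainsMap_comp, ← groupHomology.chainsMap_comp]
    refine groupHomology.chainsMap_congr rfl ?_
    ext a
    exact φ.map_app f a

/-- The induced map of bicomplexes. -/
noncomputable def bicomplex (φ : Hom α β) : α.bicomplex ⟶ β.bicomplex :=
  (AlgebraicTopology.alternatingFaceMapComplex _).map φ.chains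

theorem bicomplex_f_apply (φ : Hom α β) (p q : ℕ)
    (x : (Fin q → G.obj (Opposite.op ⦋p⦌)) →₀ A.obj (Opposite.op ⦋p⦌)) :
    (φ.bicomplex.f p).f q x = Finsupp.mapRange (φ.app _) (map_zero _) x := by
  have := groupHomology.chainsMap_id_f_hom_eq_mapRange q (φ.repHom (Opposite.op ⦋p⦌))
  exact congrArg (fun f => f x) this

theorem bicomplex_f_eq (φ : Hom α β) (p q : ℕ) :
    (⇑((φ.bicomplex.f p).f q) : ((Fin q → G.obj (Opposite.op ⦋p⦌)) →₀ A.obj (Opposite.op ⦋p⦌)) →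
      ((Fin q → G.obj (Opposite.op ⦋p⦌)) →₀ B.obj (Opposite.op ⦋p⦌))) =
    Finsupp.mapRange (φ.app _) (map_zero _) :=
  funext (φ.bicomplex_f_apply p q)

theorem bicomplex_injective (φ : Hom α β) (h : ∀ n, Function.Injective (φ.app n)) (p q : ℕ) :
    Function.Injective ((φ.bicomplex.f p).f q) := by
  refine (φ.bicomplex_f_eq p q).symm ▸ ?_
  exact Finsupp.mapRange_injective (φ.app (Opposite.op ⦋p⦌)) (map_zero _) (h _)

theorem bicomplex_surjective (φ : Hom α β) (h : ∀ n, Function.Surjective (φ.app n)) (p q : ℕ) :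
    Function.Surjective ((φ.bicomplex.f p).f q) := by
  refine (φ.bicomplex_f_eq p q).symm ▸ ?_
  exact Finsupp.mapRange_surjective (φ.app (Opposite.op ⦋p⦌)) (map_zero _) (h _)

theorem bicomplex_exact (φ : Hom α β) (ψ : Hom β γ)
    (h : ∀ n, Function.Exact (φ.app n) (ψ.app n)) (p q : ℕ) :
    Function.Exact ((φ.bicomplex.f p).f q) ((ψ.bicomplex.f p).f q) := by
  suffices H : Function.Exact (Finsupp.mapRange (α := Fin q → G.obj (Opposite.op ⦋p⦌))
      (φ.app (Opposite.op ⦋p⦌)) (map_zero _)) (Finsupp.mapRange (ψ.app _) (map_zero _)) by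
    rw [← bicomplex_f_eq, ← bicomplex_f_eq] at H
    exact H
  intro y
  constructor
  · intro hy
    choose s hs using fun b : {b // ψ.app (Opposite.op ⦋p⦌) b = 0} => (h _ _).1 b.2
    classical
    -- The chosen preimage of `0` need not be `0`, so it is replaced by `0` to keep the support
    -- finite.
    refine ⟨Finsupp.onFinset y.support (fun i => if y i = 0 then 0 else
      s ⟨y i, by simpa using DFunLike.congr_fun hy i⟩) (by intro i; aesop), ?_⟩
    ext i
    by_cases hi : y i = 0
    · simp [hi]
    · simp [hi, hs]
  · rintro ⟨x, rfl⟩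
    ext i
    simpa using (h _ _).2 ⟨x i, rfl⟩

/-- The induced map of total complexes. -/
noncomputable def tot (φ : Hom α β) : α.bicomplex.tot ⟶ β.bicomplex.tot :=
  HomologicalComplex₂.total.map φ.bicomplex (ComplexShape.down ℕ)

theorem tot_exact (φ : Hom α β) (ψ : Hom β γ)
    (h : ∀ n, Function.Exact (φ.app n) (ψ.app n)) (n : ℕ) :
    Function.Exact (φ.tot.f n) (ψ.tot.f n) :=
  HomologicalComplex₂.tot_map_exact _ _ (bicomplex_exact φ ψ h) n

theorem tot_surjective (φ : Hom α β) (h : ∀ n, Function.Surjective (φ.app n)) (n : ℕ) :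
    Function.Surjective (φ.tot.f n) :=
  HomologicalComplex₂.tot_map_surjective _ (φ.bicomplex_surjective h) n

/-- The connecting isomorphism of a short exact sequence of coefficients whose middle term is
acyclic in two consecutive degrees. -/
theorem nonempty_homology_iso (φ : Hom α β) (ψ : Hom β γ)
    (hi : ∀ n, Function.Injective (φ.app n)) (h : ∀ n, Function.Exact (φ.app n) (ψ.app n))
    (hs : ∀ n, Function.Surjective (ψ.app n)) (n : ℕ)
    (h₁ : Limits.IsZero (β.homology (n + 1))) (h₀ : Limits.IsZero (β.homology n)) :
    Nonempty (γ.homology (n + 1) ≅ α.homology n) :=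
  ⟨(HomologicalComplex₂.tot_shortExact φ.bicomplex ψ.bicomplex (φ.bicomplex_injective hi)
    (bicomplex_exact φ ψ h) (ψ.bicomplex_surjective hs)).δIso (n + 1) n rfl h₁ h₀⟩

/-- If the middle term of a short exact sequence of coefficients is acyclic in degree `n + 1`
and the left term in degree `n`, then the right term is acyclic in degree `n + 1`. -/
theorem isZero_homology_succ (φ : Hom α β) (ψ : Hom β γ)
    (hi : ∀ n, Function.Injective (φ.app n)) (h : ∀ n, Function.Exact (φ.app n) (ψ.app n))
    (hs : ∀ n, Function.Surjective (ψ.app n)) (n : ℕ)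
    (h₁ : Limits.IsZero (β.homology (n + 1))) (h₀ : Limits.IsZero (α.homology n)) :
    Limits.IsZero (γ.homology (n + 1)) := by
  have S := HomologicalComplex₂.tot_shortExact φ.bicomplex ψ.bicomplex (φ.bicomplex_injective hi)
    (bicomplex_exact φ ψ h) (ψ.bicomplex_surjective hs)
  have hm := S.mono_δ (n + 1) n rfl h₁
  exact @Limits.IsZero.of_mono _ _ _ _ _ _ hm h₀

end Hom

/-! ### Zeroth homology and the differentials of the bicomplex on generators. -/

/-- The elements of `A₀` whose class in `H₀` vanishes. -/
def zeroBoundary (α : SimplicialAction G A) : AddSubgroup (A.obj (Opposite.op ⦋0⦌)) :=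
  AddSubgroup.closure ({x | ∃ g a, x = α.act _ g a - a} ∪
    {x | ∃ b : A.obj (Opposite.op ⦋1⦌), x = A.δ 0 b - A.δ 1 b})

theorem Hom.zeroBoundary_le (φ : Hom α β) {x : A.obj (Opposite.op ⦋0⦌)}
    (hx : x ∈ α.zeroBoundary) : φ.app _ x ∈ β.zeroBoundary := by
  have : α.zeroBoundary ≤ β.zeroBoundary.comap (φ.app _) := by
    refine (AddSubgroup.closure_le _).2 ?_
    rintro _ (⟨g, a, rfl⟩ | ⟨b, rfl⟩)
    · refine AddSubgroup.subset_closure (Or.inl ⟨g, φ.app _ a, ?_⟩)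
      rw [map_sub, φ.act_app]
    · refine AddSubgroup.subset_closure (Or.inr ⟨φ.app _ b, ?_⟩)
      rw [map_sub]
      exact congrArg₂ _ (φ.map_app _ _) (φ.map_app _ _)
  exact this hx

/-- The chains of bar degree zero. -/
noncomputable def chainsZero (A : SimplicialObject AddCommGrpCat.{u}) (p : ℕ) :
    A.obj (Opposite.op ⦋p⦌) ≃+ ((Fin 0 → G.obj (Opposite.op ⦋p⦌)) →₀ A.obj (Opposite.op ⦋p⦌)) :=
  (Finsupp.uniqueAddEquiv default).symm

/-- The scalars are a lifted copy of `ℤ`; this converts the signs of the bar differential into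
integer multiples. -/
theorem neg_one_pow_down (k : ℕ) : ((-1 : ULift.{u} ℤ) ^ k).down = (-1 : ℤ) ^ k := by
  induction k with
  | zero => rfl
  | succ k ih => rw [pow_succ, pow_succ, ULift.mul_down, ih]; rfl

theorem smul_single_rep (α : SimplicialAction G A) (n : SimplexCategoryᵒᵖ) {ι : Type*} (i : ι)
    (c : ULift.{u} ℤ) (a : A.obj n) :
    (c • Finsupp.single i a : ι →₀ α.rep n) = (Finsupp.single i (c.down • a) : ι →₀ A.obj n) :=
  Finsupp.smul_single (M := α.rep n) c i a

theorem bicomplex_d_vertical (α : SimplicialAction G A) (p q : ℕ)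
    (g : Fin (q + 1) → G.obj (Opposite.op ⦋p⦌)) (a : A.obj (Opposite.op ⦋p⦌)) :
    (α.bicomplex.X p).d (q + 1) q (Finsupp.single g a) =
      (Finsupp.single (fun i => g i.succ) (α.act _ (g 0)⁻¹ a) +
        ∑ j : Fin (q + 1), Finsupp.single (Fin.contractNth j (· * ·) g) ((-1 : ℤ) ^ ((j : ℕ) + 1) • a)
        : (Fin q → G.obj (Opposite.op ⦋p⦌)) →₀ A.obj (Opposite.op ⦋p⦌)) := by
  have h := groupHomology.inhomogeneousChains.d_def (α.rep (Opposite.op ⦋p⦌)) q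
  have h2 := groupHomology.inhomogeneousChains.d_single (A := α.rep (Opposite.op ⦋p⦌)) q g a
  have h3 := congrArg (fun f => f.hom (Finsupp.single g a)) h
  refine (h3.trans h2).trans ?_
  refine congrArg₂ (· + ·) rfl (Finset.sum_congr rfl fun j _ => ?_)
  rw [← neg_one_pow_down.{u}]
  exact smul_single_rep α _ _ _ a

theorem sum_zsmul_apply {R : Type u} [Ring R] {M N : ModuleCat.{u} R} {ι : Type*} (s : Finset ι)
    (c : ι → ℤ) (f : ι → (M ⟶ N)) (x : M) : (∑ i ∈ s, c i • f i) x = ∑ i ∈ s, c i • f i x := by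
  simp [ModuleCat.hom_sum, LinearMap.sum_apply]

theorem chains_δ_apply (α : SimplicialAction G A) (p : ℕ) (i : Fin (p + 2))
    (a : A.obj (Opposite.op ⦋p + 1⦌)) :
    (α.chains.δ i).f 0 (chainsZero (G := G) A (p + 1) a) =
      chainsZero (G := G) A p (A.δ i a) := by
  refine (groupHomology.chainsMap_f_single (G.map (SimplexCategory.δ i).op).hom
    (α.repMap (SimplexCategory.δ i).op) 0 default a).trans ?_
  exact congrArg (fun x => Finsupp.single x (A.δ i a)) (Subsingleton.elim _ _)

theorem bicomplex_d_horizontal (α : SimplicialAction G A) (p : ℕ)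
    (a : A.obj (Opposite.op ⦋p + 1⦌)) :
    (α.bicomplex.d (p + 1) p).f 0 (chainsZero (G := G) A (p + 1) a) =
      chainsZero (G := G) A p (∑ i : Fin (p + 2), (-1 : ℤ) ^ (i : ℕ) • A.δ i a) := by
  have h : α.bicomplex.d (p + 1) p = ∑ i : Fin (p + 2), (-1 : ℤ) ^ (i : ℕ) • α.chains.δ i :=
    AlgebraicTopology.alternatingFaceMapComplex_obj_d _ _
  have h1 : (α.bicomplex.d (p + 1) p).f 0 =
      ∑ i : Fin (p + 2), (-1 : ℤ) ^ (i : ℕ) • (α.chains.δ i).f 0 := by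
    have := (HomologicalComplex.eval (ModuleCat.{u} (ULift.{u} ℤ)) (ComplexShape.down ℕ) 0).map_sum
      (fun i : Fin (p + 2) => (-1 : ℤ) ^ (i : ℕ) • α.chains.δ i) Finset.univ
    rw [← h] at this
    exact this
  rw [h1]
  refine (sum_zsmul_apply _ _ _ _).trans ?_
  rw [map_sum]
  refine Finset.sum_congr rfl fun i _ => ?_
  rw [map_zsmul]
  exact congrArg ((-1 : ℤ) ^ (i : ℕ) • ·) (α.chains_δ_apply p i a)

end SimplicialAction

/-! ### The bar complex of a group homomorphism -/

namespace BarComplex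

open FreeAbelianGroup (of lift lift_ext lift_apply_of map_of_apply map_comp_apply map_id_apply)

section Differentials

variable {E G : Type*} [Group E] [Group G] (π : E →* G)

/-- The differential `ℤ[G × E] → ℤ[G]`. -/
def d₁ : FreeAbelianGroup (G × E) →+ FreeAbelianGroup (G × PUnit.{u + 1}) :=
  lift fun x => of (x.1 * π x.2, ⟨⟩) - of (x.1, ⟨⟩)

/-- The differential `ℤ[G × E²] → ℤ[G × E]`. -/
def d₂ : FreeAbelianGroup (G × E × E) →+ FreeAbelianGroup (G × E) :=
  lift fun x => of (x.1 * π x.2.1, x.2.2) - of (x.1, x.2.1 * x.2.2) + of (x.1, x.2.1)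

/-- The differential `ℤ[G × E³] → ℤ[G × E²]`. -/
def d₃ : FreeAbelianGroup (G × E × E × E) →+ FreeAbelianGroup (G × E × E) :=
  lift fun x => of (x.1 * π x.2.1, x.2.2) - of (x.1, x.2.1 * x.2.2.1, x.2.2.2) +
    of (x.1, x.2.1, x.2.2.1 * x.2.2.2) - of (x.1, x.2.1, x.2.2.1)

/-- The differential `ℤ[G × E⁴] → ℤ[G × E³]`. -/
def d₄ : FreeAbelianGroup (G × E × E × E × E) →+ FreeAbelianGroup (G × E × E × E) :=
  lift fun x => of (x.1 * π x.2.1, x.2.2) - of (x.1, x.2.1 * x.2.2.1, x.2.2.2) +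
    of (x.1, x.2.1, x.2.2.1 * x.2.2.2.1, x.2.2.2.2) -
    of (x.1, x.2.1, x.2.2.1, x.2.2.2.1 * x.2.2.2.2) + of (x.1, x.2.1, x.2.2.1, x.2.2.2.1)

@[simp] theorem d₁_of (g : G) (a : E) : d₁.{u} π (of (g, a)) = of (g * π a, ⟨⟩) - of (g, ⟨⟩) :=
  lift_apply_of _ _

@[simp] theorem d₂_of (g : G) (a b : E) : d₂ π (of (g, a, b)) =
    of (g * π a, b) - of (g, a * b) + of (g, a) :=
  lift_apply_of _ _

@[simp] theorem d₃_of (g : G) (a b c : E) : d₃ π (of (g, a, b, c)) =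
    of (g * π a, b, c) - of (g, a * b, c) + of (g, a, b * c) - of (g, a, b) :=
  lift_apply_of _ _

@[simp] theorem d₄_of (g : G) (a b c e : E) : d₄ π (of (g, a, b, c, e)) =
    of (g * π a, b, c, e) - of (g, a * b, c, e) + of (g, a, b * c, e) - of (g, a, b, c * e) +
      of (g, a, b, c) :=
  lift_apply_of _ _

theorem d₁_d₂ (x : FreeAbelianGroup (G × E × E)) : d₁.{u} π (d₂ π x) = 0 := by
  refine DFunLike.congr_fun (f := (d₁ π).comp (d₂ π)) (g := 0) (lift_ext _ _ ?_) x
  rintro ⟨g, a, b⟩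
  simp [mul_assoc]

theorem d₂_d₃ (x : FreeAbelianGroup (G × E × E × E)) : d₂ π (d₃ π x) = 0 := by
  refine DFunLike.congr_fun (f := (d₂ π).comp (d₃ π)) (g := 0) (lift_ext _ _ ?_) x
  rintro ⟨g, a, b, c⟩
  simp [mul_assoc]
  abel

theorem d₃_d₄ (x : FreeAbelianGroup (G × E × E × E × E)) : d₃ π (d₄ π x) = 0 := by
  refine DFunLike.congr_fun (f := (d₃ π).comp (d₄ π)) (g := 0) (lift_ext _ _ ?_) x
  rintro ⟨g, a, b, c, e⟩
  simp [mul_assoc]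
  abel

end Differentials

section Naturality

variable {E G E' G' : Type*} [Group E] [Group G] [Group E'] [Group G'] (π : E →* G)
  (π' : E' →* G') (f : E → E') (hf : ∀ a b, f (a * b) = f a * f b) (k : G → G')
  (hk : ∀ g a, k (g * π a) = k g * π' (f a))

-- The map `k` is only required to commute with right translation through `π`. This single form
-- covers simplicial operators, left multiplication by an element of `G` (with `f = id`), and the
-- augmentation (with `k` constant).
include hk in
theorem map_d₁ (x : FreeAbelianGroup (G × E)) :
    d₁.{u} π' (FreeAbelianGroup.map (Prod.map k f) x) = FreeAbelianGroup.map (Prod.map k id) (d₁.{u} π x) := by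
  refine DFunLike.congr_fun (f := (d₁ π').comp (FreeAbelianGroup.map _)) (g := (FreeAbelianGroup.map _).comp (d₁ π))
    (lift_ext _ _ ?_) x
  rintro ⟨g, a⟩
  simp [hk]

include hf hk in
theorem map_d₂ (x : FreeAbelianGroup (G × E × E)) :
    d₂ π' (FreeAbelianGroup.map (Prod.map k (Prod.map f f)) x) = FreeAbelianGroup.map (Prod.map k f) (d₂ π x) := by
  refine DFunLike.congr_fun (f := (d₂ π').comp (FreeAbelianGroup.map _)) (g := (FreeAbelianGroup.map _).comp (d₂ π))
    (lift_ext _ _ ?_) x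
  rintro ⟨g, a, b⟩
  simp [hf, hk]

include hf hk in
theorem map_d₃ (x : FreeAbelianGroup (G × E × E × E)) :
    d₃ π' (FreeAbelianGroup.map (Prod.map k (Prod.map f (Prod.map f f))) x) =
      FreeAbelianGroup.map (Prod.map k (Prod.map f f)) (d₃ π x) := by
  refine DFunLike.congr_fun (f := (d₃ π').comp (FreeAbelianGroup.map _)) (g := (FreeAbelianGroup.map _).comp (d₃ π))
    (lift_ext _ _ ?_) x
  rintro ⟨g, a, b, c⟩
  simp [hf, hk]

include hf hk in
theorem map_d₄ (x : FreeAbelianGroup (G × E × E × E × E)) :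
    d₄ π' (FreeAbelianGroup.map (Prod.map k (Prod.map f (Prod.map f (Prod.map f f)))) x) =
      FreeAbelianGroup.map (Prod.map k (Prod.map f (Prod.map f f))) (d₄ π x) := by
  refine DFunLike.congr_fun (f := (d₄ π').comp (FreeAbelianGroup.map _)) (g := (FreeAbelianGroup.map _).comp (d₄ π))
    (lift_ext _ _ ?_) x
  rintro ⟨g, a, b, c, e⟩
  simp [hf, hk]

end Naturality

/-! ### Exactness for free groups -/

/-- A universal derivation on a group `E` with values in a free module, splitting the augmentation
ideal. It exists if and only if `E` is free. -/
structure FoxDerivation (E : Type*) [Group E] where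
  /-- the basis -/
  {S : Type*}
  /-- the elements of `E` that correspond to the basis -/
  s : S → E
  /-- the derivation -/
  Λ : E → FreeAbelianGroup (E × S)
  Λ_mul : ∀ a b, Λ (a * b) = Λ a + FreeAbelianGroup.map (Prod.map (a * ·) id) (Λ b)
  boundary : ∀ a, lift (fun x : E × S => of (x.1 * s x.2) - of x.1) (Λ a) = of a - of 1

/-- The action of a group `E` on `ℤ[E × S]`, in multiplicative notation. -/
def translation (E S : Type*) [Group E] :
    E →* MulAut (Multiplicative (FreeAbelianGroup (E × S))) where
  toFun a :=
    { toFun := fun x => .ofAdd (FreeAbelianGroup.map (Prod.map (a * ·) id) x.toAdd)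
      invFun := fun x => .ofAdd (FreeAbelianGroup.map (Prod.map (a⁻¹ * ·) id) x.toAdd)
      left_inv := fun x => by
        change FreeAbelianGroup.map _ (FreeAbelianGroup.map _ _) = _
        rw [← map_comp_apply, Prod.map_comp_map]
        exact (congrArg (fun f => FreeAbelianGroup.map f _)
          (funext fun ⟨b, c⟩ => by simp)).trans (map_id_apply x.toAdd)
      right_inv := fun x => by
        change FreeAbelianGroup.map _ (FreeAbelianGroup.map _ _) = _
        rw [← map_comp_apply, Prod.map_comp_map]
        exact (congrArg (fun f => FreeAbelianGroup.map f _)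
          (funext fun ⟨b, c⟩ => by simp)).trans (map_id_apply x.toAdd)
      map_mul' := fun x y => map_add (FreeAbelianGroup.map _) x.toAdd y.toAdd }
  map_one' := by
    ext x
    change FreeAbelianGroup.map _ _ = _
    exact (congrArg (fun f => FreeAbelianGroup.map f _)
      (funext fun ⟨b, c⟩ => by simp)).trans (map_id_apply x.toAdd)
  map_mul' a b := by
    ext x
    change FreeAbelianGroup.map _ _ = FreeAbelianGroup.map _ (FreeAbelianGroup.map _ _)
    rw [← map_comp_apply, Prod.map_comp_map]
    exact congrArg (fun f => FreeAbelianGroup.map f x.toAdd)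
      (funext fun ⟨b, c⟩ => by simp [mul_assoc])

/-- The Fox derivation on a free group. -/
def foxFreeGroup (S : Type*) : FoxDerivation (FreeGroup S) := by
  let N := Multiplicative (FreeAbelianGroup (FreeGroup S × S))
  -- A crossed homomorphism to `N` is the left component of a homomorphic section of `N ⋊ FreeGroup
  -- S → FreeGroup S`, and on a free group such a section may be prescribed on generators.
  let Φ : FreeGroup S →* N ⋊[translation (FreeGroup S) S] FreeGroup S :=
    FreeGroup.lift fun s => ⟨.ofAdd (of (1, s)), FreeGroup.of s⟩
  have hΦ (w : FreeGroup S) : (Φ w).right = w :=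
    DFunLike.congr_fun (f := SemidirectProduct.rightHom.comp Φ) (g := MonoidHom.id _)
      (FreeGroup.ext_hom _ _ fun s => by simp [Φ]) w
  have hmul (a b : FreeGroup S) : (Φ (a * b)).left.toAdd =
      (Φ a).left.toAdd + FreeAbelianGroup.map (Prod.map (a * ·) id) (Φ b).left.toAdd := by
    rw [map_mul, SemidirectProduct.mul_left, hΦ a]
    rfl
  refine ⟨FreeGroup.of, fun w => (Φ w).left.toAdd, hmul, ?_⟩
  have htr (a : FreeGroup S) (x : FreeAbelianGroup (FreeGroup S × S)) :
      lift (fun x : FreeGroup S × S => of (x.1 * FreeGroup.of x.2) - of x.1)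
        (FreeAbelianGroup.map (Prod.map (a * ·) id) x) =
      FreeAbelianGroup.map (a * ·) (lift (fun x : FreeGroup S × S => of (x.1 * FreeGroup.of x.2) - of x.1) x) := by
    refine DFunLike.congr_fun (f := (lift _).comp (FreeAbelianGroup.map _)) (g := (FreeAbelianGroup.map _).comp (lift _))
      (lift_ext _ _ ?_) x
    rintro ⟨w, s⟩
    simp [mul_assoc]
  -- Both `D` and `w ↦ w - 1` are crossed homomorphisms, so it suffices that they agree on
  -- generators.
  let D (w : FreeGroup S) := lift (fun x : FreeGroup S × S => of (x.1 * FreeGroup.of x.2) - of x.1)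
    (Φ w).left.toAdd
  have hD (a b) : D (a * b) = D a + FreeAbelianGroup.map (a * ·) (D b) := by
    change lift _ _ = _
    rw [hmul, map_add, htr]
  have hD1 : D 1 = 0 := by
    change lift _ (Φ 1).left.toAdd = 0
    rw [map_one]; exact map_zero _
  intro w
  change D w = _
  induction w using FreeGroup.induction_on with
  | C1 => rw [hD1, sub_self]
  | of s =>
    change lift _ (Φ (FreeGroup.of s)).left.toAdd = _
    simp [Φ]
  | inv_of s ih =>
    have h := hD (FreeGroup.of s)⁻¹ (FreeGroup.of s)
    rw [inv_mul_cancel, hD1, ih] at h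
    rw [eq_neg_of_add_eq_zero_left h.symm]
    simp
  | mul a b iha ihb =>
    rw [hD, iha, ihb]
    simp

/-- Transport of a Fox derivation along an isomorphism. -/
def FoxDerivation.transport {E E' : Type*} [Group E] [Group E'] (φ : FoxDerivation E)
    (e : E ≃* E') : FoxDerivation E' where
  S := φ.S
  s := fun x => e (φ.s x)
  Λ := fun a => FreeAbelianGroup.map (Prod.map e id) (φ.Λ (e.symm a))
  Λ_mul a b := by
    rw [map_mul, φ.Λ_mul, map_add, ← map_comp_apply, ← map_comp_apply]
    congr 3
    ext ⟨x, y⟩ <;> simp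
  boundary a := by
    have h := congrArg (FreeAbelianGroup.map e) (φ.boundary (e.symm a))
    simp only [map_sub, map_of_apply, e.apply_symm_apply, map_one] at h
    rw [← h]
    refine DFunLike.congr_fun (f := (lift _).comp (FreeAbelianGroup.map _)) (g := (FreeAbelianGroup.map _).comp (lift _))
      (lift_ext _ _ ?_) _
    rintro ⟨w, s⟩
    simp

section Exactness

variable {E G : Type*} [Group E] [Group G] (π : E →* G) (φ : FoxDerivation E)

/-- The part of the contraction of the bar complex given by the Fox derivation. -/
def h₁ : FreeAbelianGroup (G × E) →+ FreeAbelianGroup (G × E × E) :=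
  lift fun x => FreeAbelianGroup.map (fun y => (x.1, y.1, φ.s y.2)) (φ.Λ x.2) - of (x.1, 1, 1)

/-- The contraction of the bar complex of a free group in degree two. -/
def h₂ : FreeAbelianGroup (G × E × E) →+ FreeAbelianGroup (G × E × E × E) :=
  lift fun x => FreeAbelianGroup.map (fun y => (x.1, x.2.1, y.1, φ.s y.2)) (φ.Λ x.2.2) - of (x.1, x.2.1, 1, 1)

/-- The contraction of the bar complex of a free group in degree three. -/
def h₃ : FreeAbelianGroup (G × E × E × E) →+ FreeAbelianGroup (G × E × E × E × E) :=
  lift fun x => FreeAbelianGroup.map (fun y => (x.1, x.2.1, x.2.2.1, y.1, φ.s y.2)) (φ.Λ x.2.2.2) -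
    of (x.1, x.2.1, x.2.2.1, 1, 1)

/-- A free group has the resolution `ℤ[E × S] → ℤ[E]` of length one, and `Λ` retracts the bar
resolution onto it. The summand `(…, 1, 1)` in `h₁` and `h₂` is needed because the bar complex is
not normalised: it removes the term `(g, a, 1)` that comes from the `- 1` in the boundary of `Λ b`.
-/
theorem contraction_two (x : FreeAbelianGroup (G × E × E)) :
    d₃ π (h₂ φ x) - h₁ φ (d₂ π x) = x := by
  refine DFunLike.congr_fun (f := (d₃ π).comp (h₂ φ) - (h₁ φ).comp (d₂ π))
    (g := AddMonoidHom.id _) (lift_ext _ _ ?_) x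
  rintro ⟨g, a, b⟩
  -- The last two faces of `(g, a, p, s)` together form the Fox boundary of `(p, s)`, and the first
  -- two the translates needed for `Λ_mul`.
  have key (y : FreeAbelianGroup (E × φ.S)) :
      d₃ π (FreeAbelianGroup.map (fun y => (g, a, y.1, φ.s y.2)) y) =
        FreeAbelianGroup.map (fun y => (g * π a, y.1, φ.s y.2)) y -
        FreeAbelianGroup.map (fun y => (g, y.1, φ.s y.2)) (FreeAbelianGroup.map (Prod.map (a * ·) id) y) +
        FreeAbelianGroup.map (fun w => (g, a, w)) (lift (fun x => of (x.1 * φ.s x.2) - of x.1) y) := by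
    refine DFunLike.congr_fun (f := (d₃ π).comp (FreeAbelianGroup.map _))
      (g := FreeAbelianGroup.map (fun y : E × φ.S => (g * π a, y.1, φ.s y.2)) -
        (FreeAbelianGroup.map (fun y : E × φ.S => (g, y.1, φ.s y.2))).comp
          (FreeAbelianGroup.map (Prod.map (a * ·) id)) +
        (FreeAbelianGroup.map (fun w => (g, a, w))).comp
          (lift (fun x : E × φ.S => of (x.1 * φ.s x.2) - of x.1))) (lift_ext _ _ ?_) y
    rintro ⟨p, s⟩
    simp
    abel
  simp [h₁, h₂, key, φ.boundary, φ.Λ_mul]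
  abel

theorem contraction_three (x : FreeAbelianGroup (G × E × E × E)) :
    d₄ π (h₃ φ x) - h₂ φ (d₃ π x) = -x := by
  refine DFunLike.congr_fun (f := (d₄ π).comp (h₃ φ) - (h₂ φ).comp (d₃ π))
    (g := -AddMonoidHom.id _) (lift_ext _ _ ?_) x
  rintro ⟨g, a, b, c⟩
  have key (y : FreeAbelianGroup (E × φ.S)) :
      d₄ π (FreeAbelianGroup.map (fun y => (g, a, b, y.1, φ.s y.2)) y) =
        FreeAbelianGroup.map (fun y => (g * π a, b, y.1, φ.s y.2)) y -
        FreeAbelianGroup.map (fun y => (g, a * b, y.1, φ.s y.2)) y +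
        FreeAbelianGroup.map (fun y => (g, a, y.1, φ.s y.2)) (FreeAbelianGroup.map (Prod.map (b * ·) id) y) -
        FreeAbelianGroup.map (fun w => (g, a, b, w)) (lift (fun x => of (x.1 * φ.s x.2) - of x.1) y) := by
    refine DFunLike.congr_fun (f := (d₄ π).comp (FreeAbelianGroup.map _))
      (g := FreeAbelianGroup.map (fun y : E × φ.S => (g * π a, b, y.1, φ.s y.2)) -
        FreeAbelianGroup.map (fun y : E × φ.S => (g, a * b, y.1, φ.s y.2)) +
        (FreeAbelianGroup.map (fun y : E × φ.S => (g, a, y.1, φ.s y.2))).comp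
          (FreeAbelianGroup.map (Prod.map (b * ·) id)) -
        (FreeAbelianGroup.map (fun w => (g, a, b, w))).comp
          (lift (fun x : E × φ.S => of (x.1 * φ.s x.2) - of x.1))) (lift_ext _ _ ?_) y
    rintro ⟨p, s⟩
    simp
    abel
  simp [h₂, h₃, key, φ.boundary, φ.Λ_mul]
  abel

include φ in
/-- The bar complex of a homomorphism from a free group is exact in degree two. -/
theorem exact_two {x : FreeAbelianGroup (G × E × E)} (hx : d₂ π x = 0) : ∃ y, d₃ π y = x :=
  ⟨h₂ φ x, by simpa [hx] using contraction_two π φ x⟩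

include φ in
/-- The bar complex of a homomorphism from a free group is exact in degree three. -/
theorem exact_three {x : FreeAbelianGroup (G × E × E × E)} (hx : d₃ π x = 0) :
    ∃ y, d₄ π y = x :=
  ⟨-h₃ φ x, by simpa [hx] using congrArg Neg.neg (contraction_three π φ x)⟩

end Exactness

end BarComplex

namespace SimplicialAction

variable {G T : SimplicialObject GrpCat.{u}} {A B C : SimplicialObject AddCommGrpCat.{u}}
  {α : SimplicialAction G A} {β : SimplicialAction G B} {γ : SimplicialAction G C}

open HomologicalComplex₂

/-! ### Boundaries in total degree zero -/

section

variable {K : HomologicalComplex₂ (ModuleCat.{u} (ULift.{u} ℤ)) (ComplexShape.down ℕ)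
  (ComplexShape.down ℕ)}

theorem tot_d_totι_zero_one (x : (K.X 0).X 1) :
    K.tot.d 1 0 (K.totι 0 1 1 rfl x) = K.totι 0 0 0 rfl ((K.X 0).d 1 0 x) := by
  rw [tot_d_one_apply, totπ_totι_apply, totπ_totι_apply_ne _ _ _ _ _ _ _ (by omega),
    map_zero]
  exact congrArg _ (zero_add _)

theorem tot_d_totι_one_zero (x : (K.X 1).X 0) :
    K.tot.d 1 0 (K.totι 1 0 1 rfl x) = K.totι 0 0 0 rfl ((K.d 1 0).f 0 x) := by
  rw [tot_d_one_apply, totπ_totι_apply, totπ_totι_apply_ne _ _ _ _ _ _ _ (by omega),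
    map_zero]
  exact congrArg _ (add_zero _)

end

theorem d_one_zero_single (α : SimplicialAction G A) (p : ℕ)
    (g : Fin 1 → G.obj (Opposite.op ⦋p⦌)) (a : A.obj (Opposite.op ⦋p⦌)) :
    (α.bicomplex.X p).d 1 0 (Finsupp.single g a) =
      chainsZero (G := G) A p (α.act _ (g 0)⁻¹ a - a) := by
  refine (α.bicomplex_d_vertical p 0 g a).trans ?_
  rw [map_sub, sub_eq_add_neg, ← map_neg]
  refine congrArg₂ (· + ·) ?_ ?_
  · exact congrArg (fun x => Finsupp.single x _) (Subsingleton.elim _ _)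
  · simp only [Fin.sum_univ_succ, Finset.univ_eq_empty, Finset.sum_empty, add_zero,
      Fin.val_zero, zero_add, pow_one, neg_smul, one_smul]
    exact congrArg (fun x => Finsupp.single x _) (Subsingleton.elim _ _)

theorem exists_zeroBoundary (α : SimplicialAction G A)
    (x : (Fin 1 → G.obj (Opposite.op ⦋0⦌)) →₀ A.obj (Opposite.op ⦋0⦌)) :
    ∃ a ∈ α.zeroBoundary, (α.bicomplex.X 0).d 1 0 x = chainsZero (G := G) A 0 a := by
  induction x using Finsupp.induction_linear with
  | zero => exact ⟨0, zero_mem _, by rw [map_zero]; exact map_zero _⟩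
  | add x y hx hy =>
    obtain ⟨a, ha, hxa⟩ := hx
    obtain ⟨b, hb, hyb⟩ := hy
    refine ⟨a + b, add_mem ha hb, ?_⟩
    rw [map_add, ← hxa, ← hyb]
    exact map_add _ _ _
  | single g a =>
    exact ⟨_, AddSubgroup.subset_closure (Or.inl ⟨_, _, rfl⟩), d_one_zero_single α 0 g a⟩

theorem d_horizontal_one (α : SimplicialAction G A) (b : A.obj (Opposite.op ⦋1⦌)) :
    (α.bicomplex.d 1 0).f 0 (chainsZero (G := G) A 1 b) =
      chainsZero (G := G) A 0 (A.δ 0 b - A.δ 1 b) := by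
  refine (α.bicomplex_d_horizontal 0 b).trans (congrArg _ ?_)
  simp [Fin.sum_univ_succ, sub_eq_add_neg]

theorem totι_injective (K : HomologicalComplex₂ (ModuleCat.{u} (ULift.{u} ℤ))
    (ComplexShape.down ℕ) (ComplexShape.down ℕ)) : Function.Injective (K.totι 0 0 0 rfl) :=
  Function.LeftInverse.injective (totπ_totι_apply 0 0 0 rfl)

/-- In total degree one there are two summands: `(1, 0)` contributes the differences of the two
faces, and `(0, 1)` the relations `ᵍa - a`. -/
theorem mem_zeroBoundary_of_tot (α : SimplicialAction G A) (a : A.obj (Opposite.op ⦋0⦌))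
    (y : α.bicomplex.tot.X 1)
    (h : α.bicomplex.tot.d 1 0 y =
      α.bicomplex.totι 0 0 0 rfl (chainsZero (G := G) A 0 a)) :
    a ∈ α.zeroBoundary := by
  rw [tot_d_one_apply] at h
  have h1 := totι_injective _ h
  obtain ⟨b, hb⟩ := (chainsZero (G := G) A 1).surjective (α.bicomplex.totπ 1 0 1 rfl y)
  obtain ⟨a', ha', hx⟩ := α.exists_zeroBoundary (α.bicomplex.totπ 0 1 1 rfl y)
  have h2 := α.d_horizontal_one b
  rw [hb] at h2
  have h3 : chainsZero (G := G) A 0 (A.δ 0 b - A.δ 1 b + a') = chainsZero (G := G) A 0 a := by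
    rw [map_add]
    exact (congrArg₂ (· + ·) h2 hx).symm.trans h1
  rw [← (chainsZero (G := G) A 0).injective h3]
  exact add_mem (AddSubgroup.subset_closure (Or.inr ⟨_, rfl⟩)) ha'

theorem exists_tot_of_mem_zeroBoundary (α : SimplicialAction G A)
    {a : A.obj (Opposite.op ⦋0⦌)} (h : a ∈ α.zeroBoundary) :
    ∃ y : α.bicomplex.tot.X 1, α.bicomplex.tot.d 1 0 y =
      α.bicomplex.totι 0 0 0 rfl (chainsZero (G := G) A 0 a) := by
  refine AddSubgroup.closure_induction (p := fun a _ => ∃ y : α.bicomplex.tot.X 1,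
    α.bicomplex.tot.d 1 0 y = α.bicomplex.totι 0 0 0 rfl (chainsZero (G := G) A 0 a))
    ?_ ?_ ?_ ?_ h
  · rintro _ (⟨g, a, rfl⟩ | ⟨b, rfl⟩)
    -- The bar differential acts through the inverse of the leading group element, hence `g⁻¹`.
    · refine ⟨α.bicomplex.totι 0 1 1 rfl (Finsupp.single (fun _ => g⁻¹) a), ?_⟩
      refine (tot_d_totι_zero_one _).trans ?_
      refine congrArg _ ((α.d_one_zero_single 0 _ a).trans ?_)
      rw [inv_inv]
    · refine ⟨α.bicomplex.totι 1 0 1 rfl (chainsZero (G := G) A 1 b), ?_⟩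
      refine (tot_d_totι_one_zero _).trans ?_
      exact congrArg _ (α.d_horizontal_one b)
  · exact ⟨0, by rw [map_zero, map_zero]; exact (map_zero _).symm⟩
  · rintro a b _ _ ⟨x, hx⟩ ⟨y, hy⟩
    refine ⟨x + y, ?_⟩
    rw [map_add, hx, hy, map_add]
    exact (map_add _ _ _).symm
  · rintro a _ ⟨x, hx⟩
    refine ⟨-x, ?_⟩
    rw [map_neg, hx, map_neg]
    exact (map_neg _ _).symm

/-- The end of the long exact sequence of a short exact sequence of coefficients, if the middle
term is acyclic in degree one and the first map is injective on zeroth homology. -/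
theorem Hom.isZero_homology_one (φ : Hom α β) (ψ : Hom β γ)
    (h : ∀ n, Function.Exact (φ.app n) (ψ.app n)) (hs : ∀ n, Function.Surjective (ψ.app n))
    (hβ : Limits.IsZero (β.homology 1))
    (h0 : ∀ a, φ.app (Opposite.op ⦋0⦌) a ∈ β.zeroBoundary → a ∈ α.zeroBoundary) :
    Limits.IsZero (γ.homology 1) := by
  refine isZero_homology_one_of_shortExact φ.tot ψ.tot (φ.tot_exact ψ h) (ψ.tot_surjective hs)
    hβ fun x y hxy => ?_
  have hx : α.bicomplex.totι 0 0 0 rfl (α.bicomplex.totπ 0 0 0 rfl x) = x := by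
    refine tot_ext fun p q hpq => ?_
    obtain rfl : p = 0 := by omega
    obtain rfl : q = 0 := by omega
    rw [totπ_totι_apply]
  obtain ⟨a, ha⟩ := (chainsZero (G := G) A 0).surjective (α.bicomplex.totπ 0 0 0 rfl x)
  rw [← ha] at hx
  rw [← hx]
  refine α.exists_tot_of_mem_zeroBoundary (h0 a (β.mem_zeroBoundary_of_tot _ y ?_))
  rw [hxy, ← hx]
  have h1 := congrArg (fun f => f.hom (chainsZero (G := G) A 0 a)) (totι_map φ.bicomplex 0 0 0 rfl)
  refine h1.trans (congrArg (β.bicomplex.totι 0 0 0 rfl) ?_)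
  refine (φ.bicomplex_f_apply 0 0 _).trans ?_
  exact Finsupp.mapRange_single

/-! ### Free coefficient systems -/

/-- The free abelian simplicial group on `G × T`. -/
def freeObj (G T : SimplicialObject GrpCat.{u}) : SimplicialObject AddCommGrpCat.{u} where
  obj n := AddCommGrpCat.of (FreeAbelianGroup (G.obj n × T.obj n))
  map f := AddCommGrpCat.ofHom (FreeAbelianGroup.map (Prod.map (G.map f) (T.map f)))
  map_id n := by
    refine AddCommGrpCat.hom_ext (FreeAbelianGroup.lift_ext _ _ fun x => ?_)
    refine (FreeAbelianGroup.map_of_apply _).trans ?_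
    rw [G.map_id, T.map_id]
    rfl
  map_comp f g := by
    refine AddCommGrpCat.hom_ext (FreeAbelianGroup.lift_ext _ _ fun x => ?_)
    refine (FreeAbelianGroup.map_of_apply _).trans ?_
    rw [G.map_comp, T.map_comp]
    refine Eq.trans ?_ (congrArg (FreeAbelianGroup.map _) (FreeAbelianGroup.map_of_apply x)).symm
    exact (FreeAbelianGroup.map_of_apply _).symm

/-- The action of `G` on the free abelian simplicial group on `G × T` by left multiplication. -/
def freeAction (G T : SimplicialObject GrpCat.{u}) : SimplicialAction G (freeObj G T) where
  act n :=
    { toFun := fun g => (FreeAbelianGroup.map (Prod.map (g * ·) id) :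
        FreeAbelianGroup (G.obj n × T.obj n) →+ FreeAbelianGroup (G.obj n × T.obj n))
      map_one' := FreeAbelianGroup.lift_ext _ _ fun x => by
        refine (FreeAbelianGroup.map_of_apply _).trans ?_
        simp only [one_mul]
        rfl
      map_mul' := fun g h => FreeAbelianGroup.lift_ext _ _ fun x => by
        refine (FreeAbelianGroup.map_of_apply _).trans ?_
        simp only [mul_assoc]
        refine Eq.trans ?_
          (congrArg (FreeAbelianGroup.map _) (FreeAbelianGroup.map_of_apply x)).symm
        exact (FreeAbelianGroup.map_of_apply _).symm }
  map_act {m n} f g a := by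
    refine (FreeAbelianGroup.map_comp_apply _).symm.trans
      (Eq.trans ?_ (FreeAbelianGroup.map_comp_apply _))
    refine congrArg (fun t => FreeAbelianGroup.map t a) (funext fun x => ?_)
    exact Prod.ext ((G.map f).hom.map_mul _ _) rfl

/-- The basis of the free coefficient system. -/
def freeOf {n : SimplexCategoryᵒᵖ} (g : G.obj n) (t : T.obj n) : (freeObj G T).obj n :=
  FreeAbelianGroup.of (g, t)

/-- The universal property of the free coefficient system. -/
def freeLift {n : SimplexCategoryᵒᵖ} {M : Type*} [AddCommGroup M] (f : G.obj n × T.obj n → M) :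
    (freeObj G T).obj n →+ M :=
  FreeAbelianGroup.lift f

theorem freeLift_of {n : SimplexCategoryᵒᵖ} {M : Type*} [AddCommGroup M]
    (f : G.obj n × T.obj n → M) (g : G.obj n) (t : T.obj n) :
    freeLift f (freeOf g t) = f (g, t) :=
  FreeAbelianGroup.lift_apply_of _ _

theorem free_hom_ext {n : SimplexCategoryᵒᵖ} {M : Type*} [AddCommGroup M]
    {f f' : (freeObj G T).obj n →+ M} (h : ∀ g t, f (freeOf g t) = f' (freeOf g t)) : f = f' :=
  FreeAbelianGroup.lift_ext _ _ fun x => h x.1 x.2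

theorem freeAction_act (n : SimplexCategoryᵒᵖ) (g h : G.obj n) (t : T.obj n) :
    (freeAction G T).act n g (freeOf h t) = freeOf (g * h) t :=
  FreeAbelianGroup.map_of_apply _

theorem freeObj_map {m n : SimplexCategoryᵒᵖ} (f : m ⟶ n) (g : G.obj m) (t : T.obj m) :
    (freeObj G T).map f (freeOf g t) = freeOf (G.map f g) (T.map f t) :=
  FreeAbelianGroup.map_of_apply _

/-- The contraction of the columns of the bicomplex of a free coefficient system. -/
noncomputable def contraction (G T : SimplicialObject GrpCat.{u}) (p q : ℕ) :
    ((Fin q → G.obj (Opposite.op ⦋p⦌)) →₀ (freeObj G T).obj (Opposite.op ⦋p⦌)) →+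
      ((Fin (q + 1) → G.obj (Opposite.op ⦋p⦌)) →₀ (freeObj G T).obj (Opposite.op ⦋p⦌)) :=
  Finsupp.liftAddHom fun g => freeLift fun x =>
    Finsupp.single (Fin.cons x.1⁻¹ g) (freeOf 1 x.2)

theorem contraction_single (p q : ℕ) (g : Fin q → G.obj (Opposite.op ⦋p⦌))
    (h : G.obj (Opposite.op ⦋p⦌)) (t : T.obj (Opposite.op ⦋p⦌)) :
    contraction G T p q (Finsupp.single g (freeOf h t)) =
      Finsupp.single (Fin.cons h⁻¹ g) (freeOf 1 t) := by
  refine (Finsupp.liftAddHom_apply_single _ _ _).trans ?_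
  exact freeLift_of _ _ _

/-- The vertical differential of the bicomplex. -/
noncomputable def vertical (α : SimplicialAction G A) (p q : ℕ) :
    ((Fin (q + 1) → G.obj (Opposite.op ⦋p⦌)) →₀ A.obj (Opposite.op ⦋p⦌)) →+
      ((Fin q → G.obj (Opposite.op ⦋p⦌)) →₀ A.obj (Opposite.op ⦋p⦌)) :=
  ((α.bicomplex.X p).d (q + 1) q).hom.toAddMonoidHom

theorem vertical_single (α : SimplicialAction G A) (p q : ℕ)
    (g : Fin (q + 1) → G.obj (Opposite.op ⦋p⦌)) (a : A.obj (Opposite.op ⦋p⦌)) :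
    α.vertical p q (Finsupp.single g a) =
      Finsupp.single (fun i => g i.succ) (α.act _ (g 0)⁻¹ a) +
        ∑ j : Fin (q + 1), Finsupp.single (Fin.contractNth j (· * ·) g)
          ((-1 : ℤ) ^ ((j : ℕ) + 1) • a) :=
  α.bicomplex_d_vertical p q g a

theorem contractNth_zero_cons {M : Type*} [Mul M] {q : ℕ} (x : M) (g : Fin (q + 1) → M) :
    Fin.contractNth 0 (· * ·) (Fin.cons x g : Fin (q + 2) → M) =
      Fin.cons (x * g 0) (fun i => g i.succ) := by
  ext k
  refine Fin.cases ?_ (fun k => ?_) k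
  · simp [Fin.contractNth]
  · simp [Fin.contractNth]

theorem contractNth_succ_cons {M : Type*} [Mul M] {q : ℕ} (j : Fin (q + 1)) (x : M)
    (g : Fin (q + 1) → M) :
    Fin.contractNth j.succ (· * ·) (Fin.cons x g : Fin (q + 2) → M) =
      Fin.cons x (Fin.contractNth j (· * ·) g) := by
  ext k
  refine Fin.cases ?_ (fun k => ?_) k
  · simp [Fin.contractNth]
  · simp [Fin.contractNth]

/-- Prepending `h⁻¹` works because the first face lets the inverse of the leading entry act: it
turns the coefficient `(1, t)` back into `(h, t)` and restores the original chain. The remaining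
faces cancel against the contraction of the faces of the original chain. -/
theorem contraction_spec (p q : ℕ)
    (x : (Fin (q + 1) → G.obj (Opposite.op ⦋p⦌)) →₀ (freeObj G T).obj (Opposite.op ⦋p⦌)) :
    (freeAction G T).vertical p (q + 1) (contraction G T p (q + 1) x) +
      contraction G T p q ((freeAction G T).vertical p q x) = x := by
  refine DFunLike.congr_fun (f := ((freeAction G T).vertical p (q + 1)).comp
    (contraction G T p (q + 1)) + (contraction G T p q).comp ((freeAction G T).vertical p q))
    (g := AddMonoidHom.id _) (Finsupp.addHom_ext' fun g => free_hom_ext fun h t => ?_) x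
  change (freeAction G T).vertical p (q + 1) (contraction G T p (q + 1) (Finsupp.single g _)) +
    contraction G T p q ((freeAction G T).vertical p q (Finsupp.single g _)) = Finsupp.single g _
  have hs (n : ℕ) (g' : Fin q → G.obj (Opposite.op ⦋p⦌)) :
      contraction G T p q (Finsupp.single g' ((-1 : ℤ) ^ n • freeOf h t)) =
        Finsupp.single (Fin.cons h⁻¹ g') ((-1 : ℤ) ^ n • freeOf 1 t) := by
    rw [← Finsupp.smul_single, ← Finsupp.smul_single, map_zsmul, contraction_single]
  rw [contraction_single, vertical_single, vertical_single, map_add, map_sum, freeAction_act,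
    freeAction_act, contraction_single, Fin.sum_univ_succ (n := q + 1)]
  simp only [hs, contractNth_succ_cons]
  rw [contractNth_zero_cons]
  simp only [Fin.cons_zero, Fin.cons_succ, inv_inv, mul_one, Fin.val_zero, Fin.val_succ, pow_succ,
    mul_neg, neg_smul, Finsupp.single_neg, Finset.sum_neg_distrib, mul_inv_rev, zero_add, pow_zero,
    one_smul, neg_neg]
  abel

end SimplicialAction

/-! ### Extra degeneracies; only the underlying simplicial sets matter for these. -/

/-- An extra degeneracy of a simplicial group, as a simplicial set augmented towards `Q`. -/
structure ExtraDegeneracy (T : SimplicialObject GrpCat.{u}) (Q : Type u) where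
  /-- the augmentation -/
  ε : T.obj (Opposite.op ⦋0⦌) → Q
  /-- the section of the augmentation -/
  σ : Q → T.obj (Opposite.op ⦋0⦌)
  /-- the extra degeneracy -/
  s : ∀ p : ℕ, T.obj (Opposite.op ⦋p⦌) → T.obj (Opposite.op ⦋p + 1⦌)
  ε_σ : ∀ x, ε (σ x) = x
  ε_δ : ∀ x : T.obj (Opposite.op ⦋1⦌), ε (T.δ 0 x) = ε (T.δ 1 x)
  δ_zero_s : ∀ p x, T.δ 0 (s p x) = x
  δ_one_s : ∀ x, T.δ 1 (s 0 x) = σ (ε x)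
  δ_succ_s : ∀ p (i : Fin (p + 2)) x, T.δ i.succ (s (p + 1) x) = s p (T.δ i x)

/-- The constant simplicial group with trivial value. -/
def trivialSimplicialGroup : SimplicialObject GrpCat.{u} where
  obj _ := GrpCat.of PUnit.{u + 1}
  map _ := 𝟙 _

/-- The product of two simplicial groups. -/
def prodSimplicialGroup (T T' : SimplicialObject GrpCat.{u}) : SimplicialObject GrpCat.{u} where
  obj n := GrpCat.of (T.obj n × T'.obj n)
  map f := GrpCat.ofHom (MonoidHom.prodMap (T.map f).hom (T'.map f).hom)
  map_id n := by rw [T.map_id, T'.map_id]; rfl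
  map_comp f g := by rw [T.map_comp, T'.map_comp]; rfl

namespace ExtraDegeneracy

/-- The extra degeneracy of the trivial simplicial group. -/
def trivial : ExtraDegeneracy trivialSimplicialGroup.{u} PUnit.{u + 1} where
  ε := id
  σ := id
  s _ := id
  ε_σ _ := rfl
  ε_δ _ := rfl
  δ_zero_s _ _ := rfl
  δ_one_s _ := rfl
  δ_succ_s _ _ _ := rfl

/-- The extra degeneracy of a product. -/
def prod {T T' : SimplicialObject GrpCat.{u}} {Q Q' : Type u} (D : ExtraDegeneracy T Q)
    (D' : ExtraDegeneracy T' Q') : ExtraDegeneracy (prodSimplicialGroup T T') (Q × Q') where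
  ε := Prod.map D.ε D'.ε
  σ := Prod.map D.σ D'.σ
  s p := Prod.map (D.s p) (D'.s p)
  ε_σ _ := Prod.ext (D.ε_σ _) (D'.ε_σ _)
  ε_δ _ := Prod.ext (D.ε_δ _) (D'.ε_δ _)
  δ_zero_s p _ := Prod.ext (D.δ_zero_s p _) (D'.δ_zero_s p _)
  δ_one_s _ := Prod.ext (D.δ_one_s _) (D'.δ_one_s _)
  δ_succ_s p i _ := Prod.ext (D.δ_succ_s p i _) (D'.δ_succ_s p i _)

end ExtraDegeneracy

/-! ### Homology of the free coefficient systems. -/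

namespace SimplicialAction

variable {G T : SimplicialObject GrpCat.{u}} {Q : Type u}

/-- The projection of the free coefficient system to its coinvariants. -/
def coinv (n : SimplexCategoryᵒᵖ) : (freeObj G T).obj n →+ FreeAbelianGroup (T.obj n) :=
  freeLift fun x => FreeAbelianGroup.of x.2

/-- The inclusion of the second factor of the basis of a free coefficient system. -/
def inclOne (n : SimplexCategoryᵒᵖ) : FreeAbelianGroup (T.obj n) →+ (freeObj G T).obj n :=
  FreeAbelianGroup.lift fun t => freeOf 1 t

theorem coinv_of (n : SimplexCategoryᵒᵖ) (g : G.obj n) (t : T.obj n) :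
    coinv n (freeOf g t) = FreeAbelianGroup.of t := freeLift_of _ _ _

theorem inclOne_of (n : SimplexCategoryᵒᵖ) (t : T.obj n) :
    inclOne (G := G) n (FreeAbelianGroup.of t) = freeOf 1 t := FreeAbelianGroup.lift_apply_of _ _

theorem coinv_map {m n : SimplexCategoryᵒᵖ} (f : m ⟶ n) (x : (freeObj G T).obj m) :
    coinv n ((freeObj G T).map f x) = FreeAbelianGroup.map (T.map f) (coinv m x) := by
  refine DFunLike.congr_fun (f := (coinv n).comp ((freeObj G T).map f).hom)
    (g := (FreeAbelianGroup.map (T.map f)).comp (coinv m)) (free_hom_ext fun g t => ?_) x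
  change coinv n ((freeObj G T).map f _) = FreeAbelianGroup.map (T.map f) (coinv m _)
  rw [freeObj_map, coinv_of, coinv_of, FreeAbelianGroup.map_of_apply]

theorem inclOne_map {m n : SimplexCategoryᵒᵖ} (f : m ⟶ n) (x : FreeAbelianGroup (T.obj m)) :
    (freeObj G T).map f (inclOne m x) = inclOne n (FreeAbelianGroup.map (T.map f) x) := by
  refine DFunLike.congr_fun (f := ((freeObj G T).map f).hom.comp (inclOne m))
    (g := (inclOne n).comp (FreeAbelianGroup.map (T.map f)))
    (FreeAbelianGroup.lift_ext _ _ fun t => ?_) x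
  change (freeObj G T).map f (inclOne m _) = inclOne n (FreeAbelianGroup.map (T.map f) _)
  rw [inclOne_of, freeObj_map, FreeAbelianGroup.map_of_apply, inclOne_of, map_one]

theorem coinv_act (n : SimplexCategoryᵒᵖ) (g : G.obj n) (x : (freeObj G T).obj n) :
    coinv n ((freeAction G T).act n g x) = coinv n x := by
  refine DFunLike.congr_fun (f := (coinv n).comp ((freeAction G T).act n g)) (g := coinv n)
    (free_hom_ext fun h t => ?_) x
  change coinv n ((freeAction G T).act n g _) = _
  rw [freeAction_act, coinv_of, coinv_of]

theorem coinv_vertical (p : ℕ)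
    (x : (Fin 1 → G.obj (Opposite.op ⦋p⦌)) →₀ (freeObj G T).obj (Opposite.op ⦋p⦌)) :
    coinv _ ((chainsZero (G := G) _ p).symm ((freeAction G T).vertical p 0 x)) = 0 := by
  induction x using Finsupp.induction_linear with
  | zero => simp
  | add x y hx hy => rw [map_add, map_add, map_add, hx, hy, add_zero]
  | single g a =>
    have h : (freeAction G T).vertical p 0 (Finsupp.single g a) = _ :=
      (freeAction G T).d_one_zero_single p g a
    rw [h, AddEquiv.symm_apply_apply, map_sub, coinv_act, sub_self]

/-- Together with `coinv_vertical` this identifies the zeroth homology of column `p` with the free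
abelian group on `T_p`; the witness is the contraction in bar degree zero. -/
theorem exists_vertical (p : ℕ) (x : (freeObj G T).obj (Opposite.op ⦋p⦌)) :
    ∃ w, x - inclOne _ (coinv _ x) =
      (chainsZero (G := G) _ p).symm ((freeAction G T).vertical p 0 w) := by
  refine ⟨contraction G T p 0 (chainsZero _ p x), ?_⟩
  refine DFunLike.congr_fun (f := AddMonoidHom.id _ - (inclOne _).comp (coinv _))
    (g := (chainsZero (G := G) (freeObj G T) p).symm.toAddMonoidHom.comp
      (((freeAction G T).vertical p 0).comp ((contraction G T p 0).comp
        (chainsZero (G := G) (freeObj G T) p).toAddMonoidHom))) (free_hom_ext fun h t => ?_) x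
  change freeOf h t - inclOne _ (coinv _ (freeOf h t)) = (chainsZero _ p).symm
    ((freeAction G T).vertical p 0 (contraction G T p 0 (Finsupp.single default (freeOf h t))))
  rw [contraction_single]
  have hd : (freeAction G T).vertical p 0 (Finsupp.single (Fin.cons h⁻¹ default) (freeOf 1 t)) = _ :=
    (freeAction G T).d_one_zero_single p _ _
  rw [hd, AddEquiv.symm_apply_apply, coinv_of, inclOne_of, freeAction_act]
  simp

/-- The alternating sum of the face maps on the free abelian groups on a simplicial set. -/
def faces (T : SimplicialObject GrpCat.{u}) (p : ℕ) :
    FreeAbelianGroup (T.obj (Opposite.op ⦋p + 1⦌)) →+ FreeAbelianGroup (T.obj (Opposite.op ⦋p⦌)) :=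
  ∑ i : Fin (p + 2), (-1 : ℤ) ^ (i : ℕ) • FreeAbelianGroup.map (T.δ i)

theorem faces_apply (p : ℕ) (x : FreeAbelianGroup (T.obj (Opposite.op ⦋p + 1⦌))) :
    faces T p x = ∑ i : Fin (p + 2), (-1 : ℤ) ^ (i : ℕ) • FreeAbelianGroup.map (T.δ i) x := by
  simp [faces, AddMonoidHom.finsetSum_apply]

theorem coinv_faces (p : ℕ) (x : (freeObj G T).obj (Opposite.op ⦋p + 1⦌)) :
    coinv _ (∑ i : Fin (p + 2), (-1 : ℤ) ^ (i : ℕ) • (freeObj G T).δ i x) =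
      faces T p (coinv _ x) := by
  rw [faces_apply, map_sum]
  refine Finset.sum_congr rfl fun i _ => ?_
  rw [map_zsmul]
  exact congrArg _ (coinv_map _ x)

theorem inclOne_faces (p : ℕ) (x : FreeAbelianGroup (T.obj (Opposite.op ⦋p + 1⦌))) :
    ∑ i : Fin (p + 2), (-1 : ℤ) ^ (i : ℕ) • (freeObj G T).δ i (inclOne _ x) =
      inclOne _ (faces T p x) := by
  rw [faces_apply, map_sum]
  refine Finset.sum_congr rfl fun i _ => ?_
  rw [map_zsmul]
  exact congrArg _ (inclOne_map _ x)

variable (D : ExtraDegeneracy T Q)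

/-- The extra degeneracy is a contracting homotopy in positive degrees: its zeroth face is the
identity, and the shift of index in the other faces changes their sign. -/
theorem faces_s (p : ℕ) (x : FreeAbelianGroup (T.obj (Opposite.op ⦋p + 1⦌))) :
    faces T (p + 1) (FreeAbelianGroup.map (D.s (p + 1)) x) +
      FreeAbelianGroup.map (D.s p) (faces T p x) = x := by
  refine DFunLike.congr_fun (f := (faces T (p + 1)).comp (FreeAbelianGroup.map (D.s (p + 1))) +
    (FreeAbelianGroup.map (D.s p)).comp (faces T p)) (g := AddMonoidHom.id _)
    (FreeAbelianGroup.lift_ext _ _ fun t => ?_) x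
  change faces T (p + 1) (FreeAbelianGroup.map (D.s (p + 1)) (FreeAbelianGroup.of t)) +
      FreeAbelianGroup.map (D.s p) (faces T p (FreeAbelianGroup.of t)) = FreeAbelianGroup.of t
  rw [faces_apply, faces_apply, map_sum, Fin.sum_univ_succ]
  simp only [FreeAbelianGroup.map_of_apply, map_zsmul, D.δ_succ_s, D.δ_zero_s, Fin.val_succ,
    pow_succ, mul_neg, mul_one, neg_smul, Finset.sum_neg_distrib, Fin.val_zero, pow_zero, one_smul]
  abel

/-- A free coefficient system on a simplicial set with an extra degeneracy is acyclic. -/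
theorem isZero_homology_free (D : ExtraDegeneracy T Q) (n : ℕ) :
    Limits.IsZero ((freeAction G T).homology (n + 1)) := by
  refine HomologicalComplex₂.isZero_homology_tot_succ _ (fun p q x hx => ?_) (fun p x z hxz => ?_) n
  · refine ⟨contraction G T p (q + 1) x, ?_⟩
    have h := contraction_spec p q x
    have hx' : (freeAction G T).vertical p q x = 0 := hx
    rw [hx', map_zero, add_zero] at h
    exact h
  · obtain ⟨a, rfl⟩ := (chainsZero (G := G) (freeObj G T) (p + 1)).surjective x
    have hxz' : chainsZero (G := G) _ p (∑ i : Fin (p + 2), (-1 : ℤ) ^ (i : ℕ) •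
        (freeObj G T).δ i a) = (freeAction G T).vertical p 0 z :=
      ((freeAction G T).bicomplex_d_horizontal p a).symm.trans hxz
    -- Passing to coinvariants kills the vertical boundary and leaves a cycle in the chain complex
    -- of `T`, which the extra degeneracy bounds. Then `a` differs from a lift of its coinvariants
    -- by a vertical boundary.
    have h0 : faces T p (coinv _ a) = 0 := by
      rw [← coinv_faces (G := G), ← coinv_vertical p z, ← hxz', AddEquiv.symm_apply_apply]
    have h1 := faces_s D p (coinv _ a)
    rw [h0, map_zero, add_zero] at h1
    obtain ⟨w, hw⟩ := exists_vertical (p + 1) a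
    refine ⟨chainsZero (G := G) _ (p + 2) (inclOne _ (FreeAbelianGroup.map (D.s (p + 1))
      (coinv _ a))), w, ?_⟩
    have h2 := (freeAction G T).bicomplex_d_horizontal (p + 1) (inclOne _
      (FreeAbelianGroup.map (D.s (p + 1)) (coinv _ a)))
    rw [inclOne_faces, h1] at h2
    have h3 : chainsZero (G := G) _ (p + 1) a = chainsZero (G := G) _ (p + 1)
        (inclOne _ (coinv _ a)) + (freeAction G T).vertical (p + 1) 0 w := by
      rw [← sub_eq_iff_eq_add', ← map_sub, hw, AddEquiv.apply_symm_apply]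
    exact h3.trans (congrArg₂ (· + ·) h2.symm rfl)

/-- The augmentation of a free coefficient system. -/
def aug (D : ExtraDegeneracy T Q) : (freeObj G T).obj (Opposite.op ⦋0⦌) →+
    FreeAbelianGroup (PUnit.{u + 1} × Q) :=
  (FreeAbelianGroup.map fun t => (⟨⟩, D.ε t)).comp (coinv _)

theorem aug_of (g : G.obj (Opposite.op ⦋0⦌)) (t : T.obj (Opposite.op ⦋0⦌)) :
    aug D (freeOf g t) = FreeAbelianGroup.of (⟨⟩, D.ε t) := by
  change FreeAbelianGroup.map (fun t => (PUnit.unit.{u + 1}, D.ε t)) (coinv _ _) = _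
  rw [coinv_of, FreeAbelianGroup.map_of_apply]

theorem aug_surjective : Function.Surjective (aug (G := G) D) := by
  intro x
  refine ⟨inclOne _ (FreeAbelianGroup.map (fun x : PUnit.{u + 1} × Q => D.σ x.2) x), ?_⟩
  refine DFunLike.congr_fun (f := (aug D).comp ((inclOne _).comp (FreeAbelianGroup.map (fun x : PUnit.{u + 1} × Q => D.σ x.2))))
    (g := AddMonoidHom.id _) (FreeAbelianGroup.lift_ext _ _ fun t => ?_) x
  change aug D (inclOne _ (FreeAbelianGroup.map (fun x : PUnit.{u + 1} × Q => D.σ x.2) _)) = FreeAbelianGroup.of t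
  rw [FreeAbelianGroup.map_of_apply, inclOne_of, aug_of, D.ε_σ]

/-- An element of a free coefficient system is a boundary if and only if its augmentation
vanishes. -/
theorem mem_zeroBoundary_free_iff (x : (freeObj G T).obj (Opposite.op ⦋0⦌)) :
    x ∈ (freeAction G T).zeroBoundary ↔ aug D x = 0 := by
  constructor
  · intro hx
    have : (freeAction G T).zeroBoundary ≤ (aug D).ker := by
      refine (AddSubgroup.closure_le _).2 ?_
      rintro _ (⟨g, a, rfl⟩ | ⟨b, rfl⟩)
      · change aug D _ = 0
        rw [map_sub, sub_eq_zero]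
        exact congrArg (FreeAbelianGroup.map fun t => (PUnit.unit.{u + 1}, D.ε t)) (coinv_act _ _ _)
      · change aug D _ = 0
        rw [map_sub, sub_eq_zero]
        refine (congrArg (FreeAbelianGroup.map fun t => (PUnit.unit.{u + 1}, D.ε t)) (coinv_map _ _)).trans
          (Eq.trans ?_ (congrArg (FreeAbelianGroup.map fun t => (PUnit.unit.{u + 1}, D.ε t)) (coinv_map _ _)).symm)
        rw [← FreeAbelianGroup.map_comp_apply, ← FreeAbelianGroup.map_comp_apply]
        exact congrArg (fun t => FreeAbelianGroup.map t (coinv _ b)) 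
            (funext fun y => Prod.ext rfl (D.ε_δ y))
    exact this hx
  · intro hx
    have key (x : (freeObj G T).obj (Opposite.op ⦋0⦌)) :
        x - inclOne _ (FreeAbelianGroup.map (fun x : PUnit.{u + 1} × Q => D.σ x.2) (aug D x)) ∈ (freeAction G T).zeroBoundary := by
      refine (QuotientAddGroup.eq_zero_iff _).1 ?_
      refine DFunLike.congr_fun (f := (QuotientAddGroup.mk' (freeAction G T).zeroBoundary).comp (AddMonoidHom.id _ -
        (inclOne _).comp ((FreeAbelianGroup.map (fun x : PUnit.{u + 1} × Q => D.σ x.2)).comp (aug D)))) (g := 0)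
        (free_hom_ext fun g t => ?_) x
      refine (QuotientAddGroup.eq_zero_iff _).2 ?_
      change freeOf g t - inclOne _ (FreeAbelianGroup.map (fun x : PUnit.{u + 1} × Q => D.σ x.2) (aug D (freeOf g t))) ∈ _
      -- Two moves: the action identifies `(g, t)` with `(1, t)`, and the edge `(1, s t)` joins `(1,
      -- t)` to `(1, σ (ε t))`.
      rw [aug_of, FreeAbelianGroup.map_of_apply, inclOne_of, ← sub_add_sub_cancel _ (freeOf 1 t)]
      refine add_mem (AddSubgroup.subset_closure (Or.inl ⟨g, freeOf 1 t, ?_⟩))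
        (AddSubgroup.subset_closure (Or.inr ⟨freeOf 1 (D.s 0 t), ?_⟩))
      · rw [freeAction_act, mul_one]
      · refine congrArg₂ _ ?_ ?_
        · refine Eq.trans ?_ (freeObj_map _ _ _).symm
          rw [map_one]
          exact congrArg _ (D.δ_zero_s 0 t).symm
        · refine Eq.trans ?_ (freeObj_map _ _ _).symm
          rw [map_one]
          exact congrArg _ (D.δ_one_s t).symm
    have h := key x
    rwa [hx, map_zero, map_zero, sub_zero] at h

end SimplicialAction

namespace SimplicialAction

variable {G : SimplicialObject GrpCat.{u}} {A B C : SimplicialObject AddCommGrpCat.{u}}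

/-! ### Submodules and quotients -/

/-- A family of subgroups stable under the simplicial operators and the action. -/
structure Sub (α : SimplicialAction G A) where
  /-- the subgroups -/
  carrier : ∀ n, AddSubgroup (A.obj n)
  map_mem : ∀ {m n} (f : m ⟶ n) {a : A.obj m}, a ∈ carrier m → A.map f a ∈ carrier n
  act_mem : ∀ n (g : G.obj n) {a : A.obj n}, a ∈ carrier n → α.act n g a ∈ carrier n

variable {α : SimplicialAction G A} {β : SimplicialAction G B} {γ : SimplicialAction G C}

namespace Sub

/-- The abelian simplicial group given by a stable family of subgroups. -/
def obj (S : Sub α) : SimplicialObject AddCommGrpCat.{u} where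
  obj n := AddCommGrpCat.of (S.carrier n)
  map {m n} f := AddCommGrpCat.ofHom (((A.map f).hom.comp (S.carrier m).subtype).codRestrict
    (S.carrier n) fun x => S.map_mem f x.2)
  map_id n := by
    refine AddCommGrpCat.hom_ext (AddMonoidHom.ext fun x => Subtype.ext ?_)
    exact congrArg (fun t => t.hom x.1) (A.map_id n)
  map_comp f g := by
    refine AddCommGrpCat.hom_ext (AddMonoidHom.ext fun x => Subtype.ext ?_)
    exact congrArg (fun t => t.hom x.1) (A.map_comp f g)

/-- The restricted action. -/
def action (S : Sub α) : SimplicialAction G S.obj where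
  act n :=
    { toFun := fun g => ((α.act n g).comp (S.carrier n).subtype).codRestrict
        (S.carrier n) fun x => S.act_mem n g x.2
      map_one' := AddMonoidHom.ext fun x => Subtype.ext
        (congrArg (fun t : AddMonoid.End _ => t x.1) (map_one (α.act n)))
      map_mul' := fun g h => AddMonoidHom.ext fun x => Subtype.ext
        (congrArg (fun t : AddMonoid.End _ => t x.1) (map_mul (α.act n) g h)) }
  map_act f g a := Subtype.ext (α.map_act f g a.1)

/-- The inclusion. -/
def incl (S : Sub α) : Hom S.action α where
  app n := (S.carrier n).subtype
  map_app _ _ := rfl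
  act_app _ _ _ := rfl

theorem incl_injective (S : Sub α) (n) : Function.Injective (S.incl.app n) :=
  Subtype.val_injective

/-- The corestriction of a homomorphism. -/
def lift (S : Sub β) (φ : Hom α β) (h : ∀ n a, φ.app n a ∈ S.carrier n) : Hom α S.action where
  app n := (φ.app n).codRestrict (S.carrier n) (h n)
  map_app f a := Subtype.ext (φ.map_app f a)
  act_app n g a := Subtype.ext (φ.act_app n g a)

/-- The quotient abelian simplicial group. -/
def quotObj (S : Sub α) : SimplicialObject AddCommGrpCat.{u} where
  obj n := AddCommGrpCat.of (A.obj n ⧸ S.carrier n)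
  map {m n} f := AddCommGrpCat.ofHom (QuotientAddGroup.map (S.carrier m) (S.carrier n)
    (A.map f).hom fun _ h => S.map_mem f h)
  map_id n := by
    refine AddCommGrpCat.hom_ext (QuotientAddGroup.addMonoidHom_ext _ (AddMonoidHom.ext fun x => ?_))
    exact congrArg (fun t => QuotientAddGroup.mk (t.hom x)) (A.map_id n)
  map_comp f g := by
    refine AddCommGrpCat.hom_ext (QuotientAddGroup.addMonoidHom_ext _ (AddMonoidHom.ext fun x => ?_))
    exact congrArg (fun t => QuotientAddGroup.mk (t.hom x)) (A.map_comp f g)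

/-- The action on the quotient. -/
def quotAction (S : Sub α) : SimplicialAction G S.quotObj where
  act n :=
    { toFun := fun g => QuotientAddGroup.map (S.carrier n) (S.carrier n) (α.act n g)
        fun _ h => S.act_mem n g h
      map_one' := QuotientAddGroup.addMonoidHom_ext _ (AddMonoidHom.ext fun x =>
        congrArg (fun t : AddMonoid.End _ => QuotientAddGroup.mk (t x)) (map_one (α.act n)))
      map_mul' := fun g h => QuotientAddGroup.addMonoidHom_ext _ (AddMonoidHom.ext fun x =>
        congrArg (fun t : AddMonoid.End _ => QuotientAddGroup.mk (t x)) (map_mul (α.act n) g h)) }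
  map_act f g a := by
    obtain ⟨a, rfl⟩ := QuotientAddGroup.mk_surjective a
    exact congrArg QuotientAddGroup.mk (α.map_act f g a)

/-- The projection to the quotient. -/
def proj (S : Sub α) : Hom α S.quotAction where
  app n := QuotientAddGroup.mk' (S.carrier n)
  map_app _ _ := rfl
  act_app _ _ _ := rfl

theorem proj_surjective (S : Sub α) (n) : Function.Surjective (S.proj.app n) :=
  QuotientAddGroup.mk_surjective

theorem proj_eq_zero_iff (S : Sub α) (n) (a : A.obj n) :
    S.proj.app n a = 0 ↔ a ∈ S.carrier n :=
  QuotientAddGroup.eq_zero_iff a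

theorem incl_proj_exact (S : Sub α) (n) : Function.Exact (S.incl.app n) (S.proj.app n) :=
  fun a => (S.proj_eq_zero_iff n a).trans ⟨fun h => ⟨⟨a, h⟩, rfl⟩, fun ⟨x, hx⟩ => hx ▸ x.2⟩

/-- The homomorphism induced on the quotient. -/
def quotLift (S : Sub α) (φ : Hom α β) (h : ∀ n a, a ∈ S.carrier n → φ.app n a = 0) :
    Hom S.quotAction β where
  app n := QuotientAddGroup.lift (S.carrier n) (φ.app n) (h n)
  map_app f a := by
    obtain ⟨a, rfl⟩ := QuotientAddGroup.mk_surjective a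
    exact φ.map_app f a
  act_app n g a := by
    obtain ⟨a, rfl⟩ := QuotientAddGroup.mk_surjective a
    exact φ.act_app n g a

end Sub

/-- The kernel of a homomorphism. -/
def Hom.ker (φ : Hom α β) : Sub α where
  carrier n := (φ.app n).ker
  map_mem f a h := by
    rw [AddMonoidHom.mem_ker] at h ⊢
    rw [φ.map_app, h, map_zero]
  act_mem n g a h := by
    rw [AddMonoidHom.mem_ker] at h ⊢
    rw [φ.act_app, h, map_zero]

/-- The range of a homomorphism. -/
def Hom.range (φ : Hom α β) : Sub β where
  carrier n := (φ.app n).range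
  map_mem := by
    rintro m n f _ ⟨a, rfl⟩
    exact ⟨A.map f a, φ.map_app f a⟩
  act_mem := by
    rintro n g _ ⟨a, rfl⟩
    exact ⟨α.act n g a, φ.act_app n g a⟩

/-- The corestriction of a homomorphism to its range. -/
def Hom.toRange (φ : Hom α β) : Hom α φ.range.action :=
  φ.range.lift φ fun _ a => ⟨a, rfl⟩

theorem Hom.toRange_surjective (φ : Hom α β) (n) : Function.Surjective (φ.toRange.app n) := by
  rintro ⟨_, a, rfl⟩
  exact ⟨a, rfl⟩

theorem Hom.ker_toRange_exact (φ : Hom α β) (n) :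
    Function.Exact (φ.ker.incl.app n) (φ.toRange.app n) := by
  intro a
  constructor
  · intro h
    exact ⟨⟨a, congrArg Subtype.val h⟩, rfl⟩
  · rintro ⟨x, rfl⟩
    exact Subtype.ext x.2

/-! ### Zeroth homology and free coefficient systems -/

variable {T₁ T₂ T₃ : SimplicialObject GrpCat.{u}} {Q₁ Q₂ Q₃ : Type u}

/-- A criterion for a map to a free coefficient system to be injective on zeroth homology. -/
theorem mem_zeroBoundary_of_exact (D₁ : ExtraDegeneracy T₁ Q₁) (D₂ : ExtraDegeneracy T₂ Q₂)
    (D₃ : ExtraDegeneracy T₃ Q₃) (φ : Hom (freeAction G T₃) (freeAction G T₂))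
    (χ : Hom (freeAction G T₂) β) (ι : Hom β (freeAction G T₁))
    (d₃ : FreeAbelianGroup (PUnit.{u + 1} × Q₃) →+ FreeAbelianGroup (PUnit.{u + 1} × Q₂))
    (d₂ : FreeAbelianGroup (PUnit.{u + 1} × Q₂) →+ FreeAbelianGroup (PUnit.{u + 1} × Q₁))
    (h₃ : ∀ x, aug D₂ (φ.app _ x) = d₃ (aug D₃ x))
    (h₂ : ∀ x, aug D₁ (ι.app _ (χ.app _ x)) = d₂ (aug D₂ x))
    (hz : ∀ x, χ.app (Opposite.op ⦋0⦌) (φ.app _ x) = 0)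
    (hd : ∀ y, d₂ y = 0 → ∃ w, d₃ w = y)
    (hs : Function.Surjective (χ.app (Opposite.op ⦋0⦌)))
    (b : B.obj (Opposite.op ⦋0⦌)) (hb : ι.app _ b ∈ (freeAction G T₁).zeroBoundary) :
    b ∈ β.zeroBoundary := by
  obtain ⟨y, rfl⟩ := hs b
  rw [mem_zeroBoundary_free_iff D₁, h₂] at hb
  obtain ⟨w, hw⟩ := hd _ hb
  obtain ⟨v, rfl⟩ := aug_surjective (G := G) D₃ w
  -- The lift `y` agrees with `φ v` on zeroth homology, and `χ` kills `φ v`; so `χ y` is the image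
  -- of a boundary.
  have h : y - φ.app _ v ∈ (freeAction G T₂).zeroBoundary := by
    rw [mem_zeroBoundary_free_iff D₂, map_sub, h₃, hw, sub_self]
  have h' := χ.zeroBoundary_le h
  rwa [map_sub, hz, sub_zero] at h'

/-! ### The bar complex as a complex of coefficient systems -/

section Bar

variable {E : SimplicialObject GrpCat.{u}} (π : E ⟶ G)

theorem hom_comm {m n : SimplexCategoryᵒᵖ} (f : m ⟶ n) (g : G.obj m) (a : E.obj m) :
    G.map f (g * π.app m a) = G.map f g * π.app n (E.map f a) := by
  rw [map_mul]
  exact congrArg _ (congrArg (fun t => t.hom a) (π.naturality f)).symm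

/-- The differential of the bar complex in degree one. -/
def bar₁ : Hom (freeAction G E) (freeAction G trivialSimplicialGroup) where
  app n := BarComplex.d₁ (π.app n).hom
  map_app f a := (BarComplex.map_d₁ _ _ _ _ (hom_comm π f) a)
  act_app n g a := (BarComplex.map_d₁ (π.app n).hom (π.app n).hom id (g * ·)
    (fun _ _ => (mul_assoc _ _ _).symm) a)

/-- The differential of the bar complex in degree two. -/
def bar₂ : Hom (freeAction G (prodSimplicialGroup E E)) (freeAction G E) where
  app n := BarComplex.d₂ (π.app n).hom
  map_app f a := (BarComplex.map_d₂ _ _ _ (map_mul (E.map f).hom) _ (hom_comm π f) a)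
  act_app n g a := (BarComplex.map_d₂ (π.app n).hom (π.app n).hom id (fun _ _ => rfl) (g * ·)
    (fun _ _ => (mul_assoc _ _ _).symm) a)

/-- The differential of the bar complex in degree three. -/
def bar₃ : Hom (freeAction G (prodSimplicialGroup E (prodSimplicialGroup E E)))
    (freeAction G (prodSimplicialGroup E E)) where
  app n := BarComplex.d₃ (π.app n).hom
  map_app f a := (BarComplex.map_d₃ _ _ _ (map_mul (E.map f).hom) _ (hom_comm π f) a)
  act_app n g a := (BarComplex.map_d₃ (π.app n).hom (π.app n).hom id (fun _ _ => rfl) (g * ·)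
    (fun _ _ => (mul_assoc _ _ _).symm) a)

/-- The differential of the bar complex in degree four. -/
def bar₄ : Hom (freeAction G (prodSimplicialGroup E (prodSimplicialGroup E
      (prodSimplicialGroup E E))))
    (freeAction G (prodSimplicialGroup E (prodSimplicialGroup E E))) where
  app n := BarComplex.d₄ (π.app n).hom
  map_app f a := (BarComplex.map_d₄ _ _ _ (map_mul (E.map f).hom) _ (hom_comm π f) a)
  act_app n g a := (BarComplex.map_d₄ (π.app n).hom (π.app n).hom id (fun _ _ => rfl) (g * ·)
    (fun _ _ => (mul_assoc _ _ _).symm) a)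

/-- The cokernel of the second differential of the bar complex, i.e. the simplicial module
`ℤ[G] ⊗_E I(E)`, where `I(E)` is the augmentation ideal. -/
abbrev relationModule : SimplicialAction G (bar₂ π).range.quotObj := (bar₂ π).range.quotAction

variable {Q : Type u} [Group Q] (D : ExtraDegeneracy E Q)
  (hD : ∀ a b, D.ε (a * b) = D.ε a * D.ε b)

/-- The trivial homomorphism to the trivial group. -/
abbrev toTrivial (Q : Type u) [Group Q] : Q →* PUnit.{u + 1} := 1

/-- The redundant factor `PUnit` makes the target a term of the bar complex of `Q → 1`, so that the
naturality lemmas of the bar differentials apply to `aug`. -/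
theorem aug_eq {T : SimplicialObject GrpCat.{u}} {Q : Type u} (D : ExtraDegeneracy T Q)
    (x : (freeObj G T).obj (Opposite.op ⦋0⦌)) :
    aug D x = FreeAbelianGroup.map (Prod.map (fun _ => ⟨⟩) D.ε) x := by
  refine DFunLike.congr_fun (f := aug D) (g := FreeAbelianGroup.map (Prod.map (fun _ => ⟨⟩) D.ε))
    (free_hom_ext fun g t => ?_) x
  rw [aug_of]
  exact (FreeAbelianGroup.map_of_apply _).symm

-- This and the next two lemmas show that on zeroth homology the complex `ℤ[G] ⊗_E B(E)` becomes the
-- integral bar complex of `Q`.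
include hD in
theorem aug_bar₂ (x) : aug D ((bar₂ π).app (Opposite.op ⦋0⦌) x) =
    BarComplex.d₂ (toTrivial Q) (aug (D.prod D) x) := by
  rw [aug_eq, aug_eq]
  exact (BarComplex.map_d₂ _ _ _ hD _ (fun _ _ => rfl) x).symm

include hD in
theorem aug_bar₃ (x) : aug (D.prod D) ((bar₃ π).app (Opposite.op ⦋0⦌) x) =
    BarComplex.d₃ (toTrivial Q) (aug (D.prod (D.prod D)) x) := by
  rw [aug_eq, aug_eq]
  exact (BarComplex.map_d₃ _ _ _ hD _ (fun _ _ => rfl) x).symm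

include hD in
theorem aug_bar₄ (x) : aug (D.prod (D.prod D)) ((bar₄ π).app (Opposite.op ⦋0⦌) x) =
    BarComplex.d₄ (toTrivial Q) (aug (D.prod (D.prod (D.prod D))) x) := by
  rw [aug_eq, aug_eq]
  exact (BarComplex.map_d₄ _ _ _ hD _ (fun _ _ => rfl) x).symm

-- Since `ℤ[G × E]` has no first homology, it is enough that the image of `bar₂` injects into it on
-- zeroth homology. A class of that image lifts to `ℤ[Q²]`; if it vanishes in `ℤ[Q]`, then it is a
-- value of `d₃` because `Q` is free, and `d₂ ∘ d₃ = 0`.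
include hD in
theorem isZero_homology_one_relationModule (ΛQ : BarComplex.FoxDerivation Q) :
    Limits.IsZero ((relationModule π).homology 1) := by
  refine Hom.isZero_homology_one (bar₂ π).range.incl (bar₂ π).range.proj
    (bar₂ π).range.incl_proj_exact (bar₂ π).range.proj_surjective
    (isZero_homology_free D 0) ?_
  refine mem_zeroBoundary_of_exact D (D.prod D) (D.prod (D.prod D)) (bar₃ π) (bar₂ π).toRange
    (bar₂ π).range.incl _ _ (aug_bar₃ π D hD) (aug_bar₂ π D hD) ?_
    (fun _ => BarComplex.exact_two _ ΛQ) ((bar₂ π).toRange_surjective _)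
  exact fun x => Subtype.ext (BarComplex.d₂_d₃ _ x)

-- Shifting once reduces the claim to the first homology of the image of `bar₂`. The argument in
-- degree one is then repeated one step further left in the bar complex, for the kernel of `bar₂`
-- inside `ℤ[G × E²]`.
include hD in
theorem isZero_homology_two_relationModule (ΛQ : BarComplex.FoxDerivation Q)
    (ΛE : BarComplex.FoxDerivation (E.obj (Opposite.op ⦋0⦌))) :
    Limits.IsZero ((relationModule π).homology 2) := by
  refine Hom.isZero_homology_succ (bar₂ π).range.incl (bar₂ π).range.proj
    (bar₂ π).range.incl_injective
    (bar₂ π).range.incl_proj_exact (bar₂ π).range.proj_surjective 1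
    (isZero_homology_free D 1) ?_
  refine Hom.isZero_homology_one (bar₂ π).ker.incl (bar₂ π).toRange
    (bar₂ π).ker_toRange_exact (bar₂ π).toRange_surjective (isZero_homology_free (D.prod D) 0) ?_
  refine mem_zeroBoundary_of_exact (D.prod D) (D.prod (D.prod D)) (D.prod (D.prod (D.prod D)))
    (bar₄ π) ((bar₂ π).ker.lift (bar₃ π) fun _ x => BarComplex.d₂_d₃ _ x)
    (bar₂ π).ker.incl _ _ (aug_bar₄ π D hD) (aug_bar₃ π D hD) ?_
    (fun _ => BarComplex.exact_three _ ΛQ) ?_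
  · exact fun x => Subtype.ext (BarComplex.d₃_d₄ _ x)
  -- Here `bar₃` must reach all of the kernel of `bar₂`, in dimension zero only; this is where the
  -- freeness of `E₀` enters.
  · rintro ⟨x, hx⟩
    obtain ⟨y, hy⟩ := BarComplex.exact_two (π.app (Opposite.op ⦋0⦌)).hom ΛE hx
    exact ⟨y, Subtype.ext hy⟩

/-- The homomorphism from the relation module to the augmentation ideal. -/
def relationModuleToRange : Hom (relationModule π) (bar₁ π).range.action :=
  (bar₂ π).range.quotLift (bar₁ π).toRange (by
    rintro n _ ⟨a, rfl⟩
    exact Subtype.ext (BarComplex.d₁_d₂ _ a))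

theorem relationModuleToRange_surjective (n) :
    Function.Surjective ((relationModuleToRange π).app n) := by
  intro x
  obtain ⟨a, rfl⟩ := (bar₁ π).toRange_surjective n x
  exact ⟨(bar₂ π).range.proj.app n a, rfl⟩

include hD in
/-- Dimension shifting along the relation sequence. -/
theorem nonempty_homology_iso_of_relation (ΛQ : BarComplex.FoxDerivation Q)
    (ΛE : BarComplex.FoxDerivation (E.obj (Opposite.op ⦋0⦌)))
    (ψ : Hom α (relationModule π)) (hψ : ∀ n, Function.Injective (ψ.app n))
    (hex : ∀ n, Function.Exact (ψ.app n) ((relationModuleToRange π).app n))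
    (θ : Hom (freeAction G trivialSimplicialGroup) γ)
    (hθ : ∀ n, Function.Surjective (θ.app n))
    (hex' : ∀ n, Function.Exact ((bar₁ π).app n) (θ.app n)) :
    Nonempty (γ.homology 3 ≅ α.homology 1) := by
  -- By `hex'` the image of `bar₁` is the kernel of `θ`; in the application it is the augmentation
  -- ideal `I(G)`. This shift goes from degree 3 to degree 2.
  obtain ⟨e⟩ := Hom.nonempty_homology_iso (bar₁ π).range.incl θ (bar₁ π).range.incl_injective
    (fun n x => (hex' n x).trans
      ⟨fun ⟨a, ha⟩ => ⟨⟨x, a, ha⟩, rfl⟩, by rintro ⟨⟨_, a, rfl⟩, rfl⟩; exact ⟨a, rfl⟩⟩)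
    hθ 2 (isZero_homology_free ExtraDegeneracy.trivial 2)
    (isZero_homology_free ExtraDegeneracy.trivial 1)
  obtain ⟨e'⟩ := Hom.nonempty_homology_iso ψ (relationModuleToRange π) hψ hex
    (relationModuleToRange_surjective π) 1 (isZero_homology_two_relationModule π D hD ΛQ ΛE)
    (isZero_homology_one_relationModule π D hD ΛQ)
  exact ⟨e ≪≫ e'⟩

end Bar

end SimplicialAction

/-! ### The relation module of a surjective homomorphism -/

namespace BarComplex

open FreeAbelianGroup (of lift lift_ext lift_apply_of)

section Rel

variable {K E G A : Type*} [Group K] [Group E] [Group G] [AddCommGroup A] (π : E →* G)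

/-- The module `ℤ[G] ⊗_E I(E)` as the cokernel of the second bar differential. -/
abbrev Rel : Type _ := FreeAbelianGroup (G × E) ⧸ (d₂ π).range

/-- The generators of the relation module. -/
abbrev relOf (g : G) (e : E) : Rel π := QuotientAddGroup.mk (of (g, e))

/-- With `relOf π g e` read as `g ⊗ (e - 1)`, this is `ab - 1 = a(b - 1) + (a - 1)`. -/
theorem relOf_mul (g : G) (a b : E) : relOf π g (a * b) = relOf π (g * π a) b + relOf π g a := by
  have h : QuotientAddGroup.mk (s := (d₂ π).range) (d₂ π (of (g, a, b))) = 0 :=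
    (QuotientAddGroup.eq_zero_iff _).2 ⟨_, rfl⟩
  rw [d₂_of] at h
  have h' : relOf π (g * π a) b - relOf π g (a * b) + relOf π g a = 0 := h
  rw [sub_add_eq_add_sub, sub_eq_zero] at h'
  exact h'.symm

variable (ι : K →* E) (hι : ∀ k, π (ι k) = 1)

/-- The homomorphism from the kernel to the relation module. -/
def kerToRel : K →* Multiplicative (Rel π) :=
  MonoidHom.mk' (fun k => Multiplicative.ofAdd (relOf π 1 (ι k))) fun k k' => by
    rw [map_mul, relOf_mul, hι, one_mul, add_comm]
    rfl

variable (a : K →* Multiplicative A) (ha : Function.Surjective a) (ha' : a.ker ≤ commutator K)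

/-- The homomorphism from the abelianised kernel to the relation module. -/
noncomputable def abToRel : A →+ Rel π :=
  AddMonoidHom.toMultiplicative.symm (a.liftOfSurjective ha ⟨kerToRel π ι hι,
    ha'.trans (Abelianization.commutator_subset_ker _)⟩)

theorem abToRel_apply (k : K) :
    abToRel π ι hι a ha ha' (a k).toAdd = relOf π 1 (ι k) :=
  congrArg Multiplicative.toAdd (MonoidHom.liftOfRightInverse_comp_apply a _
    (Function.rightInverse_surjInv ha)
    ⟨kerToRel π ι hι, ha'.trans (Abelianization.commutator_subset_ker _)⟩ k)

/-- Expand `k' e = e k` in two ways. This makes the embedding of the abelianised kernel equivariant: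
conjugation by `e` corresponds to multiplication by `π e`. -/
theorem relOf_conj (e : E) (k k' : K) (hk : π (ι k') = 1) (h : ι k' = e * ι k * e⁻¹) :
    relOf π (π e) (ι k) = relOf π 1 (ι k') := by
  have h1 := relOf_mul π 1 (ι k') e
  have h2 := relOf_mul π 1 e (ι k)
  rw [hk, one_mul, h, inv_mul_cancel_right, h2, one_mul, add_comm] at h1
  rw [h]
  exact add_left_cancel h1

variable (hπ : Function.Surjective π) (hex : π.ker ≤ ι.range)

include hπ in
theorem exists_section : ∃ t : G → E, t 1 = 1 ∧ ∀ g, π (t g) = g := by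
  classical
  refine ⟨Function.update (Function.surjInv hπ) 1 1, Function.update_self .., fun g => ?_⟩
  by_cases h : g = 1
  · subst h; simp
  · rw [Function.update_of_ne h, Function.surjInv_eq hπ]

-- The Schreier cocycle of a transversal. It satisfies `c g (e f) = c g e * c (g π(e)) f`, so its
-- class in an abelian quotient of `K` defines a homomorphism on the relation module.
include hex in
theorem exists_cocycle (t : G → E) (ht : ∀ g, π (t g) = g) :
    ∃ c : G → E → K, ∀ g e, ι (c g e) = t g * e * (t (g * π e))⁻¹ := by
  have h (g : G) (e : E) : ∃ k, ι k = t g * e * (t (g * π e))⁻¹ := by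
    refine MonoidHom.mem_range.1 (hex ?_)
    simp [MonoidHom.mem_ker, ht]
  choose c hc using h
  exact ⟨c, hc⟩

-- The Schreier cocycle induces a left inverse.
include hπ hex in
theorem abToRel_injective (hinj : Function.Injective ι) :
    Function.Injective (abToRel π ι hι a ha ha') := by
  obtain ⟨t, ht1, ht⟩ := exists_section π hπ
  obtain ⟨c, hc⟩ := exists_cocycle π ι hex t ht
  let φ : FreeAbelianGroup (G × E) →+ A := lift fun x => (a (c x.1 x.2)).toAdd
  have hφ (x) : φ (d₂ π x) = 0 := by
    refine DFunLike.congr_fun (f := φ.comp (d₂ π)) (g := 0) (lift_ext _ _ ?_) x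
    rintro ⟨g, e, f⟩
    have h : c g (e * f) = c g e * c (g * π e) f := by
      apply hinj
      rw [map_mul, hc, hc, hc, map_mul]
      group
    simp [φ, h]
  let Φ : Rel π →+ A := QuotientAddGroup.lift _ φ (by rintro _ ⟨x, rfl⟩; exact hφ x)
  refine Function.LeftInverse.injective (g := Φ) fun x => ?_
  obtain ⟨k, hk⟩ := ha (Multiplicative.ofAdd x)
  have hk' : (a k).toAdd = x := congrArg Multiplicative.toAdd hk
  rw [← hk', abToRel_apply]
  change φ (of (1, ι k)) = _
  -- The normalisation `t 1 = 1` is used here.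
  have h : c 1 (ι k) = k := hinj (by rw [hc, hι, mul_one, ht1]; simp)
  simp [φ, h]

-- From `c(g, e) t(g π(e)) = t(g) e` one gets `g ⊗ (e - 1) = 1 ⊗ (c(g, e) - 1) + τ(d₁(g, e))`, and
-- the last term disappears on the kernel of `d₁`.
include hπ hex in
theorem exists_abToRel {x : FreeAbelianGroup (G × E)} (hx : d₁.{u} π x = 0) :
    ∃ y, abToRel π ι hι a ha ha' y = QuotientAddGroup.mk x := by
  obtain ⟨t, ht1, ht⟩ := exists_section π hπ
  obtain ⟨c, hc⟩ := exists_cocycle π ι hex t ht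
  let φ : FreeAbelianGroup (G × E) →+ A := lift fun x => (a (c x.1 x.2)).toAdd
  let τ : FreeAbelianGroup (G × PUnit.{u + 1}) →+ Rel π := lift fun x => relOf π 1 (t x.1)
  have h : QuotientAddGroup.mk' (d₂ π).range =
      (abToRel π ι hι a ha ha').comp φ + τ.comp (d₁ π) := by
    refine lift_ext _ _ ?_
    rintro ⟨g, e⟩
    have h1 := relOf_mul π 1 (t g) e
    have h2 := relOf_mul π 1 (ι (c g e)) (t (g * π e))
    have h3 : ι (c g e) * t (g * π e) = t g * e := by rw [hc]; group
    rw [h3, h1, hι, ht, one_mul, one_mul] at h2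
    simp only [AddMonoidHom.add_apply, AddMonoidHom.comp_apply, φ, τ, lift_apply_of, d₁_of,
      map_sub, abToRel_apply]
    change relOf π g e = _
    rw [eq_sub_of_add_eq h2]
    abel
  refine ⟨φ x, ?_⟩
  have h' := DFunLike.congr_fun h x
  simp only [AddMonoidHom.add_apply, AddMonoidHom.comp_apply, hx, map_zero, add_zero] at h'
  exact h'.symm

end Rel

end BarComplex

/-! ### Diagrams -/

namespace CrossedModule

namespace Diagram

section

variable {H G H' G' : Type u} [Group H] [Group G] [Group H'] [Group G']
  {X : CrossedModule H G} {X' : CrossedModule H' G'} {ι : Type} [Preorder ι]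

/-- The homomorphism of groups of diagrams induced by a morphism of crossed modules. -/
def map (f : Hom X X') : X.Diagram ι →* X'.Diagram ι where
  toFun x :=
    { obj := fun j => f.bot (x.obj j)
      arr := fun j k h => f.top (x.arr j k h)
      target := fun j k h => by rw [← x.target j k h, map_mul, f.comm]
      comp := fun j k l h h' => by rw [← x.comp j k l h h', map_mul] }
  map_one' := by ext <;> simp
  map_mul' x y := by ext <;> simp [f.equivariant]

@[simp] theorem map_obj (f : Hom X X') (x : X.Diagram ι) (j : ι) :
    (map f x).obj j = f.bot (x.obj j) := rfl

@[simp] theorem map_arr (f : Hom X X') (x : X.Diagram ι) (j k : ι) (h : j ≤ k) :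
    (map f x).arr j k h = f.top (x.arr j k h) := rfl

variable (X ι) in
/-- Constant diagrams. -/
def const : G →* X.Diagram ι where
  toFun g :=
    { obj := fun _ => g
      arr := fun _ _ _ => 1
      target := fun _ _ _ => by simp
      comp := fun _ _ _ _ _ => by simp }
  map_one' := rfl
  map_mul' x y := by
    ext
    · rfl
    · simp

@[simp] theorem const_obj (g : G) (j : ι) : (const X ι g).obj j = g := rfl

@[simp] theorem const_arr (g : G) (j k : ι) (h : j ≤ k) : (const X ι g).arr j k h = 1 := rfl

variable (X ι) in
/-- The diagram with objects `μ (u j)` and arrows given by the quotients of the `u j`. -/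
def coboundary : (ι → H) →* X.Diagram ι where
  toFun u :=
    { obj := fun j => X.μ (u j)
      arr := fun j k _ => u j * (u k)⁻¹
      target := fun _ _ _ => by rw [← map_mul, inv_mul_cancel_right]
      comp := fun _ _ _ _ _ => by group }
  map_one' := by ext <;> simp
  map_mul' x y := by
    ext
    · simp
    · simp [X.peiffer, mul_assoc]

@[simp] theorem coboundary_obj (u : ι → H) (j : ι) : (coboundary X ι u).obj j = X.μ (u j) := rfl

@[simp] theorem coboundary_arr (u : ι → H) (j k : ι) (h : j ≤ k) :
    (coboundary X ι u).arr j k h = u j * (u k)⁻¹ := rfl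

theorem const_conj_coboundary (g : G) (u : ι → H) :
    const X ι g * coboundary X ι u * (const X ι g)⁻¹ = coboundary X ι fun j => X.act g (u j) := by
  ext
  · simp [X.μ_act]
  · simp

/-- A simplex is determined by its object at the top index and the arrows from that object to the
others. Statements about diagrams thereby reduce to the two homomorphisms `coboundary` and `const`.
-/
theorem eq_coboundary_mul_const [OrderTop ι] (x : X.Diagram ι) :
    x = coboundary X ι (fun j => x.arr j ⊤ le_top) * const X ι (x.obj ⊤) := by
  ext j k h
  · exact (x.target j ⊤ le_top).symm
  · simp [← x.comp j k ⊤ h le_top]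

theorem map_surjective [OrderTop ι] (f : Hom X X') (h₁ : Function.Surjective f.top)
    (h₂ : Function.Surjective f.bot) : Function.Surjective (map (ι := ι) f) := by
  intro x
  refine ⟨coboundary X ι (fun j => Function.surjInv h₁ (x.arr j ⊤ le_top)) *
    const X ι (Function.surjInv h₂ (x.obj ⊤)), ?_⟩
  conv_rhs => rw [eq_coboundary_mul_const x]
  ext j k h
  · simp [f.comm, Function.surjInv_eq]
  · simp [Function.surjInv_eq]

theorem map_injective (f : Hom X X') (h₁ : Function.Injective f.top)
    (h₂ : Function.Injective f.bot) : Function.Injective (map (ι := ι) f) := by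
  intro x y h
  ext j k hjk
  · exact h₂ (congrFun (congrArg obj h) j)
  · exact h₁ (congrFun (congrFun (congrFun (congrArg arr h) j) k) hjk)

/-- The commutator of `const g` with the coboundary of a function supported at one vertex is again
such a coboundary, with value `ᵍy y⁻¹`. Finiteness of `ι` lets an arbitrary function be built from
these. -/
theorem mem_commutator [OrderTop ι] [Finite ι] (x : X.Diagram ι)
    (h₁ : ∀ j, x.arr j ⊤ le_top ∈ X.commTop) (h₂ : x.obj ⊤ ∈ commutator G) :
    x ∈ commutator (X.Diagram ι) := by
  classical
  rw [eq_coboundary_mul_const x]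
  refine mul_mem ?_ ?_
  · refine Subgroup.pi_mem_of_mulSingle_mem
      (H := (commutator (X.Diagram ι)).comap (coboundary X ι)) _ fun j => ?_
    have h : X.commTop ≤ (commutator (X.Diagram ι)).comap
        ((coboundary X ι).comp (MonoidHom.mulSingle (fun _ => H) j)) := by
      refine Subgroup.normalClosure_le_normal ?_
      rintro _ ⟨g, y, rfl⟩
      have h1 : (fun k => X.act g ((Pi.mulSingle j y : ι → H) k)) = Pi.mulSingle j (X.act g y) := by
        funext k
        exact (Pi.apply_mulSingle (fun _ => X.act g) (fun _ => map_one _) j y k)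
      have h2 := Subgroup.commutator_mem_commutator (Subgroup.mem_top (const X ι g))
        (Subgroup.mem_top (coboundary X ι (Pi.mulSingle j y)))
      rw [commutatorElement_def, const_conj_coboundary, h1] at h2
      rw [← map_inv, ← map_mul, ← Pi.mulSingle_inv, ← Pi.mulSingle_mul] at h2
      exact h2
    exact h (h₁ j)
  · have h : (commutator G).map (const X ι) ≤ commutator (X.Diagram ι) := by
      rw [commutator_def, commutator_def, Subgroup.map_commutator]
      exact Subgroup.commutator_mono le_top le_top
    exact h ⟨_, h₂, rfl⟩

end

section Exact

variable {R' F' R F H G : Type u} [Group R'] [Group F'] [Group R] [Group F] [Group H] [Group G]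
  {X' : CrossedModule R' F'} {X : CrossedModule R F} {Y : CrossedModule H G}
  {i : Hom X' X} {p : Hom X Y} {ι : Type} [Preorder ι]

theorem map_map_eq_one (e : IsShortExact i p) (x : X'.Diagram ι) : map p (map i x) = 1 := by
  ext
  · simp [e.p_i_bot]
  · simp [e.p_i_top]

theorem ker_map_le (e : IsShortExact i p) : (map (ι := ι) p).ker ≤ (map i).range := by
  intro x hx
  have h₁ (j k h) : ∃ r, i.top r = x.arr j k h :=
    e.exists_top (congrFun (congrFun (congrFun (congrArg arr hx) j) k) h)
  have h₂ (j) : ∃ f, i.bot f = x.obj j := e.exists_bot (congrFun (congrArg obj hx) j)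
  choose r hr using h₁
  choose f hf using h₂
  refine ⟨⟨f, r, fun j k h => e.bot_injective ?_, fun j k l h h' => e.top_injective ?_⟩, ?_⟩
  · rw [map_mul, i.comm, hr, hf, hf, x.target]
  · rw [map_mul, hr, hr, hr, x.comp]
  · ext j k h
    · exact hf j
    · exact hr j k h

/-- The abelianisation of diagrams. -/
def toAb (e : IsShortExact i p) : X'.Diagram ι →* Multiplicative (AbDiagram X'.ab ι) :=
  MonoidHom.mk' (fun x => Multiplicative.ofAdd
    { obj := fun j => e.clsBot (x.obj j)
      arr := fun j k h => e.clsTop (x.arr j k h)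
      target := fun j k h => by
        rw [← x.target j k h, e.ab_cls]
        rfl
      comp := fun j k l h h' => by
        rw [← x.comp j k l h h']
        rfl }) fun x y => by
    refine congrArg Multiplicative.ofAdd (AbDiagram.ext rfl ?_)
    funext j k h
    exact (e.clsTop_mul _ _).trans (congrArg _ (e.clsTop_act _ _))

theorem toAb_obj (e : IsShortExact i p) (x : X'.Diagram ι) (j : ι) :
    (toAb e x).toAdd.obj j = e.clsBot (x.obj j) := rfl

theorem toAb_arr (e : IsShortExact i p) (x : X'.Diagram ι) (j k : ι) (h : j ≤ k) :
    (toAb e x).toAdd.arr j k h = e.clsTop (x.arr j k h) := rfl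

theorem toAb_surjective [OrderTop ι] (e : IsShortExact i p) :
    Function.Surjective (toAb (ι := ι) e) := by
  intro y
  obtain ⟨f, hf⟩ := e.clsBot_surjective (y.toAdd.obj ⊤)
  have hr (j) := e.clsTop_surjective (y.toAdd.arr j ⊤ le_top)
  choose r hr using hr
  refine ⟨coboundary X' ι r * const X' ι f, congrArg Multiplicative.ofAdd
    (AbDiagram.ext (y := y.toAdd) ?_ ?_)⟩
  · funext j
    rw [← y.toAdd.target j ⊤ le_top, ← hr, ← hf]
    rfl
  · funext j k h
    have := y.toAdd.comp j k ⊤ h le_top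
    rw [← hr, ← hr] at this
    rw [eq_sub_of_add_eq this]
    simp [IsShortExact.clsTop, sub_eq_add_neg]

/-- With surjectivity this says that forming the nerve commutes with abelianisation, as the relation
sequence requires. -/
theorem ker_toAb_le [OrderTop ι] [Finite ι] (e : IsShortExact i p) :
    (toAb (ι := ι) e).ker ≤ commutator (X'.Diagram ι) := by
  intro x hx
  have hx' : (toAb e x).toAdd = 0 := congrArg Multiplicative.toAdd hx
  refine mem_commutator x (fun j => ?_) ?_
  · have h : e.clsTop (x.arr j ⊤ le_top) = 0 := by rw [← toAb_arr, hx']; rfl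
    exact (QuotientGroup.eq_one_iff _).1 (congrArg Additive.toMul h)
  · have h : e.clsBot (x.obj ⊤) = 0 := by rw [← toAb_obj, hx']; rfl
    rw [← Abelianization.ker_of]
    exact congrArg Additive.toMul h

/-- This matches the explicit formula of `diagramAct` with conjugation in the nerve of `X`, the
action that occurs in the relation sequence. -/
theorem exists_conj (e : IsShortExact i p) (x : X.Diagram ι) (k : X'.Diagram ι) :
    ∃ k', map i k' = x * map i k * x⁻¹ ∧
      (toAb e k').toAdd = e.abAction.diagramAct (map p x) (toAb e k).toAdd := by
  obtain ⟨k', hk'⟩ : x * map i k * x⁻¹ ∈ (map i).range :=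
    ker_map_le e (by
      rw [MonoidHom.mem_ker, map_mul, map_mul, map_map_eq_one e]
      simp)
  refine ⟨k', hk', AbDiagram.ext ?_ ?_⟩
  · funext j
    have h : k'.obj j = e.conjBot (x.obj j) (k.obj j) := e.bot_injective (by
      rw [e.i_conjBot]
      exact congrFun (congrArg obj hk') j)
    rw [toAb_obj, h, ← e.abAction_actA]
    rfl
  · funext j l h
    -- The two factors give the two summands in the arrow component of `diagramAct`.
    have h' : k'.arr j l h = e.conjTop (x.obj j) (k.arr j l h) *
        e.bracket (x.arr j l h) (e.conjBot (x.obj l) (k.obj l)) := e.top_injective (by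
      rw [map_mul, e.i_conjTop, e.i_bracket, e.i_conjBot, x.act_obj j l h]
      refine (congrFun (congrFun (congrFun (congrArg arr hk') j) l) h).trans ?_
      simp [MulAut.mul_apply, mul_assoc])
    rw [toAb_arr, h', e.clsTop_mul, ← e.abAction_actC, ← e.abAction_ξ, ← e.abAction_actA]
    rfl

/-- The homomorphism from the abelianised kernel to the relation module of diagrams. -/
noncomputable def toRel [OrderTop ι] [Finite ι] (e : IsShortExact i p) :
    AbDiagram X'.ab ι →+ BarComplex.Rel (map (ι := ι) p) :=
  BarComplex.abToRel (map p) (map i) (map_map_eq_one e) (toAb e) (toAb_surjective e)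
    (ker_toAb_le e)

theorem toRel_toAb [OrderTop ι] [Finite ι] (e : IsShortExact i p) (k : X'.Diagram ι) :
    toRel e (toAb e k).toAdd = BarComplex.relOf (map p) 1 (map i k) :=
  BarComplex.abToRel_apply ..

end Exact

end Diagram

end CrossedModule

/-! ### The relation sequence of a presentation -/

namespace SimplicialAction

variable {G E : SimplicialObject GrpCat.{u}} (π : E ⟶ G)

/-- The generators of the relation module. -/
def relationOf (n : SimplexCategoryᵒᵖ) (g : G.obj n) (e : E.obj n) :
    (bar₂ π).range.quotObj.obj n :=
  (bar₂ π).range.proj.app n (freeOf g e)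

theorem relationOf_map {m n : SimplexCategoryᵒᵖ} (f : m ⟶ n) (g : G.obj m) (e : E.obj m) :
    (bar₂ π).range.quotObj.map f (relationOf π m g e) = relationOf π n (G.map f g) (E.map f e) :=
  ((bar₂ π).range.proj.map_app f _).symm.trans (congrArg _ (freeObj_map f g e))

theorem relationOf_act (n : SimplexCategoryᵒᵖ) (h g : G.obj n) (e : E.obj n) :
    (relationModule π).act n h (relationOf π n g e) = relationOf π n (h * g) e :=
  ((bar₂ π).range.proj.act_app n h _).symm.trans (congrArg _ (freeAction_act n h g e))

theorem relationModuleToRange_relationOf (n : SimplexCategoryᵒᵖ) (e : E.obj n)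
    (he : π.app n e = 1) : (relationModuleToRange π).app n (relationOf π n 1 e) = 0 := by
  refine Subtype.ext ((BarComplex.d₁_of (π.app n).hom 1 e).trans ?_)
  rw [show (π.app n).hom e = 1 from he, one_mul]
  exact sub_self _

end SimplicialAction

namespace CrossedModule

variable {H G H' G' : Type u} [Group H] [Group G] [Group H'] [Group G']
  {X : CrossedModule H G} {X' : CrossedModule H' G'}

/-- The map of nerves induced by a morphism of crossed modules. -/
def Hom.nerve (f : Hom X X') : X.nerve ⟶ X'.nerve where
  app _ := GrpCat.ofHom (Diagram.map f)
  naturality _ _ _ := rfl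

namespace IsShortExact

open SimplicialAction

variable {R' F' R F H G : Type u} [Group R'] [Group F'] [Group R] [Group F] [Group H] [Group G]
  {X' : CrossedModule R' F'} {X : CrossedModule R F} {Y : CrossedModule H G}
  {i : Hom X' X} {p : Hom X Y}

theorem toRel_toAb_eq (e : IsShortExact i p) (n : SimplexCategoryᵒᵖ)
    (k : X'.Diagram (Fin (n.unop.len + 1))) :
    (Diagram.toRel e (Diagram.toAb e k).toAdd : (bar₂ p.nerve).range.quotObj.obj n) =
      relationOf p.nerve n (1 : Y.Diagram (Fin (n.unop.len + 1))) (Diagram.map i k) :=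
  Diagram.toRel_toAb e k

theorem relationOf_conj (e : IsShortExact i p) (n : SimplexCategoryᵒᵖ)
    (x : X.Diagram (Fin (n.unop.len + 1))) (k k' : X'.Diagram (Fin (n.unop.len + 1)))
    (h : Diagram.map i k' = x * Diagram.map i k * x⁻¹) :
    relationOf p.nerve n (Diagram.map p x) (Diagram.map i k) =
      relationOf p.nerve n (1 : Y.Diagram (Fin (n.unop.len + 1))) (Diagram.map i k') :=
  BarComplex.relOf_conj (Diagram.map p) (Diagram.map i) x k k' (Diagram.map_map_eq_one e k') h

/-- The homomorphism from the nerve of the abelianised kernel to the relation module. -/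
noncomputable def relation (e : IsShortExact i p) :
    SimplicialAction.Hom e.abAction.nerveAction (relationModule p.nerve) where
  app n := Diagram.toRel (ι := Fin (n.unop.len + 1)) e
  map_app {m n} f a := by
    obtain ⟨k, hk⟩ := Diagram.toAb_surjective e (Multiplicative.ofAdd a)
    obtain rfl : (Diagram.toAb e k).toAdd = a := congrArg Multiplicative.toAdd hk
    refine Eq.trans ?_ (congrArg ((bar₂ p.nerve).range.quotObj.map f) (e.toRel_toAb_eq m k).symm)
    refine Eq.trans ?_ (relationOf_map p.nerve f _ _).symm
    refine (e.toRel_toAb_eq n (Diagram.restrict f.unop.toOrderHom k)).trans ?_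
    exact congrArg (fun g => relationOf p.nerve n g _) (map_one (Y.nerve.map f).hom).symm
  act_app n g a := by
    obtain ⟨x, rfl⟩ := Diagram.map_surjective p e.top_surjective e.bot_surjective g
    obtain ⟨k, hk⟩ := Diagram.toAb_surjective e (Multiplicative.ofAdd a)
    obtain rfl : (Diagram.toAb e k).toAdd = a := congrArg Multiplicative.toAdd hk
    -- Acting by the image of `x` on the class of `k` means conjugating `k` by `x`, which the
    -- relation module turns into multiplication by that image.
    obtain ⟨k', hk', h⟩ := Diagram.exists_conj e x k
    refine (congrArg (Diagram.toRel e) h.symm).trans ((e.toRel_toAb_eq n k').trans ?_)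
    refine (e.relationOf_conj n x k k' hk').symm.trans ?_
    refine Eq.trans ?_ (congrArg ((relationModule p.nerve).act n (Diagram.map p x))
      (e.toRel_toAb_eq n k)).symm
    refine Eq.trans ?_ (relationOf_act p.nerve n _ _ _).symm
    exact congrArg (fun g => relationOf p.nerve n g _) (mul_one (Diagram.map p x)).symm

theorem relation_injective (e : IsShortExact i p) (n) : Function.Injective (e.relation.app n) :=
  BarComplex.abToRel_injective (Diagram.map p) (Diagram.map i) (Diagram.map_map_eq_one e)
    (Diagram.toAb (ι := Fin (n.unop.len + 1)) e) (Diagram.toAb_surjective e)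
    (Diagram.ker_toAb_le e)
    (Diagram.map_surjective p e.top_surjective e.bot_surjective) (Diagram.ker_map_le e)
    (Diagram.map_injective i e.top_injective e.bot_injective)

theorem relation_exact (e : IsShortExact i p) (n) :
    Function.Exact (e.relation.app n) ((relationModuleToRange p.nerve).app n) := by
  intro x
  constructor
  · obtain ⟨x, rfl⟩ := (bar₂ p.nerve).range.proj_surjective n x
    intro h
    exact BarComplex.exists_abToRel (Diagram.map p) (Diagram.map i) (Diagram.map_map_eq_one e)
      (Diagram.toAb (ι := Fin (n.unop.len + 1)) e) (Diagram.toAb_surjective e)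
      (Diagram.ker_toAb_le e)
      (Diagram.map_surjective p e.top_surjective e.bot_surjective) (Diagram.ker_map_le e)
      (congrArg Subtype.val h)
  · rintro ⟨a, rfl⟩
    obtain ⟨k, hk⟩ := Diagram.toAb_surjective e (Multiplicative.ofAdd a)
    obtain rfl : (Diagram.toAb e k).toAdd = a := congrArg Multiplicative.toAdd hk
    exact (congrArg ((relationModuleToRange p.nerve).app n) (e.toRel_toAb_eq n k)).trans
      (relationModuleToRange_relationOf p.nerve n _ (Diagram.map_map_eq_one e k))

end IsShortExact

end CrossedModule

/-! ### The free crossed module -/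

/-- The free product of two free groups is free. -/
def freeGroupSumEquiv (S T : Type*) :
    FreeGroup (S ⊕ T) ≃* Monoid.Coprod (FreeGroup S) (FreeGroup T) :=
  MonoidHom.toMulEquiv
    (FreeGroup.lift (Sum.elim (Monoid.Coprod.inl ∘ FreeGroup.of) (Monoid.Coprod.inr ∘ FreeGroup.of)))
    (Monoid.Coprod.lift (FreeGroup.map Sum.inl) (FreeGroup.map Sum.inr))
    (FreeGroup.ext_hom _ _ (by rintro (s | t) <;> simp))
    (Monoid.Coprod.hom_ext (FreeGroup.ext_hom _ _ fun s => by simp)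
      (FreeGroup.ext_hom _ _ fun s => by simp))

namespace CrossedModule

variable {R F : Type u} [Group R] [Group F] {X : CrossedModule R F}

namespace Diagram

variable {ι : Type} [Preorder ι]

/-- For injective `μ` there is at most one arrow between two objects, so a simplex is the list of
its vertices. -/
theorem ext_of_injective (hμ : Function.Injective X.μ) {x y : X.Diagram ι}
    (h : ∀ j, x.obj j = y.obj j) : x = y := by
  ext j k hjk
  · exact h j
  · apply hμ
    rw [eq_mul_inv_of_mul_eq (x.target j k hjk), eq_mul_inv_of_mul_eq (y.target j k hjk), h, h]

variable {Q : Type u} [Group Q] (ϖ : F →* Q)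

theorem exists_arr (h : ϖ.ker ≤ X.μ.range) {f f' : F} (hf : ϖ f = ϖ f') :
    ∃ r, X.μ r = f * f'⁻¹ :=
  h (by simp [MonoidHom.mem_ker, hf])

/-- The diagram with prescribed objects in the same component, if `μ` is injective. -/
noncomputable def ofObj (hμ : Function.Injective X.μ) (h : ϖ.ker ≤ X.μ.range) (o : ι → F)
    (ho : ∀ j k, ϖ (o j) = ϖ (o k)) : X.Diagram ι where
  obj := o
  arr j k _ := (exists_arr ϖ h (ho j k)).choose
  target j k _ := by
    rw [(exists_arr ϖ h (ho j k)).choose_spec, inv_mul_cancel_right]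
  comp j k l _ _ := by
    apply hμ
    rw [map_mul, (exists_arr ϖ h (ho j k)).choose_spec, (exists_arr ϖ h (ho k l)).choose_spec,
      (exists_arr ϖ h (ho j l)).choose_spec]
    group

theorem apply_obj_eq (h' : ∀ r, ϖ (X.μ r) = 1) [OrderTop ι] (x : X.Diagram ι) (j k : ι) :
    ϖ (x.obj j) = ϖ (x.obj k) := by
  rw [← x.target j ⊤ le_top, ← x.target k ⊤ le_top, map_mul, map_mul, h', h']

end Diagram

section

variable {Q : Type u} [Group Q] (ϖ : F →* Q) (t : Q → F) (ht : ∀ q, ϖ (t q) = q)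
  (hμ : Function.Injective X.μ) (h : ϖ.ker ≤ X.μ.range) (h' : ∀ r, ϖ (X.μ r) = 1)

/-- The nerve of the inclusion of a normal subgroup is homotopy equivalent to the quotient. -/
noncomputable def extraDegeneracy : ExtraDegeneracy X.nerve Q where
  ε x := ϖ (Diagram.obj x (0 : Fin 1))
  σ q := Diagram.const X (Fin 1) (t q)
  -- The new vertex 0 is the chosen representative of the coset containing all vertices of `x`. The
  -- section `t` need not be multiplicative.
  s p x := Diagram.ofObj (ι := Fin (p + 2)) ϖ hμ h
    (Fin.cons (t (ϖ (Diagram.obj x (0 : Fin (p + 1))))) fun j : Fin (p + 1) => Diagram.obj x j) (by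
      have h0 : ∀ j : Fin (p + 2), ϖ ((Fin.cons (t (ϖ (Diagram.obj x (0 : Fin (p + 1)))))
          fun j : Fin (p + 1) => Diagram.obj x j : Fin (p + 2) → F) j) =
            ϖ (Diagram.obj x (0 : Fin (p + 1))) := by
        refine Fin.cases (ht _) fun j => ?_
        exact Diagram.apply_obj_eq (ι := Fin (p + 1)) ϖ h' x j 0
      exact fun j k => (h0 j).trans (h0 k).symm)
  ε_σ := ht
  ε_δ x := Diagram.apply_obj_eq (ι := Fin 2) ϖ h' x 1 0
  δ_zero_s _ _ := Diagram.ext_of_injective hμ fun _ => rfl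
  δ_one_s _ := Diagram.ext_of_injective (ι := Fin 1) hμ (Fin.forall_fin_one.2 rfl)
  δ_succ_s p i x := by
    refine Diagram.ext_of_injective (ι := Fin (p + 2)) hμ (Fin.cases ?_ fun j => ?_)
    -- The face may drop the old vertex 0, but any other vertex determines the same representative.
    · exact congrArg t (Diagram.apply_obj_eq (ι := Fin (p + 2)) ϖ h' x 0 (i.succAbove 0))
    · change (Fin.cons _ _ : Fin (p + 3) → F) (i.succ.succAbove j.succ) = _
      rw [Fin.succ_succAbove_succ]
      rfl

/-- The group of vertices of the nerve. -/
def vertexEquiv : F ≃* X.nerve.obj (Opposite.op ⦋0⦌) :=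
  MulEquiv.mk' (M := F) (N := X.Diagram (Fin 1))
    { toFun := Diagram.const X (Fin 1)
      invFun := fun x => x.obj 0
      left_inv := fun _ => rfl
      right_inv := fun _ => Diagram.ext_of_injective hμ (Fin.forall_fin_one.2 rfl) }
    (map_mul (Diagram.const X (Fin 1)))

end

/-- A free crossed module is the inclusion of the kernel of a split surjection of free groups. -/
theorem IsFree.exists_data (hX : X.IsFree) : ∃ (S : Type u) (_ : FreeGroup (S ⊕ S) ≃* F)
    (ϖ : F →* FreeGroup S) (t : FreeGroup S → F), (∀ q, ϖ (t q) = q) ∧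
      Function.Injective X.μ ∧ ϖ.ker ≤ X.μ.range ∧ ∀ r, ϖ (X.μ r) = 1 := by
  obtain ⟨S, e, h₁, h₂⟩ := hX
  let b : Monoid.Coprod (FreeGroup S) (FreeGroup S) ≃* F := MulEquiv.ofBijective e.bot h₂
  let ρ : Monoid.Coprod (FreeGroup S) (FreeGroup S) →* FreeGroup S :=
    Monoid.Coprod.lift 1 (MonoidHom.id _)
  have hb (h : freeTop S) : b.symm (X.μ (e.top h)) = h.1 := by
    rw [← e.comm]
    exact b.symm_apply_apply h.1
  refine ⟨S, (freeGroupSumEquiv S S).trans b, ρ.comp b.symm.toMonoidHom,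
    fun q => b (Monoid.Coprod.inr q), fun q => ?_, fun r r' hr => ?_, fun f hf => ?_, fun r => ?_⟩
  · simp [ρ]
  · obtain ⟨h, rfl⟩ := h₁.2 r
    obtain ⟨h', rfl⟩ := h₁.2 r'
    rw [Subtype.ext ((hb h).symm.trans ((congrArg b.symm hr).trans (hb h')))]
  · exact ⟨e.top ⟨b.symm f, hf⟩, (e.comm _).symm.trans (b.apply_symm_apply f)⟩
  · obtain ⟨h, rfl⟩ := h₁.2 r
    exact (congrArg ρ (hb h)).trans h.2

end CrossedModule

/-! ### The augmentation sequence and the theorem -/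

namespace BarComplex

open FreeAbelianGroup (of lift lift_ext lift_apply_of)

variable {E G : Type*} [Group E] [Group G] (π : E →* G)

/-- The augmentation. -/
def degree (G : Type*) : FreeAbelianGroup (G × PUnit.{u + 1}) →+ ULift.{u} ℤ :=
  lift fun _ => ⟨1⟩

theorem degree_d₁ (x : FreeAbelianGroup (G × E)) : degree.{u} G (d₁ π x) = 0 := by
  refine DFunLike.congr_fun (f := (degree G).comp (d₁ π)) (g := 0) (lift_ext _ _ ?_) x
  rintro ⟨g, e⟩
  simp [degree]

theorem degree_surjective : Function.Surjective (degree.{u} G) := fun x =>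
  ⟨x.down • of (1, ⟨⟩), by
    rw [map_zsmul, degree, lift_apply_of]
    exact ULift.ext _ _ ((smul_eq_mul _ _).trans (mul_one _))⟩

/-- Modulo the image of `d₁` every basis element `g = π e` equals `1`, so the quotient is generated
by one element and the class of `x` is its degree times that generator. -/
theorem exists_d₁ (hπ : Function.Surjective π) {x : FreeAbelianGroup (G × PUnit.{u + 1})}
    (hx : degree G x = 0) : ∃ y, d₁ π y = x := by
  have h : QuotientAddGroup.mk' (d₁.{u} π).range =
      ((zmultiplesHom _ (QuotientAddGroup.mk' (d₁.{u} π).range (of (1, ⟨⟩)))).comp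
        AddEquiv.ulift.toAddMonoidHom).comp (degree G) := by
    refine lift_ext _ _ ?_
    rintro ⟨g, ⟨⟩⟩
    obtain ⟨e, rfl⟩ := hπ g
    have h0 : QuotientAddGroup.mk' (d₁.{u} π).range (d₁.{u} π (of (1, e))) = 0 :=
      (QuotientAddGroup.eq_zero_iff _).2 ⟨_, rfl⟩
    rw [d₁_of, map_sub, sub_eq_zero, one_mul] at h0
    rw [h0]
    simp only [AddMonoidHom.comp_apply, degree, lift_apply_of]
    exact (one_zsmul _).symm
  have h' := DFunLike.congr_fun h x
  rw [AddMonoidHom.comp_apply _ (degree G), hx, map_zero] at h'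
  exact (QuotientAddGroup.eq_zero_iff _).1 h'

end BarComplex

namespace CrossedModule

open SimplicialAction

variable {H G A : Type u} [Group H] [Group G] [AddCommGroup A]

/-- Constant diagrams. -/
def AbDiagram.const {C : Type u} [AddCommGroup C] (ν : C →+ A) (ι : Type) [Preorder ι] :
    A →+ AbDiagram ν ι where
  toFun a :=
    { obj := fun _ => a
      arr := fun _ _ _ => 0
      target := fun _ _ _ => by simp
      comp := fun _ _ _ _ _ => by simp }
  map_zero' := rfl
  map_add' _ _ := by ext <;> simp

theorem AbDiagram.const_surjective (ι : Type) [Preorder ι] [OrderTop ι] :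
    Function.Surjective (AbDiagram.const (0 : PUnit.{u + 1} →+ A) ι) := by
  intro x
  refine ⟨x.obj ⊤, AbDiagram.ext (funext fun j => ?_) rfl⟩
  exact (zero_add _).symm.trans (x.target j ⊤ le_top)

/-- The augmentation of the bar complex. -/
def augmentation (Y : CrossedModule H G) :
    SimplicialAction.Hom (freeAction Y.nerve trivialSimplicialGroup)
      (Y.trivialAction (ULift.{u} ℤ)).nerveAction where
  app n := (AbDiagram.const 0 (Fin (n.unop.len + 1))).comp
    (BarComplex.degree (Y.Diagram (Fin (n.unop.len + 1))))
  map_app {m n} f a := by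
    refine DFunLike.congr_fun (f := ((AbDiagram.const 0 (Fin (n.unop.len + 1))).comp
      (BarComplex.degree (Y.Diagram (Fin (n.unop.len + 1))))).comp
        ((freeObj Y.nerve trivialSimplicialGroup).map f).hom)
      (g := (AddCommGrpCat.Hom.hom ((abNerve (0 : PUnit.{u + 1} →+ ULift.{u} ℤ)).map f)).comp
        ((AbDiagram.const 0 (Fin (m.unop.len + 1))).comp
          (BarComplex.degree (Y.Diagram (Fin (m.unop.len + 1))))))
      (free_hom_ext fun g t => ?_) a
    refine (congrArg (fun x => AbDiagram.const 0 (Fin (n.unop.len + 1))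
      (BarComplex.degree (Y.Diagram (Fin (n.unop.len + 1))) x)) (freeObj_map f g t)).trans ?_
    refine (congrArg (AbDiagram.const 0 (Fin (n.unop.len + 1)))
      (FreeAbelianGroup.lift_apply_of _ _)).trans ?_
    exact (congrArg (fun x => (abNerve (0 : PUnit.{u + 1} →+ ULift.{u} ℤ)).map f
      (AbDiagram.const 0 (Fin (m.unop.len + 1)) x)) (FreeAbelianGroup.lift_apply_of _ _)).symm
  act_app n h a := by
    refine DFunLike.congr_fun (f := ((AbDiagram.const 0 (Fin (n.unop.len + 1))).comp
      (BarComplex.degree (Y.Diagram (Fin (n.unop.len + 1))))).comp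
        ((freeAction Y.nerve trivialSimplicialGroup).act n h))
      (g := (AbDiagram.const 0 (Fin (n.unop.len + 1))).comp
          (BarComplex.degree (Y.Diagram (Fin (n.unop.len + 1)))))
      (free_hom_ext fun g t => ?_) a
    refine (congrArg (fun x => AbDiagram.const 0 (Fin (n.unop.len + 1))
      (BarComplex.degree (Y.Diagram (Fin (n.unop.len + 1))) x)) (freeAction_act n h g t)).trans ?_
    exact congrArg (AbDiagram.const 0 (Fin (n.unop.len + 1)))
      ((FreeAbelianGroup.lift_apply_of _ _).trans (FreeAbelianGroup.lift_apply_of _ _).symm)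

theorem augmentation_surjective (Y : CrossedModule H G) (n) :
    Function.Surjective (Y.augmentation.app n) :=
  (AbDiagram.const_surjective (Fin (n.unop.len + 1))).comp BarComplex.degree_surjective

theorem IsShortExact.augmentation_exact {R' F' R F : Type u} [Group R'] [Group F'] [Group R]
    [Group F] {X' : CrossedModule R' F'} {X : CrossedModule R F} {Y : CrossedModule H G}
    {i : Hom X' X} {p : Hom X Y} (e : IsShortExact i p) (n) :
    Function.Exact ((bar₁ p.nerve).app n) (Y.augmentation.app n) := by
  intro x
  constructor
  · intro h
    exact BarComplex.exists_d₁ (Diagram.map p)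
      (Diagram.map_surjective p e.top_surjective e.bot_surjective)
      -- Evaluation at a vertex recovers the integer from a constant diagram.
      (congrArg (fun a : AbDiagram _ (Fin (n.unop.len + 1)) => a.obj ⊤) h)
  · rintro ⟨y, rfl⟩
    exact (congrArg (AbDiagram.const 0 (Fin (n.unop.len + 1)))
      (BarComplex.degree_d₁ (Diagram.map p) y)).trans (map_zero _)

end CrossedModule

/-- For a free presentation `0 → (R', F', η') → (R, F, η) → (H, G, μ) → 0` of a crossed module,
`H_3(H, G, μ) ≅ H_1((H, G, μ), (R', F', η')_ab)`. -/
theorem proposition8 {R' F' R F H G : Type u} [Group R'] [Group F'] [Group R] [Group F]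
    [Group H] [Group G] (X' : CrossedModule R' F') (X : CrossedModule R F)
    (Y : CrossedModule H G) (i : CrossedModule.Hom X' X) (p : CrossedModule.Hom X Y)
    (hX : X.IsFree) (hs : CrossedModule.IsShortExact i p) :
    Nonempty (Y.integralHomology 3 ≃+ CrossedModule.homology hs.abAction 1) := by
  obtain ⟨S, b, ϖ, t, ht, hμ, h, h'⟩ := hX.exists_data
  -- The two free groups needed are `Q`, free on `S`, and the vertex group `F` of the nerve, free on
  -- `S ⊕ S`.
  obtain ⟨e⟩ := SimplicialAction.nonempty_homology_iso_of_relation p.nerve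
    (CrossedModule.extraDegeneracy ϖ t ht hμ h h') (fun _ _ => map_mul ϖ _ _)
    (BarComplex.foxFreeGroup S)
    ((BarComplex.foxFreeGroup (S ⊕ S)).transport (b.trans (CrossedModule.vertexEquiv hμ)))
    hs.relation hs.relation_injective hs.relation_exact Y.augmentation
    Y.augmentation_surjective hs.augmentation_exact
  exact ⟨e.toLinearEquiv.toAddEquiv⟩
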